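/- Let $V$ be a set of $n\ge 1$ vertices. A cut tree on $V$ is an edge-weighted tree $T$ with vertex set $V$ and real edge weights. For distinct $x,y\in V$, an $xy$-cut of $T$ is a bipartition $(X,V\setminus X)$ with $x\in X$, $y\notin X$ given by the two components of $T\setminus\{e\}$ for an edge $e$ of $T$; its weight is $w(e)$. A minimum $xy$-cut of $T$ is an $xy$-cut of $T$ of smallest weight (that is, one given by a lightest edge on the $x$-to-$y$ path in $T$). Given cut trees $T_1,\dots,T_k$ on $V$ ($k\ge 1$), a best $xy$-cut of the family is a minimum $xy$-cut of some $T_i$ whose weight is the smallest among the weights of the minimum $xy$-cuts of $T_1,\dots,T_k$. Two bipartitions $(A,B)$ and $(X,Y)$ cross if $A\cap X$, $A\cap Y$, $B\cap X$, $B\cap Y$ are all non-empty. There is an algorithm that, given $k\ge 1$ cut trees $T_1,\dots,T_k$ on a common set $V$ of $n\ge 1$ vertices such that no best $ab$-cut of the family crosses a best $xy$-cut of the family, for any $a\neq b$ and $x\ne y$ in $V$, computes in time $O(kn\log^2 n)$ (read as $O(k)$ for $n=1$) a single cut tree $T_0$ on $V$ such that, for all distinct $x,y\in V$, the weight of a minimum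 $xy$-cut of $T_0$ is the minimum over $i=1,\dots,k$ of the weight of a minimum $xy$-cut of $T_i$, and every minimum $xy$-cut of $T_0$ is, as a bipartition of $V$, a best $xy$-cut of the family. Here time is the number of steps on a word RAM whose words have at least $c(\lfloor\log_2(kn)\rfloor+1)$ bits for a suitable absolute constant $c$ (in particular $O(\log(kn)+1)$ bits suffice), on which edge weights are real numbers that can only be copied and compared; each tree is given, and $T_0$ is returned, as a list of its $n-1$ weighted edges. -/

import Mathlib

namespace CutMerge

/-! ### Cut trees and the cuts they represent -/

/-- An edge-weighted tree on the vertex set `V`. -/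
structure CutTree (V : Type) where
  graph : SimpleGraph V
  isTree : graph.IsTree
  weight : Sym2 V → ℝ

/-- The side containing `x` of the bipartition of `V` obtained by removing the edge `e`. -/
def CutTree.side {V : Type} (T : CutTree V) (e : Sym2 V) (x : V) : Set V :=
  {z | (T.graph.deleteEdges {e}).Reachable x z}

/-- `(X, Xᶜ)` is an `xy`-cut (`x ∈ X`, `y ∉ X`) of weight `c` represented by an edge of `T`. -/
def CutTree.IsCut {V : Type} (T : CutTree V) (x y : V) (X : Set V) (c : ℝ) : Prop :=
  ∃ e ∈ T.graph.edgeSet, T.side e x = X ∧ y ∉ X ∧ T.weight e = c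

/-- `(X, Xᶜ)` is a minimum `xy`-cut of `T`, and its weight is `c`. -/
def CutTree.IsMinCut {V : Type} (T : CutTree V) (x y : V) (X : Set V) (c : ℝ) : Prop :=
  T.IsCut x y X c ∧ ∀ X' c', T.IsCut x y X' c' → c ≤ c'

/-- `(X, Xᶜ)`, of weight `c`, is a minimum `xy`-cut of one of the trees of the family, and no
tree of the family has a lighter minimum `xy`-cut. -/
def IsBestCut {V ι : Type} (T : ι → CutTree V) (x y : V) (X : Set V) (c : ℝ) : Prop :=
  (∃ i, (T i).IsMinCut x y X c) ∧ ∀ j X' c', (T j).IsMinCut x y X' c' → c ≤ c'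

/-- The bipartitions `(A, Aᶜ)` and `(X, Xᶜ)` cross: no side of one is contained in a side of the
other. -/
def Crosses {V : Type} (A X : Set V) : Prop :=
  (A ∩ X).Nonempty ∧ (A ∩ Xᶜ).Nonempty ∧ (Aᶜ ∩ X).Nonempty ∧ (Aᶜ ∩ Xᶜ).Nonempty

/-- The minimum cuts of the family (best over all its trees) pairwise do not cross. -/
def NonCrossing {V ι : Type} (T : ι → CutTree V) : Prop :=
  ∀ (a b x y : V) (A X : Set V) (c d : ℝ),
    IsBestCut T a b A c → IsBestCut T x y X d → ¬ Crosses A X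

/-- `T₀` merges the family: for every pair `x ≠ y`, the minimum `xy`-cut value of `T₀` is the best
over the family, and every minimum `xy`-cut of `T₀` is, as a bipartition, a best one of the
family. -/
def IsMerge {V ι : Type} (T : ι → CutTree V) (T₀ : CutTree V) : Prop :=
  ∀ x y : V, x ≠ y →
    (∀ c, (∃ X, T₀.IsMinCut x y X c) ↔ ∃ X, IsBestCut T x y X c) ∧
    ∀ X c, T₀.IsMinCut x y X c → IsBestCut T x y X c

/-! ### A word RAM with comparison-only weights

Words are natural numbers below `2 ^ w`. There are word registers, a word memory with indirect
addressing, and separate registers and memory for weights, which are real numbers that can only be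
copied and compared. Programs are built from instructions by sequencing, branching and
`while`-loops; every instruction and every evaluation of a test costs one step. -/

structure State where
  reg : ℕ → ℕ
  mem : ℕ → ℕ
  wreg : ℕ → ℝ
  wmem : ℕ → ℝ

inductive ArithOp
  | add
  | sub
  | mul
  | div

/-- Word arithmetic; subtraction is truncated at `0`, division is rounded down (and `a / 0 = 0`). -/
def ArithOp.eval : ArithOp → ℕ → ℕ → ℕ
  | .add, a, b => a + b
  | .sub, a, b => a - b
  | .mul, a, b => a * b
  | .div, a, b => a / b

inductive Instr
  /-- `reg d := c` -/
  | const (d c : ℕ)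
  /-- `reg d := reg a` -/
  | move (d a : ℕ)
  /-- `reg d := reg a ∘ reg b` -/
  | arith (o : ArithOp) (d a b : ℕ)
  /-- `reg d := mem[reg a]` -/
  | load (d a : ℕ)
  /-- `mem[reg a] := reg b` -/
  | store (a b : ℕ)
  /-- `wreg d := wreg a` -/
  | wmove (d a : ℕ)
  /-- `wreg d := wmem[reg a]` -/
  | wload (d a : ℕ)
  /-- `wmem[reg a] := wreg b` -/
  | wstore (a b : ℕ)

/-- The effect of an instruction on a machine with word length `w`. -/
def Instr.exec (w : ℕ) : Instr → State → State
  | .const d c, s => { s with reg := Function.update s.reg d (c % 2 ^ w) }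
  | .move d a, s => { s with reg := Function.update s.reg d (s.reg a) }
  | .arith o d a b, s =>
      { s with reg := Function.update s.reg d (o.eval (s.reg a) (s.reg b) % 2 ^ w) }
  | .load d a, s => { s with reg := Function.update s.reg d (s.mem (s.reg a)) }
  | .store a b, s => { s with mem := Function.update s.mem (s.reg a) (s.reg b) }
  | .wmove d a, s => { s with wreg := Function.update s.wreg d (s.wreg a) }
  | .wload d a, s => { s with wreg := Function.update s.wreg d (s.wmem (s.reg a)) }
  | .wstore a b, s => { s with wmem := Function.update s.wmem (s.reg a) (s.wreg b) }

inductive Test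
  /-- `reg a = reg b` -/
  | eq (a b : ℕ)
  /-- `reg a < reg b` -/
  | lt (a b : ℕ)
  /-- `wreg a < wreg b` -/
  | wlt (a b : ℕ)

def Test.Holds : Test → State → Prop
  | .eq a b, s => s.reg a = s.reg b
  | .lt a b, s => s.reg a < s.reg b
  | .wlt a b, s => s.wreg a < s.wreg b

inductive Program
  | skip
  | instr (i : Instr)
  | seq (p q : Program)
  | ite (b : Test) (p q : Program)
  | while (b : Test) (p : Program)

/-- `Runs w p s t s'`: on word length `w`, program `p` started in state `s` terminates after
exactly `t` steps in state `s'`. -/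
inductive Runs (w : ℕ) : Program → State → ℕ → State → Prop
  | skip (s : State) : Runs w .skip s 1 s
  | instr (i : Instr) (s : State) : Runs w (.instr i) s 1 (i.exec w s)
  | seq {p q : Program} {s s' s'' : State} {t t' : ℕ} :
      Runs w p s t s' → Runs w q s' t' s'' → Runs w (.seq p q) s (t + t') s''
  | ite_true {b : Test} {p q : Program} {s s' : State} {t : ℕ} :
      b.Holds s → Runs w p s t s' → Runs w (.ite b p q) s (t + 1) s'
  | ite_false {b : Test} {p q : Program} {s s' : State} {t : ℕ} :
      ¬ b.Holds s → Runs w q s t s' → Runs w (.ite b p q) s (t + 1) s'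
  | while_false {b : Test} {p : Program} {s : State} :
      ¬ b.Holds s → Runs w (.while b p) s 1 s
  | while_true {b : Test} {p : Program} {s s' s'' : State} {t t' : ℕ} :
      b.Holds s → Runs w p s t s' → Runs w (.while b p) s' t' s'' →
      Runs w (.while b p) s (t + t' + 1) s''

/-! ### Input and output format -/

/-- The `n - 1` edges of `T` are listed, in some order and with endpoints in some order, as the
entries `b, …, b + n - 2` of the edge table held in memory: entry `j` has its endpoints in the
words `2 * j`, `2 * j + 1` and its weight in the weight cell `j`. -/
def CutTree.StoredAt {n : ℕ} (T : CutTree (Fin n)) (s : State) (b : ℕ) : Prop :=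
  ∃ f : Fin (n - 1) ≃ T.graph.edgeSet, ∀ j : Fin (n - 1), ∃ u v : Fin n,
    (f j : Sym2 (Fin n)) = s(u, v) ∧
    s.mem (2 * (b + j)) = u ∧ s.mem (2 * (b + j) + 1) = v ∧ s.wmem (b + j) = T.weight (f j)

/-- Initial states: `k` and `n` in the first two registers, the edge lists of the `k` trees one
after the other from the start of memory, and zeros elsewhere. -/
structure IsInput {k n : ℕ} (T : Fin k → CutTree (Fin n)) (s : State) : Prop where
  reg_zero : s.reg 0 = k
  reg_one : s.reg 1 = n
  reg_other : ∀ r, 2 ≤ r → s.reg r = 0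
  wreg_zero : ∀ r, s.wreg r = 0
  trees : ∀ i : Fin k, (T i).StoredAt s (i * (n - 1))
  mem_other : ∀ a, 2 * (k * (n - 1)) ≤ a → s.mem a = 0
  wmem_other : ∀ a, k * (n - 1) ≤ a → s.wmem a = 0

end CutMerge

/-! Number the edges of all trees consecutively and order them by weight, ties broken by number
(`Family.key`). Every pair of vertices then has a unique first cut among all that separate it. The
cuts arising in this way (`Family.Best`) are best cuts of the input family. Root all trees at 0 and
represent a cut by its side without 0; the non-crossing hypothesis makes these sides a laminar
family (`Family.Describes.laminar`).

There are exactly n - 1 such cuts. Every vertex v ≠ 0 lies in a smallest one, its owner. Because any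
two vertices are separated by a best cut, laminarity makes v ↦ owner injective, so there are at
least n - 1. For the upper bound, consider a flow tree of the family: a tree with labelled edges
whose components above any threshold are the intersections of the corresponding components of all
input trees. Every best cut must occur as a label (`Family.Flow.exists_of_best`), and there are at
most n - 1 labels on edges that are not loops. So the labels are precisely the best cuts, and each
best cut owns a vertex (`Family.Flow.best_iff`). Let the parent of v be the vertex that owns the
second smallest best cut around v, or 0 if there is none. The cuts of the resulting tree are exactly
the best cuts (`Family.exists_rooted_merged`), which makes it a merge of the family
(`Family.Describes.isMerge`).

The algorithm first builds the flow tree by adding the input trees one at a time. To combine the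
current flow tree with another tree, the edges of both are inserted by decreasing key on two
disjoint copies of V. The cell of a vertex is the pair of its component labels in the two copies.
When two cells become one, their representatives are linked by an edge labelled with the current
edge (`Family.RoundInv.step`, `Family.RoundInv.flow`). Sorting and small-to-large relabelling
(`potential_relabel`) cost O(n log n) per tree. Next, each tree is rooted in linear time by
stripping leaves. The best cuts of one tree around v are nested along the ancestors of v, so a
top-down pass finds the two smallest, and these are combined over all trees. The total is O(kn log
n), so one logarithm of the stated bound is not needed.

The program is written in a small structured language, verified with a calculus of postconditions on
final state and running time (`Wp`), and compiled to the word RAM with constant overhead per step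
(`Stmt.compile_runs`). -/

namespace CutMerge

/-! ### The source language and its simulation on the word RAM. -/

set_option linter.constructorNameAsVariable false

/-! ### A structured language with named variables and arrays -/

/-- Word variables. -/
inductive Var
  -- The order matters: `k` and `n` must receive registers 0 and 1, where the input is supplied.
  | k | n | m | i | j | s | b | h | md | en | l | r | o | g | x | z | e | X | Y | d | B
  | cnt | c | u | v | p | t | M | id
  deriving DecidableEq

/-- Word arrays; `io` is the part of the memory that holds the input and the output. -/
inductive Arr
  -- `io` must come first, since position 0 is where the input starts and where the output is
  -- expected.
  | io | eu | ev | ei | p | q | lab | nxt | hd | sz | tab | par | pid | mark | deg | sN | sE | siz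
  | pr | pe | ord | n1 | n2 | c1 | c2 | vo
  deriving DecidableEq

/-- The register of a variable. -/
def Var.reg (x : Var) : ℕ := x.ctorIdx

/-- The position of an array in memory. -/
def Arr.pos (a : Arr) : ℕ := a.ctorIdx

theorem Var.reg_injective : Function.Injective Var.reg := by
  intro a b h
  cases a <;> cases b <;> first | rfl | exact absurd h (by decide)

theorem Arr.pos_injective : Function.Injective Arr.pos := by
  intro a b h
  cases a <;> cases b <;> first | rfl | exact absurd h (by decide)

theorem Var.reg_lt (x : Var) : x.reg < 30 := by cases x <;> decide

theorem Arr.pos_lt (a : Arr) : a.pos < 26 := by cases a <;> decide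

/-- States of the structured language. -/
structure Store where
  var : Var → ℕ
  arr : Arr → ℕ → ℕ
  wt : ℕ → ℝ

def Store.set (σ : Store) (x : Var) (a : ℕ) : Store :=
  { σ with var := Function.update σ.var x a }

def Store.put (σ : Store) (a : Arr) (i c : ℕ) : Store :=
  { σ with arr := Function.update σ.arr a (Function.update (σ.arr a) i c) }

def Store.wput (σ : Store) (i : ℕ) (c : ℝ) : Store :=
  { σ with wt := Function.update σ.wt i c }

@[simp] theorem Store.set_var (σ : Store) (x y : Var) (a : ℕ) :
    (σ.set x a).var y = if y = x then a else σ.var y := by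
  simp [Store.set, Function.update_apply]

@[simp] theorem Store.set_arr (σ : Store) (x : Var) (a : ℕ) : (σ.set x a).arr = σ.arr := rfl

@[simp] theorem Store.set_wt (σ : Store) (x : Var) (a : ℕ) : (σ.set x a).wt = σ.wt := rfl

@[simp] theorem Store.put_var (σ : Store) (a : Arr) (i c : ℕ) : (σ.put a i c).var = σ.var := rfl

@[simp] theorem Store.put_arr (σ : Store) (a b : Arr) (i c : ℕ) :
    (σ.put a i c).arr b = if b = a then Function.update (σ.arr a) i c else σ.arr b := by
  simp [Store.put, Function.update_apply]

@[simp] theorem Store.put_wt (σ : Store) (a : Arr) (i c : ℕ) : (σ.put a i c).wt = σ.wt := rfl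

@[simp] theorem Store.wput_var (σ : Store) (i : ℕ) (c : ℝ) : (σ.wput i c).var = σ.var := rfl

@[simp] theorem Store.wput_arr (σ : Store) (i : ℕ) (c : ℝ) : (σ.wput i c).arr = σ.arr := rfl

@[simp] theorem Store.wput_wt (σ : Store) (i : ℕ) (c : ℝ) :
    (σ.wput i c).wt = Function.update σ.wt i c := rfl

@[simp] theorem ArithOp.eval_add (a b : ℕ) : ArithOp.add.eval a b = a + b := rfl
@[simp] theorem ArithOp.eval_sub (a b : ℕ) : ArithOp.sub.eval a b = a - b := rfl
@[simp] theorem ArithOp.eval_mul (a b : ℕ) : ArithOp.mul.eval a b = a * b := rfl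
@[simp] theorem ArithOp.eval_div (a b : ℕ) : ArithOp.div.eval a b = a / b := rfl

/-- Word expressions. -/
inductive Expr
  | num (c : ℕ)
  | var (x : Var)
  | op (o : ArithOp) (e f : Expr)
  | get (a : Arr) (e : Expr)

@[simp] def Expr.eval : Expr → Store → ℕ
  | .num c, _ => c
  | .var x, σ => σ.var x
  | .op o e f, σ => o.eval (e.eval σ) (f.eval σ)
  | .get a e, σ => σ.arr a (e.eval σ)

/-- The evaluation of the expression stays below `Z`, and so do all array indices. -/
@[simp] def Expr.Ok (Z : ℕ) : Expr → Store → Prop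
  | .num c, _ => c < Z
  | .var _, _ => True
  | .op o e f, σ => e.Ok Z σ ∧ f.Ok Z σ ∧ o.eval (e.eval σ) (f.eval σ) < Z
  | .get _ e, σ => e.Ok Z σ ∧ e.eval σ < Z

instance : Coe Var Expr := ⟨.var⟩
instance (c : ℕ) : OfNat Expr c := ⟨.num c⟩
instance : Add Expr := ⟨.op .add⟩
instance : Sub Expr := ⟨.op .sub⟩
instance : Mul Expr := ⟨.op .mul⟩
instance : Div Expr := ⟨.op .div⟩

@[simp] theorem Expr.eval_ofNat (c : ℕ) (σ : Store) : Expr.eval (OfNat.ofNat c) σ = c := rfl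
@[simp] theorem Expr.eval_add (e f : Expr) (σ : Store) :
    (e + f).eval σ = e.eval σ + f.eval σ := rfl
@[simp] theorem Expr.eval_sub (e f : Expr) (σ : Store) :
    (e - f).eval σ = e.eval σ - f.eval σ := rfl
@[simp] theorem Expr.eval_mul (e f : Expr) (σ : Store) :
    (e * f).eval σ = e.eval σ * f.eval σ := rfl
@[simp] theorem Expr.eval_div (e f : Expr) (σ : Store) :
    (e / f).eval σ = e.eval σ / f.eval σ := rfl
@[simp] theorem Expr.ok_ofNat (Z c : ℕ) (σ : Store) :
    Expr.Ok Z (OfNat.ofNat c) σ ↔ c < Z := Iff.rfl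
@[simp] theorem Expr.ok_add (Z : ℕ) (e f : Expr) (σ : Store) :
    (e + f).Ok Z σ ↔ e.Ok Z σ ∧ f.Ok Z σ ∧ e.eval σ + f.eval σ < Z := Iff.rfl
@[simp] theorem Expr.ok_sub (Z : ℕ) (e f : Expr) (σ : Store) :
    (e - f).Ok Z σ ↔ e.Ok Z σ ∧ f.Ok Z σ ∧ e.eval σ - f.eval σ < Z := Iff.rfl
@[simp] theorem Expr.ok_mul (Z : ℕ) (e f : Expr) (σ : Store) :
    (e * f).Ok Z σ ↔ e.Ok Z σ ∧ f.Ok Z σ ∧ e.eval σ * f.eval σ < Z := Iff.rfl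
@[simp] theorem Expr.ok_div (Z : ℕ) (e f : Expr) (σ : Store) :
    (e / f).Ok Z σ ↔ e.Ok Z σ ∧ f.Ok Z σ ∧ e.eval σ / f.eval σ < Z := Iff.rfl

/-- Tests; `wlt e f` compares the weights stored at the addresses `e` and `f`. -/
inductive Cond
  | eq (e f : Expr)
  | lt (e f : Expr)
  | wlt (e f : Expr)

@[simp] def Cond.Holds : Cond → Store → Prop
  | .eq e f, σ => e.eval σ = f.eval σ
  | .lt e f, σ => e.eval σ < f.eval σ
  | .wlt e f, σ => σ.wt (e.eval σ) < σ.wt (f.eval σ)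

@[simp] def Cond.Ok (Z : ℕ) : Cond → Store → Prop
  | .eq e f, σ => e.Ok Z σ ∧ f.Ok Z σ
  | .lt e f, σ => e.Ok Z σ ∧ f.Ok Z σ
  | .wlt e f, σ => e.Ok Z σ ∧ f.Ok Z σ ∧ e.eval σ < Z ∧ f.eval σ < Z

/-- Statements. -/
inductive Stmt
  | skip
  | assign (x : Var) (e : Expr)
  | put (a : Arr) (e f : Expr)
  | wput (e f : Expr)
  | seq (p q : Stmt)
  | ite (b : Cond) (p q : Stmt)
  | loop (b : Cond) (p : Stmt)

infixr:60 ";;" => Stmt.seq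
infix:62 "::=" => Stmt.assign

/-- Big-step semantics with unit costs. -/
inductive Exec (Z : ℕ) : Stmt → Store → ℕ → Store → Prop
  | skip (σ : Store) : Exec Z .skip σ 1 σ
  | assign {σ : Store} (x : Var) {e : Expr} :
      e.Ok Z σ → Exec Z (.assign x e) σ 1 (σ.set x (e.eval σ))
  | put {σ : Store} (a : Arr) {e f : Expr} :
      e.Ok Z σ → f.Ok Z σ → e.eval σ < Z →
      Exec Z (.put a e f) σ 1 (σ.put a (e.eval σ) (f.eval σ))
  | wput {σ : Store} {e f : Expr} :
      e.Ok Z σ → f.Ok Z σ → e.eval σ < Z → f.eval σ < Z →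
      Exec Z (.wput e f) σ 1 (σ.wput (e.eval σ) (σ.wt (f.eval σ)))
  | seq {p q : Stmt} {σ σ' σ'' : Store} {t t' : ℕ} :
      Exec Z p σ t σ' → Exec Z q σ' t' σ'' → Exec Z (.seq p q) σ (t + t') σ''
  | ite_true {b : Cond} {p q : Stmt} {σ σ' : Store} {t : ℕ} :
      b.Ok Z σ → b.Holds σ → Exec Z p σ t σ' → Exec Z (.ite b p q) σ (t + 1) σ'
  | ite_false {b : Cond} {p q : Stmt} {σ σ' : Store} {t : ℕ} :
      b.Ok Z σ → ¬ b.Holds σ → Exec Z q σ t σ' → Exec Z (.ite b p q) σ (t + 1) σ'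
  | loop_false {b : Cond} {p : Stmt} {σ : Store} :
      b.Ok Z σ → ¬ b.Holds σ → Exec Z (.loop b p) σ 1 σ
  | loop_true {b : Cond} {p : Stmt} {σ σ' σ'' : Store} {t t' : ℕ} :
      b.Ok Z σ → b.Holds σ → Exec Z p σ t σ' → Exec Z (.loop b p) σ' t' σ'' →
      Exec Z (.loop b p) σ (t + t' + 1) σ''

/-! ### Compilation to the word RAM -/

/-- The register that holds the common length of the arrays. -/
def strideReg : ℕ := 30

/-- The first register used for intermediate results. -/
def tempReg : ℕ := 31

/-- Turn the array index in register `d` into a memory address. -/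
def compileAddr (a : Arr) (d : ℕ) : Program :=
  .seq (.instr (.const (d + 1) a.pos))
    (.seq (.instr (.arith .mul (d + 1) (d + 1) strideReg))
      (.instr (.arith .add d d (d + 1))))

/-- Evaluate an expression into register `d`, using no register below `d`. -/
def Expr.compile : Expr → ℕ → Program
  | .num c, d => .instr (.const d c)
  | .var x, d => .instr (.move d x.reg)
  | .op o e f, d =>
      .seq (e.compile d) (.seq (f.compile (d + 1)) (.instr (.arith o d d (d + 1))))
  | .get a e, d =>
      .seq (e.compile d) (.seq (compileAddr a d) (.instr (.load d d)))

def Expr.cost : Expr → ℕ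
  | .num _ => 1
  | .var _ => 1
  | .op _ e f => e.cost + (f.cost + 1)
  | .get _ e => e.cost + (1 + (1 + 1) + 1)

/-- The evaluation of the operands of a test. -/
def Cond.compile : Cond → Program
  | .eq e f => .seq (e.compile tempReg) (f.compile (tempReg + 1))
  | .lt e f => .seq (e.compile tempReg) (f.compile (tempReg + 1))
  | .wlt e f => .seq (e.compile tempReg) (.seq (f.compile (tempReg + 1))
      (.seq (.instr (.wload 0 tempReg)) (.instr (.wload 1 (tempReg + 1)))))

def Cond.test : Cond → Test
  | .eq _ _ => .eq tempReg (tempReg + 1)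
  | .lt _ _ => .lt tempReg (tempReg + 1)
  | .wlt _ _ => .wlt 0 1

def Cond.cost : Cond → ℕ
  | .eq e f => e.cost + f.cost
  | .lt e f => e.cost + f.cost
  | .wlt e f => e.cost + (f.cost + (1 + 1))

/-- A machine test only compares registers, so the operands of a loop condition are evaluated once
before the loop and again at the end of every iteration. -/
def Stmt.compile : Stmt → Program
  | .skip => .skip
  | .assign x e => .seq (e.compile tempReg) (.instr (.move x.reg tempReg))
  | .put a e f => .seq (f.compile tempReg) (.seq (e.compile (tempReg + 1))
      (.seq (compileAddr a (tempReg + 1)) (.instr (.store (tempReg + 1) tempReg))))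
  | .wput e f => .seq (f.compile tempReg) (.seq (e.compile (tempReg + 1))
      (.seq (.instr (.wload 0 tempReg)) (.instr (.wstore (tempReg + 1) 0))))
  | .seq p q => .seq p.compile q.compile
  | .ite b p q => .seq b.compile (.ite b.test p.compile q.compile)
  | .loop b p => .seq b.compile (.while b.test (.seq p.compile b.compile))

/-- `K` bounds the number of steps for every unit of cost. -/
def Stmt.CostLE (K : ℕ) : Stmt → Prop
  | .skip => 1 ≤ K
  | .assign _ e => e.cost + 1 ≤ K
  | .put _ e f => f.cost + (e.cost + (1 + (1 + 1) + 1)) ≤ K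
  | .wput e f => f.cost + (e.cost + (1 + 1)) ≤ K
  | .seq p q => p.CostLE K ∧ q.CostLE K
  | .ite b p q => b.cost + 1 ≤ K ∧ p.CostLE K ∧ q.CostLE K
  | .loop b p => b.cost + 1 ≤ K ∧ p.CostLE K

theorem Stmt.CostLE.mono {K K' : ℕ} (h : K ≤ K') : ∀ {S : Stmt}, S.CostLE K → S.CostLE K'
  | .skip, hS => le_trans (b := K) hS h
  | .assign _ _, hS => le_trans (b := K) hS h
  | .put _ _ _, hS => le_trans (b := K) hS h
  | .wput _ _, hS => le_trans (b := K) hS h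
  | .seq _ _, hS => ⟨hS.1.mono h, hS.2.mono h⟩
  | .ite _ _ _, hS => ⟨hS.1.trans h, hS.2.1.mono h, hS.2.2.mono h⟩
  | .loop _ _, hS => ⟨hS.1.trans h, hS.2.mono h⟩

theorem Stmt.exists_costLE (S : Stmt) : ∃ K, S.CostLE K := by
  induction S with
  | skip => exact ⟨1, le_rfl⟩
  | assign x e => exact ⟨_, le_refl (e.cost + 1)⟩
  | put a e f => exact ⟨_, le_refl (f.cost + (e.cost + (1 + (1 + 1) + 1)))⟩
  | wput e f => exact ⟨_, le_refl (f.cost + (e.cost + (1 + 1)))⟩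
  | seq p q hp hq =>
    obtain ⟨K, hK⟩ := hp
    obtain ⟨K', hK'⟩ := hq
    exact ⟨K + K', hK.mono (by omega), hK'.mono (by omega)⟩
  | ite b p q hp hq =>
    obtain ⟨K, hK⟩ := hp
    obtain ⟨K', hK'⟩ := hq
    exact ⟨K + K' + (b.cost + 1), by omega, hK.mono (by omega), hK'.mono (by omega)⟩
  | loop b p hp =>
    obtain ⟨K, hK⟩ := hp
    exact ⟨K + (b.cost + 1), by omega, hK.mono (by omega)⟩

/-- The RAM state `s` represents the store `σ`, with arrays of length `Z`. -/
structure Rep (Z : ℕ) (σ : Store) (s : State) : Prop where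
  reg : ∀ x : Var, s.reg x.reg = σ.var x
  stride : s.reg strideReg = Z
  mem : ∀ (a : Arr) (i : ℕ), i < Z → s.mem (a.pos * Z + i) = σ.arr a i
  wmem : ∀ i < Z, s.wmem i = σ.wt i

/-- The states agree on memory and on the registers below `d`. -/
structure SameBelow (d : ℕ) (s s' : State) : Prop where
  reg : ∀ r < d, s'.reg r = s.reg r
  mem : s'.mem = s.mem
  wmem : s'.wmem = s.wmem

theorem SameBelow.trans {d d' : ℕ} {s s' s'' : State} (h : SameBelow d s s')
    (h' : SameBelow d' s' s'') (hd : d ≤ d') : SameBelow d s s'' :=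
  ⟨fun r hr => (h'.reg r (by omega)).trans (h.reg r hr), h'.mem.trans h.mem,
    h'.wmem.trans h.wmem⟩

theorem Rep.of_sameBelow {Z d : ℕ} {σ : Store} {s s' : State} (h : Rep Z σ s)
    (h' : SameBelow d s s') (hd : tempReg ≤ d) : Rep Z σ s' where
  reg x := by
    have := x.reg_lt
    rw [h'.reg _ (by simp only [tempReg] at hd; omega), h.reg]
  stride := by rw [h'.reg _ (by simp only [tempReg] at hd; simp only [strideReg]; omega), h.stride]
  mem a i hi := by rw [h'.mem, h.mem a i hi]
  wmem i hi := by rw [h'.wmem, h.wmem i hi]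

section simulation

variable {w Z : ℕ} (hZ : 26 * Z ≤ 2 ^ w) (hZ' : 26 ≤ Z)
include hZ hZ'

theorem compileAddr_runs {σ : Store} {s : State} (hs : Rep Z σ s) (a : Arr) {d : ℕ}
    (hd : tempReg ≤ d) (hi : s.reg d < Z) :
    ∃ s', Runs w (compileAddr a d) s (1 + (1 + 1)) s' ∧ SameBelow d s s' ∧
      s'.reg d = a.pos * Z + s.reg d := by
  have hpos := a.pos_lt
  have hd' : 30 ≠ d ∧ 30 ≠ d + 1 := by simp only [tempReg] at hd; omega
  have h1 : a.pos * Z + s.reg d < 2 ^ w := by nlinarith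
  have h2 : a.pos * Z < 2 ^ w := by omega
  have h3 : a.pos < 2 ^ w := by omega
  have hst : s.reg 30 = Z := hs.stride
  refine ⟨_, .seq (.instr _ _) (.seq (.instr _ _) (.instr _ _)), ⟨?_, rfl, rfl⟩, ?_⟩
  · intro r hr
    simp only [Instr.exec]
    rw [Function.update_of_ne (by omega), Function.update_of_ne (by omega),
      Function.update_of_ne (by omega)]
  · simp [Instr.exec, ArithOp.eval, strideReg, hst, hd', Nat.mod_eq_of_lt h1,
      Nat.mod_eq_of_lt h2, Nat.mod_eq_of_lt h3, add_comm (s.reg d)]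

/-- Evaluation into register `d` leaves all lower registers alone, so a first operand survives the
evaluation of the second. The predicate `Ok` keeps all values below `Z ≤ 2 ^ w`, which makes
reduction modulo `2 ^ w` invisible. -/
theorem Expr.compile_runs {σ : Store} (e : Expr) :
    ∀ {s : State} {d : ℕ}, Rep Z σ s → tempReg ≤ d → e.Ok Z σ →
      ∃ s', Runs w (e.compile d) s e.cost s' ∧ SameBelow d s s' ∧ s'.reg d = e.eval σ := by
  have hlt : ∀ {a : ℕ}, a < Z → a < 2 ^ w := fun h => by omega
  induction e with
  | num c =>
    intro s d hs hd ho
    refine ⟨_, .instr _ _, ⟨fun r hr => ?_, rfl, rfl⟩, ?_⟩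
    · simp [Instr.exec, Function.update_of_ne hr.ne]
    · simp only [Expr.Ok] at ho
      simp [Instr.exec, Nat.mod_eq_of_lt (hlt ho)]
  | var x =>
    intro s d hs hd ho
    refine ⟨_, .instr _ _, ⟨fun r hr => ?_, rfl, rfl⟩, ?_⟩
    · simp [Instr.exec, Function.update_of_ne hr.ne]
    · simp [Instr.exec, hs.reg]
  | op o e f he hf =>
    intro s d hs hd ho
    obtain ⟨h1, h2, h3⟩ := ho
    obtain ⟨s1, r1, b1, v1⟩ := he hs hd h1
    obtain ⟨s2, r2, b2, v2⟩ := hf (d := d + 1) (hs.of_sameBelow b1 hd) (by omega) h2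
    refine ⟨_, .seq r1 (.seq r2 (.instr _ _)), (b1.trans b2 (by omega)).trans (d' := d)
      ⟨fun r hr => ?_, rfl, rfl⟩ le_rfl, ?_⟩
    · simp [Instr.exec, Function.update_of_ne hr.ne]
    · simp [Instr.exec, v2, b2.reg d (by omega), v1, Nat.mod_eq_of_lt (hlt h3)]
  | get a e he =>
    intro s d hs hd ho
    obtain ⟨h1, h2⟩ := ho
    obtain ⟨s1, r1, b1, v1⟩ := he hs hd h1
    have hs1 := hs.of_sameBelow b1 hd
    obtain ⟨s2, r2, b2, v2⟩ := compileAddr_runs hZ hZ' hs1 a hd (v1 ▸ h2)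
    refine ⟨_, .seq r1 (.seq r2 (.instr _ _)), (b1.trans b2 (by omega)).trans (d' := d)
      ⟨fun r hr => ?_, rfl, rfl⟩ le_rfl, ?_⟩
    · simp [Instr.exec, Function.update_of_ne hr.ne]
    · simp [Instr.exec, v2, b2.mem, v1, hs1.mem a _ h2]

theorem Cond.compile_runs {σ : Store} (b : Cond) {s : State} (hs : Rep Z σ s) (ho : b.Ok Z σ) :
    ∃ s', Runs w b.compile s b.cost s' ∧ Rep Z σ s' ∧ (b.test.Holds s' ↔ b.Holds σ) := by
  have main : ∀ e f : Expr, e.Ok Z σ → f.Ok Z σ → ∃ s1 s2,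
      Runs w (e.compile tempReg) s e.cost s1 ∧ Runs w (f.compile (tempReg + 1)) s1 f.cost s2 ∧
      Rep Z σ s2 ∧ s2.reg tempReg = e.eval σ ∧ s2.reg (tempReg + 1) = f.eval σ := by
    intro e f he hf
    obtain ⟨s1, r1, b1, v1⟩ := e.compile_runs hZ hZ' hs le_rfl he
    have hs1 := hs.of_sameBelow b1 le_rfl
    obtain ⟨s2, r2, b2, v2⟩ := f.compile_runs hZ hZ' (d := tempReg + 1) hs1 (by omega) hf
    exact ⟨s1, s2, r1, r2, hs1.of_sameBelow b2 (by omega), by rw [b2.reg _ (by omega), v1], v2⟩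
  cases b with
  | eq e f =>
    obtain ⟨s1, s2, r1, r2, hs2, v1, v2⟩ := main e f ho.1 ho.2
    exact ⟨s2, .seq r1 r2, hs2, by simp [Cond.test, Test.Holds, v1, v2]⟩
  | lt e f =>
    obtain ⟨s1, s2, r1, r2, hs2, v1, v2⟩ := main e f ho.1 ho.2
    exact ⟨s2, .seq r1 r2, hs2, by simp [Cond.test, Test.Holds, v1, v2]⟩
  | wlt e f =>
    obtain ⟨s1, s2, r1, r2, hs2, v1, v2⟩ := main e f ho.1 ho.2.1
    refine ⟨_, .seq r1 (.seq r2 (.seq (.instr _ _) (.instr _ _))),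
      hs2.of_sameBelow (d := tempReg) ⟨fun r hr => ?_, rfl, rfl⟩ le_rfl, ?_⟩
    · simp [Instr.exec]
    · simp [Instr.exec, Cond.test, Test.Holds, v1, v2, hs2.wmem _ ho.2.2.1, hs2.wmem _ ho.2.2.2]

/-- Induction on the execution. One unit of cost corresponds to one atomic statement or one test,
whose compiled length is fixed by the program text; hence the factor `K` independent of the input.
-/
theorem Stmt.compile_runs {K : ℕ} {S : Stmt} {σ σ' : Store} {t : ℕ} (h : Exec Z S σ t σ') :
    ∀ {s : State}, S.CostLE K → Rep Z σ s →
      ∃ t' s', Runs w S.compile s t' s' ∧ Rep Z σ' s' ∧ t' ≤ K * t := by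
  have hreg : ∀ (x : Var) (r : ℕ), tempReg ≤ r → x.reg ≠ r := by
    intro x r hr
    have := x.reg_lt
    simp only [tempReg] at hr
    omega
  induction h with
  | skip σ =>
    intro s hK hs
    exact ⟨1, s, .skip s, hs, by simpa [Stmt.CostLE] using hK⟩
  | @assign σ x e ho =>
    intro s hK hs
    obtain ⟨s1, r1, b1, v1⟩ := e.compile_runs hZ hZ' hs le_rfl ho
    have hs1 := hs.of_sameBelow b1 le_rfl
    refine ⟨_, _, .seq r1 (.instr _ _), ⟨?_, ?_, ?_, ?_⟩, by simpa [Stmt.CostLE] using hK⟩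
    · intro y
      simp only [Instr.exec, Store.set, Function.update_apply, Var.reg_injective.eq_iff, v1,
        hs1.reg]
    · have hne : strideReg ≠ x.reg := by
        have := x.reg_lt
        simp only [strideReg]
        omega
      simp [Instr.exec, Function.update_of_ne hne, hs1.stride]
    · exact hs1.mem
    · exact hs1.wmem
  | @put σ a e f he hf hlt =>
    intro s hK hs
    obtain ⟨s1, r1, b1, v1⟩ := f.compile_runs hZ hZ' hs le_rfl hf
    have hs1 := hs.of_sameBelow b1 le_rfl
    obtain ⟨s2, r2, b2, v2⟩ := e.compile_runs hZ hZ' (d := tempReg + 1) hs1 (by omega) he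
    have hs2 := hs1.of_sameBelow b2 (by omega)
    obtain ⟨s3, r3, b3, v3⟩ := compileAddr_runs hZ hZ' hs2 a (d := tempReg + 1) (by omega)
      (v2 ▸ hlt)
    have hs3 := hs2.of_sameBelow b3 (by omega)
    refine ⟨_, _, .seq r1 (.seq r2 (.seq r3 (.instr _ _))), ⟨hs3.reg, hs3.stride, ?_, hs3.wmem⟩,
      by simpa [Stmt.CostLE] using hK⟩
    intro c i hi
    have hv : s3.reg tempReg = f.eval σ := by
      rw [b3.reg _ (by omega), b2.reg _ (by omega), v1]
    simp only [Instr.exec, v3, v2, hv, Function.update_apply, Store.put]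
    by_cases hc : c = a
    · subst hc
      simp only [Nat.add_left_cancel_iff, if_true, Function.update_apply, hs3.mem c i hi]
    -- Cells of different arrays have different addresses: division by `Z` recovers the array.
    · have hne : c.pos * Z + i ≠ a.pos * Z + e.eval σ := by
        intro heq
        have : (c.pos * Z + i) / Z = (a.pos * Z + e.eval σ) / Z := by rw [heq]
        rw [add_comm, Nat.add_mul_div_right _ _ (by omega), Nat.div_eq_of_lt hi, add_comm (_ * Z),
          Nat.add_mul_div_right _ _ (by omega), Nat.div_eq_of_lt hlt] at this
        exact hc (Arr.pos_injective (by omega))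
      rw [if_neg hne, if_neg hc, hs3.mem c i hi]
  | @wput σ e f he hf hlt hlt' =>
    intro s hK hs
    obtain ⟨s1, r1, b1, v1⟩ := f.compile_runs hZ hZ' hs le_rfl hf
    have hs1 := hs.of_sameBelow b1 le_rfl
    obtain ⟨s2, r2, b2, v2⟩ := e.compile_runs hZ hZ' (d := tempReg + 1) hs1 (by omega) he
    have hs2 := hs1.of_sameBelow b2 (by omega)
    refine ⟨_, _, .seq r1 (.seq r2 (.seq (.instr _ _) (.instr _ _))),
      ⟨hs2.reg, hs2.stride, hs2.mem, ?_⟩, by simpa [Stmt.CostLE] using hK⟩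
    intro i hi
    have hv : s2.reg tempReg = f.eval σ := by rw [b2.reg _ (by omega), v1]
    simp only [Instr.exec, v2, hv, Function.update_apply, Store.wput, hs2.wmem _ hlt', if_true,
      hs2.wmem i hi]
  | @seq p q σ σ' σ'' t t' hp hq ihp ihq =>
    intro s hK hs
    obtain ⟨t1, s1, r1, hs1, ht1⟩ := ihp hK.1 hs
    obtain ⟨t2, s2, r2, hs2, ht2⟩ := ihq hK.2 hs1
    exact ⟨_, s2, .seq r1 r2, hs2, by rw [mul_add]; omega⟩
  | @ite_true b p q σ σ' t ho hb hp ihp =>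
    intro s hK hs
    obtain ⟨s1, r1, hs1, hh⟩ := b.compile_runs hZ hZ' hs ho
    obtain ⟨t2, s2, r2, hs2, ht2⟩ := ihp hK.2.1 hs1
    refine ⟨_, s2, .seq r1 (.ite_true (hh.2 hb) r2), hs2, ?_⟩
    have := hK.1
    rw [mul_add]
    omega
  | @ite_false b p q σ σ' t ho hb hp ihp =>
    intro s hK hs
    obtain ⟨s1, r1, hs1, hh⟩ := b.compile_runs hZ hZ' hs ho
    obtain ⟨t2, s2, r2, hs2, ht2⟩ := ihp hK.2.2 hs1
    refine ⟨_, s2, .seq r1 (.ite_false (hh.not.2 hb) r2), hs2, ?_⟩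
    have := hK.1
    rw [mul_add]
    omega
  | @loop_false b p σ ho hb =>
    intro s hK hs
    obtain ⟨s1, r1, hs1, hh⟩ := b.compile_runs hZ hZ' hs ho
    refine ⟨_, s1, .seq r1 (.while_false (hh.not.2 hb)), hs1, ?_⟩
    have := hK.1
    omega
  | @loop_true b p σ σ' σ'' t t' ho hb hp hw ihp ihw =>
    intro s hK hs
    obtain ⟨s1, r1, hs1, hh⟩ := b.compile_runs hZ hZ' hs ho
    obtain ⟨t2, s2, r2, hs2, ht2⟩ := ihp hK.2 hs1
    obtain ⟨t3, s3, r3, hs3, ht3⟩ := ihw hK hs2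
    -- The run of the remaining loop starts by evaluating the condition. That part is cut off and
    -- becomes the end of the present iteration's body.
    cases r3 with
    | @seq _ _ _ s4 _ u u' r4 r5 =>
    refine ⟨_, s3, .seq r1 (.while_true (hh.2 hb) (.seq r2 r4) r5), hs3, ?_⟩
    have := hK.1
    rw [mul_add, mul_add]
    omega

end simulation

end CutMerge

/-! ### A program logic with frame conditions and step counts. -/

namespace CutMerge

set_option linter.constructorNameAsVariable false

/-! ### Variables and arrays that a statement may change -/

def Stmt.writesVar : Stmt → Var → Bool
  | .assign x _, y => x == y
  | .seq p q, y => p.writesVar y || q.writesVar y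
  | .ite _ p q, y => p.writesVar y || q.writesVar y
  | .loop _ p, y => p.writesVar y
  | _, _ => false

def Stmt.writesArr : Stmt → Arr → Bool
  | .put a _ _, b => a == b
  | .seq p q, y => p.writesArr y || q.writesArr y
  | .ite _ p q, y => p.writesArr y || q.writesArr y
  | .loop _ p, y => p.writesArr y
  | _, _ => false

def Stmt.writesWt : Stmt → Bool
  | .wput _ _ => true
  | .seq p q => p.writesWt || q.writesWt
  | .ite _ p q => p.writesWt || q.writesWt
  | .loop _ p => p.writesWt
  | _ => false

/-- `σ'` differs from `σ` only where `S` writes. -/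
structure Same (S : Stmt) (σ σ' : Store) : Prop where
  var' : ∀ x, S.writesVar x = false → σ'.var x = σ.var x
  arr' : ∀ a, S.writesArr a = false → σ'.arr a = σ.arr a
  wt' : S.writesWt = false → σ'.wt = σ.wt

/-- The frame condition is a computable property of the program text, so the default argument `rfl`
discharges it for every concrete program. -/
theorem Same.var {S : Stmt} {σ σ' : Store} (h : Same S σ σ') (x : Var)
    (hx : S.writesVar x = false := by rfl) : σ'.var x = σ.var x := h.var' x hx

theorem Same.arr {S : Stmt} {σ σ' : Store} (h : Same S σ σ') (a : Arr)
    (ha : S.writesArr a = false := by rfl) : σ'.arr a = σ.arr a := h.arr' a ha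

theorem Same.wt {S : Stmt} {σ σ' : Store} (h : Same S σ σ')
    (hw : S.writesWt = false := by rfl) : σ'.wt = σ.wt := h.wt' hw

theorem Same.refl (S : Stmt) (σ : Store) : Same S σ σ :=
  ⟨fun _ _ => rfl, fun _ _ => rfl, fun _ => rfl⟩

theorem Same.trans {S : Stmt} {σ σ' σ'' : Store} (h : Same S σ σ') (h' : Same S σ' σ'') :
    Same S σ σ'' :=
  ⟨fun x hx => (h'.var x hx).trans (h.var x hx), fun a ha => (h'.arr a ha).trans (h.arr a ha),
    fun hw => (h'.wt hw).trans (h.wt hw)⟩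

theorem Same.mono {S S' : Stmt} {σ σ' : Store} (h : Same S σ σ')
    (hv : ∀ x, S'.writesVar x = false → S.writesVar x = false)
    (ha : ∀ x, S'.writesArr x = false → S.writesArr x = false)
    (hw : S'.writesWt = false → S.writesWt = false) : Same S' σ σ' :=
  ⟨fun x hx => h.var x (hv x hx), fun x hx => h.arr x (ha x hx), fun hx => h.wt (hw hx)⟩

theorem Exec.same {Z : ℕ} {S : Stmt} {σ σ' : Store} {t : ℕ} (h : Exec Z S σ t σ') :
    Same S σ σ' := by
  induction h with
  | skip σ => exact Same.refl _ _
  | assign x _ =>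
    refine ⟨fun y hy => ?_, fun _ _ => rfl, fun _ => rfl⟩
    have : y ≠ x := by
      rintro rfl
      simp [Stmt.writesVar] at hy
    simp [this]
  | put a _ _ _ =>
    refine ⟨fun _ _ => rfl, fun b hb => ?_, fun _ => rfl⟩
    have : b ≠ a := by
      rintro rfl
      simp [Stmt.writesArr] at hb
    simp [this]
  | wput => exact ⟨fun _ _ => rfl, fun _ _ => rfl, fun h => by simp [Stmt.writesWt] at h⟩
  | seq _ _ h1 h2 =>
    refine (h1.mono ?_ ?_ ?_).trans (h2.mono ?_ ?_ ?_) <;>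
      simp +contextual [Stmt.writesVar, Stmt.writesArr, Stmt.writesWt]
  | ite_true _ _ _ h | ite_false _ _ _ h =>
    refine h.mono ?_ ?_ ?_ <;> simp +contextual [Stmt.writesVar, Stmt.writesArr, Stmt.writesWt]
  | loop_false => exact Same.refl _ _
  | loop_true _ _ _ _ h1 h2 =>
    refine (h1.mono ?_ ?_ ?_).trans h2 <;>
      simp +contextual [Stmt.writesVar, Stmt.writesArr, Stmt.writesWt]

/-! ### Total correctness with running times -/

/-- Started in `σ`, the statement `S` terminates, with a running time and in a store that
satisfy `Q`. -/
def Wp (Z : ℕ) (S : Stmt) (σ : Store) (Q : ℕ → Store → Prop) : Prop :=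
  ∃ t σ', Exec Z S σ t σ' ∧ Q t σ'

section rules

variable {Z : ℕ} {σ : Store} {Q : ℕ → Store → Prop}

theorem Wp.mono {S : Stmt} {Q' : ℕ → Store → Prop} (h : Wp Z S σ Q)
    (hQ : ∀ t σ', Same S σ σ' → Q t σ' → Q' t σ') : Wp Z S σ Q' := by
  obtain ⟨t, σ', he, h⟩ := h
  exact ⟨t, σ', he, hQ t σ' he.same h⟩

@[simp] theorem wp_skip : Wp Z .skip σ Q ↔ Q 1 σ :=
  ⟨fun ⟨_, _, he, h⟩ => by cases he; exact h, fun h => ⟨_, _, .skip _, h⟩⟩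

@[simp] theorem wp_assign {x : Var} {e : Expr} :
    Wp Z (x ::= e) σ Q ↔ e.Ok Z σ ∧ Q 1 (σ.set x (e.eval σ)) :=
  ⟨fun ⟨_, _, he, h⟩ => by cases he with | assign x ho => exact ⟨ho, h⟩,
    fun ⟨ho, h⟩ => ⟨_, _, .assign x ho, h⟩⟩

@[simp] theorem wp_put {a : Arr} {e f : Expr} :
    Wp Z (.put a e f) σ Q ↔
      e.Ok Z σ ∧ f.Ok Z σ ∧ e.eval σ < Z ∧ Q 1 (σ.put a (e.eval σ) (f.eval σ)) :=
  ⟨fun ⟨_, _, he, h⟩ => by cases he with | put a h1 h2 h3 => exact ⟨h1, h2, h3, h⟩,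
    fun ⟨h1, h2, h3, h⟩ => ⟨_, _, .put a h1 h2 h3, h⟩⟩

@[simp] theorem wp_wput {e f : Expr} :
    Wp Z (.wput e f) σ Q ↔ e.Ok Z σ ∧ f.Ok Z σ ∧ e.eval σ < Z ∧ f.eval σ < Z ∧
      Q 1 (σ.wput (e.eval σ) (σ.wt (f.eval σ))) :=
  ⟨fun ⟨_, _, he, h⟩ => by cases he with | wput h1 h2 h3 h4 => exact ⟨h1, h2, h3, h4, h⟩,
    fun ⟨h1, h2, h3, h4, h⟩ => ⟨_, _, .wput h1 h2 h3 h4, h⟩⟩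

@[simp] theorem wp_seq {p q : Stmt} :
    Wp Z (p ;; q) σ Q ↔ Wp Z p σ fun t σ' => Wp Z q σ' fun t' => Q (t + t') :=
  ⟨fun ⟨_, _, he, h⟩ => by cases he with | seq h1 h2 => exact ⟨_, _, h1, _, _, h2, h⟩,
    fun ⟨_, _, h1, _, _, h2, h⟩ => ⟨_, _, .seq h1 h2, h⟩⟩

@[simp] theorem wp_ite {b : Cond} {p q : Stmt} :
    Wp Z (.ite b p q) σ Q ↔ b.Ok Z σ ∧ (b.Holds σ → Wp Z p σ fun t => Q (t + 1)) ∧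
      (¬ b.Holds σ → Wp Z q σ fun t => Q (t + 1)) := by
  constructor
  · rintro ⟨_, _, he, h⟩
    cases he with
    | ite_true ho hb hp => exact ⟨ho, fun _ => ⟨_, _, hp, h⟩, fun hb' => absurd hb hb'⟩
    | ite_false ho hb hp => exact ⟨ho, fun hb' => absurd hb' hb, fun _ => ⟨_, _, hp, h⟩⟩
  · rintro ⟨ho, h1, h2⟩
    by_cases hb : b.Holds σ
    · obtain ⟨_, _, hp, h⟩ := h1 hb
      exact ⟨_, _, .ite_true ho hb hp, h⟩
    · obtain ⟨_, _, hp, h⟩ := h2 hb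
      exact ⟨_, _, .ite_false ho hb hp, h⟩

/-- Loop rule: `I t σ` says that `σ` may be reached after `t` steps. -/
theorem Wp.loop {b : Cond} {p : Stmt} (I : ℕ → Store → Prop) (μ : Store → ℕ) (h0 : I 0 σ)
    (hok : ∀ t σ', Same p σ σ' → I t σ' → b.Ok Z σ')
    (hstep : ∀ t σ', Same p σ σ' → I t σ' → b.Holds σ' →
      Wp Z p σ' fun t' σ'' => I (t + t' + 1) σ'' ∧ μ σ'' < μ σ')
    (hQ : ∀ t σ', Same p σ σ' → I t σ' → ¬ b.Holds σ' → Q (t + 1) σ') :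
    Wp Z (.loop b p) σ Q := by
  -- Induction on a bound for the measure, with the elapsed time `t` generalized because the
  -- invariant refers to it.
  have main : ∀ N t σ', μ σ' < N → Same p σ σ' → I t σ' →
      Wp Z (.loop b p) σ' fun t' => Q (t + t') := by
    intro N
    induction N with
    | zero => intro t σ' h; omega
    | succ N ih =>
      intro t σ' hμ hs hI
      have ho := hok t σ' hs hI
      by_cases hb : b.Holds σ'
      · obtain ⟨t', σ'', he, hI', hμ'⟩ := hstep t σ' hs hI hb
        obtain ⟨t'', σ''', he', h⟩ := ih (t + t' + 1) σ'' (by omega) (hs.trans he.same) hI'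
        refine ⟨_, _, .loop_true ho hb he he', ?_⟩
        have e : t + (t' + t'' + 1) = t + t' + 1 + t'' := by ring
        simpa only [e] using h
      · exact ⟨_, _, .loop_false ho hb, hQ t σ' hs hI hb⟩
  simpa using main (μ σ + 1) 0 σ (by omega) (Same.refl _ _) h0

/-- `for x := 0, …, e - 1 do p` -/
def Stmt.upTo (x : Var) (e : Expr) (p : Stmt) : Stmt :=
  x ::= 0 ;; .loop (.lt x e) (p ;; x ::= x + 1)

/-- Here the invariant sees the elapsed time, which permits amortized bounds. Each iteration pays 2
extra steps for test and increment; the final 2 are the initialization and the failing test. -/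
theorem Wp.upTo_of_cost {x : Var} {e : Expr} {p : Stmt} (m : ℕ) (hm : m < Z)
    (I : ℕ → ℕ → Store → Prop)
    (he : ∀ σ', Same (.upTo x e p) σ σ' → e.Ok Z σ' ∧ e.eval σ' = m)
    (h0 : I 0 0 (σ.set x 0))
    (hstep : ∀ j t σ', j < m → Same (.upTo x e p) σ σ' → σ'.var x = j → I j t σ' →
      Wp Z p σ' fun t' σ'' => I (j + 1) (t + t' + 2) (σ''.set x (j + 1)))
    (hQ : ∀ t σ', Same (.upTo x e p) σ σ' → I m t σ' → Q (t + 2) σ')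
    (hx : p.writesVar x = false := by rfl) :
    Wp Z (.upTo x e p) σ Q := by
  have hsame : ∀ σ', Same (p ;; x ::= x + 1) (σ.set x 0) σ' → Same (.upTo x e p) σ σ' := by
    intro σ' h
    refine Same.trans (σ' := σ.set x 0) ⟨?_, fun _ _ => rfl, fun _ => rfl⟩ (h.mono ?_ ?_ ?_)
    · intro y hy
      have : y ≠ x := by
        rintro rfl
        simp [Stmt.upTo, Stmt.writesVar] at hy
      simp [this]
    all_goals simp +contextual [Stmt.upTo, Stmt.writesVar, Stmt.writesArr, Stmt.writesWt]
  have hle : ∀ σ', Same (p ;; x ::= x + 1) (σ.set x 0) σ' → e.eval σ' = m :=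
    fun σ' h => (he σ' (hsame σ' h)).2
  refine wp_seq.2 (wp_assign.2 ⟨show 0 < Z by omega, ?_⟩)
  refine Wp.loop (fun t σ' => ∃ j, j ≤ m ∧ σ'.var x = j ∧ I j t σ') (fun σ' => m - σ'.var x)
    ⟨0, Nat.zero_le _, by simp, h0⟩ ?_ ?_ ?_
  · rintro t σ' hs ⟨j, hj, hxj, hI⟩
    exact ⟨trivial, (he σ' (hsame σ' hs)).1⟩
  · rintro t σ' hs ⟨j, hj, hxj, hI⟩ hb
    have hjm : j < m := by
      have : σ'.var x < e.eval σ' := hb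
      rw [hle σ' hs] at this
      omega
    refine wp_seq.2 ((hstep j t σ' hjm (hsame σ' hs) hxj hI).mono fun t' σ'' hs' hI' => ?_)
    have hxj' : σ''.var x = j := (hs'.var x hx).trans hxj
    refine wp_assign.2 ⟨⟨trivial, show 1 < Z by omega, ?_⟩, ⟨j + 1, hjm, ?_, ?_⟩, ?_⟩
    · simp only [Expr.eval, hxj', ArithOp.eval]
      omega
    · simp [hxj']
    · simpa [hxj', add_assoc] using hI'
    · simp [hxj', hxj]
      omega
  · rintro t σ' hs ⟨j, hj, hxj, hI⟩ hb
    have hjm : j = m := by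
      have : ¬ σ'.var x < e.eval σ' := hb
      rw [hle σ' hs] at this
      omega
    subst hjm
    rw [show 1 + (t + 1) = t + 2 by ring]
    exact hQ t σ' (hsame σ' hs) hI

/-- Rule for a `for`-loop whose body takes at most `c` steps. -/
theorem Wp.upTo {x : Var} {e : Expr} {p : Stmt} (m c : ℕ) (hm : m < Z)
    (I : ℕ → Store → Prop)
    (he : ∀ σ', Same (.upTo x e p) σ σ' → e.Ok Z σ' ∧ e.eval σ' = m)
    (h0 : I 0 (σ.set x 0))
    (hstep : ∀ j σ', j < m → Same (.upTo x e p) σ σ' → σ'.var x = j → I j σ' →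
      Wp Z p σ' fun t' σ'' => t' ≤ c ∧ I (j + 1) (σ''.set x (j + 1)))
    (hQ : ∀ t σ', t ≤ m * (c + 2) + 2 → Same (.upTo x e p) σ σ' → I m σ' → Q t σ')
    (hx : p.writesVar x = false := by rfl) :
    Wp Z (.upTo x e p) σ Q := by
  refine Wp.upTo_of_cost m hm (fun j t σ' => t ≤ j * (c + 2) ∧ I j σ') he ⟨by simp, h0⟩ ?_ ?_ hx
  · rintro j t σ' hj hs hx' ⟨ht, hI⟩
    refine (hstep j σ' hj hs hx' hI).mono fun t' σ'' _ h => ⟨?_, h.2⟩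
    have := h.1
    rw [Nat.succ_mul]
    omega
  · rintro t σ' hs ⟨ht, hI⟩
    exact hQ _ _ (by omega) hs hI

end rules

end CutMerge

/-! ### Parent functions, subtrees and the cuts of a rooted tree. -/

namespace CutMerge

open Relation

/-! ### Rooted trees on initial segments of `ℕ` -/

/-- `par` is the parent function of a tree on `0, …, n - 1` with root `0`; `dep` decreases
towards the root. -/
structure Rooted (n : ℕ) (par dep : ℕ → ℕ) : Prop where
  par_lt : ∀ x < n, par x < n
  dep_par : ∀ x < n, x ≠ 0 → dep (par x) < dep x
  par_zero : par 0 = 0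
  dep_zero : dep 0 = 0

/-- `q` is `z` or an ancestor of `z`. -/
def Anc (par : ℕ → ℕ) (q z : ℕ) : Prop := ∃ m, par^[m] z = q

theorem Anc.refl (par : ℕ → ℕ) (q : ℕ) : Anc par q q := ⟨0, rfl⟩

/-- Going up one edge leaves the subtree of `q` only if that edge is the one above `q`. So the cut
of `q` separates the ends of no other tree edge. -/
theorem anc_par_iff {par : ℕ → ℕ} {q z : ℕ} (h : z ≠ q) : Anc par q (par z) ↔ Anc par q z := by
  constructor
  · rintro ⟨m, hm⟩
    exact ⟨m + 1, hm⟩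
  · rintro ⟨_ | m, hm⟩
    · exact absurd hm h
    · exact ⟨m, hm⟩

theorem Anc.trans {par : ℕ → ℕ} {a b c : ℕ} (hab : Anc par a b) (hbc : Anc par b c) :
    Anc par a c := by
  obtain ⟨m, rfl⟩ := hab
  obtain ⟨l, rfl⟩ := hbc
  exact ⟨m + l, by rw [Function.iterate_add_apply]⟩

namespace Rooted

variable {n : ℕ} {par dep : ℕ → ℕ} (h : Rooted n par dep)
include h

theorem iterate_zero (m : ℕ) : par^[m] 0 = 0 := by
  induction m with
  | zero => rfl
  | succ m ih => rw [Function.iterate_succ_apply, h.par_zero, ih]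

theorem anc_zero {q : ℕ} : Anc par q 0 ↔ q = 0 := by
  constructor
  · rintro ⟨m, hm⟩
    rw [← hm, h.iterate_zero]
  · rintro rfl
    exact Anc.refl _ _

theorem eq_or_dep_lt {q z : ℕ} (hz : z < n) (hq : Anc par q z) : q = z ∨ dep q < dep z := by
  obtain ⟨m, rfl⟩ := hq
  induction m generalizing z with
  | zero => exact Or.inl rfl
  | succ m ih =>
    rw [Function.iterate_succ_apply]
    by_cases h0 : z = 0
    · subst h0
      left
      rw [h.par_zero, h.iterate_zero]
    · right
      have := h.dep_par z hz h0
      rcases ih (h.par_lt z hz) with h1 | h1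
      · rw [h1]
        exact this
      · exact h1.trans this

theorem not_anc_par {x : ℕ} (hx : x < n) (h0 : x ≠ 0) : ¬ Anc par x (par x) := by
  intro ha
  have := h.dep_par x hx h0
  rcases h.eq_or_dep_lt (h.par_lt x hx) ha with h1 | h1
  · rw [← h1] at this
    omega
  · omega

theorem par_ne {x : ℕ} (hx : x < n) (h0 : x ≠ 0) : par x ≠ x := fun he =>
  h.not_anc_par hx h0 (by rw [he]; exact Anc.refl _ _)

/-- Vertices are connected by the edges `(x, par x)` with `P x` if and only if all separating
vertices satisfy `P`. -/
theorem eqvGen_iff {P : ℕ → Prop} {x y : ℕ} (hx : x < n) (hy : y < n) :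
    EqvGen (fun a b => ∃ q, 0 < q ∧ q < n ∧ P q ∧ q = a ∧ par q = b) x y ↔
      ∀ q, 0 < q → q < n → ¬ (Anc par q x ↔ Anc par q y) → P q := by
  constructor
  · intro hxy
    clear hx hy
    induction hxy with
    | rel a b hab =>
      obtain ⟨q, hq0, hq, hP, rfl, rfl⟩ := hab
      intro r hr0 hr hs
      by_cases hqr : q = r
      · exact hqr ▸ hP
      · exact absurd (anc_par_iff hqr).symm hs
    | refl a => exact fun q _ _ hs => absurd Iff.rfl hs
    | symm a b _ ih => exact fun q h0 hq hs => ih q h0 hq fun he => hs he.symm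
    | trans a b c _ _ ih1 ih2 =>
      intro q h0 hq hs
      by_cases h1 : Anc par q a ↔ Anc par q b
      · exact ih2 q h0 hq fun h2 => hs (h1.trans h2)
      · exact ih1 q h0 hq h1
  -- Replace the deeper of the two vertices by its parent.
  · induction hd : dep x + dep y using Nat.strong_induction_on generalizing x y with
    | _ d ih =>
      have main : ∀ x y, x < n → y < n → dep x + dep y = d → dep y ≤ dep x →
          (∀ q, 0 < q → q < n → ¬ (Anc par q x ↔ Anc par q y) → P q) →
          EqvGen (fun a b => ∃ q, 0 < q ∧ q < n ∧ P q ∧ q = a ∧ par q = b) x y := by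
        intro x y hx hy hd hle hP
        by_cases hxy : x = y
        · exact hxy ▸ EqvGen.refl _
        have hx0 : x ≠ 0 := by
          rintro rfl
          have := h.dep_zero
          have : dep y = 0 := by omega
          by_cases hy0 : y = 0
          · omega
          · have := h.dep_par y hy hy0
            omega
        -- Since `x` is at least as deep as `y` and different from it, the edge above `x` lies on
        -- the path, so `P x` is available.
        have hsep : ¬ Anc par x y := fun ha => by
          rcases h.eq_or_dep_lt hy ha with h1 | h1
          · exact hxy h1
          · omega
        have hPx : P x := hP x (by omega) hx fun he => hsep (he.1 (Anc.refl _ _))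
        have hdp := h.dep_par x hx hx0
        refine EqvGen.trans _ (par x) _ (EqvGen.rel _ _ ⟨x, by omega, hx, hPx, rfl, rfl⟩)
          (ih _ (by omega) (h.par_lt x hx) hy rfl fun q hq0 hq hs => ?_)
        by_cases hqx : x = q
        · exact hqx ▸ hPx
        · exact hP q hq0 hq (by rwa [anc_par_iff hqx] at hs)
      intro hP
      rcases le_total (dep y) (dep x) with hle | hle
      · exact main x y hx hy hd hle hP
      · exact (main y x hy hx (by omega) hle
          fun q h0 hq hs => hP q h0 hq fun he => hs he.symm).symm

/-- Every pair of distinct vertices is separated. -/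
theorem exists_sep {x y : ℕ} (hx : x < n) (hy : y < n) (hxy : x ≠ y) :
    ∃ q, 0 < q ∧ q < n ∧ ¬ (Anc par q x ↔ Anc par q y) := by
  by_contra hc
  push Not at hc
  by_cases hx0 : x = 0
  · subst hx0
    have := (hc y (by omega) hy).2 (Anc.refl _ _)
    exact hxy (h.anc_zero.1 this).symm
  · by_cases hy0 : y = 0
    · subst hy0
      have := (hc x (by omega) hx).1 (Anc.refl _ _)
      exact hxy (h.anc_zero.1 this)
    · have h1 := h.eq_or_dep_lt hy ((hc x (by omega) hx).1 (Anc.refl _ _))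
      have h2 := h.eq_or_dep_lt hx ((hc y (by omega) hy).2 (Anc.refl _ _))
      omega

end Rooted

/-! ### Rooted trees and graphs -/

/-- `par` is a parent function for the graph `G`. -/
def IsParent {n : ℕ} (G : SimpleGraph (Fin n)) (par : ℕ → ℕ) : Prop :=
  ∀ x y : Fin n, G.Adj x y ↔ ((x : ℕ) ≠ 0 ∧ par x = y) ∨ ((y : ℕ) ≠ 0 ∧ par y = x)

namespace Rooted

variable {n : ℕ} {par dep : ℕ → ℕ} (h : Rooted n par dep)

/-- The edge from `x` to its parent. -/
def edge (x : Fin n) : Sym2 (Fin n) := s(x, ⟨par x, h.par_lt x x.2⟩)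

include h

/-- Otherwise two vertices would be parents of each other, and `dep` would decrease both ways. -/
theorem edge_injOn {x y : Fin n} (hx : (x : ℕ) ≠ 0) (hy : (y : ℕ) ≠ 0)
    (hxy : h.edge x = h.edge y) : x = y := by
  simp only [edge, Sym2.eq_iff, Fin.ext_iff] at hxy
  rcases hxy with hxy | ⟨h1, h2⟩
  · exact Fin.ext hxy.1
  · have h3 := h.dep_par x x.2 hx
    have h4 := h.dep_par y y.2 hy
    rw [h2] at h3
    rw [← h1] at h4
    omega

theorem edge_mem {G : SimpleGraph (Fin n)} (hG : IsParent G par) {x : Fin n}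
    (hx : (x : ℕ) ≠ 0) : h.edge x ∈ G.edgeSet :=
  (hG _ _).2 (Or.inl ⟨hx, rfl⟩)

theorem mem_edgeSet {G : SimpleGraph (Fin n)} (hG : IsParent G par) {e : Sym2 (Fin n)} :
    e ∈ G.edgeSet ↔ ∃ x : Fin n, (x : ℕ) ≠ 0 ∧ h.edge x = e := by
  constructor
  · induction e with
    | _ x y =>
    intro hxy
    rcases (hG x y).1 hxy with ⟨h0, he⟩ | ⟨h0, he⟩
    · exact ⟨x, h0, by simp [edge, he]⟩
    · exact ⟨y, h0, by simp [edge, he]⟩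
  · rintro ⟨x, h0, rfl⟩
    exact h.edge_mem hG h0

/-- The edges of the graph are numbered by the vertices `1, …, n - 1`. -/
noncomputable def edgeEquiv {G : SimpleGraph (Fin n)} (hG : IsParent G par) :
    Fin (n - 1) ≃ G.edgeSet :=
  Equiv.ofBijective
    (fun j => ⟨h.edge ⟨j + 1, by omega⟩, h.edge_mem hG (by simp)⟩) <| by
    constructor
    · intro i j hij
      have := h.edge_injOn (by simp) (by simp) (congrArg Subtype.val hij)
      simp only [Fin.mk.injEq] at this
      exact Fin.ext (by omega)
    · rintro ⟨e, he⟩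
      obtain ⟨x, hx, rfl⟩ := (h.mem_edgeSet hG).1 he
      refine ⟨⟨x - 1, by omega⟩, Subtype.ext ?_⟩
      have : (⟨(x : ℕ) - 1 + 1, by omega⟩ : Fin n) = x := Fin.ext (by simp; omega)
      simp only [this]

theorem reachable_root {G : SimpleGraph (Fin n)} (hG : IsParent G par) (h0 : 0 < n) (x : Fin n) :
    G.Reachable x ⟨0, h0⟩ := by
  induction hd : dep x using Nat.strong_induction_on generalizing x with
  | _ d ih =>
    by_cases hx : (x : ℕ) = 0
    · have : x = ⟨0, h0⟩ := Fin.ext hx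
      rw [this]
    · have hadj : G.Adj x ⟨par x, h.par_lt x x.2⟩ := (hG _ _).2 (Or.inl ⟨hx, rfl⟩)
      exact hadj.reachable.trans (ih _ (hd ▸ h.dep_par x x.2 hx) _ rfl)

theorem isTree {G : SimpleGraph (Fin n)} (hG : IsParent G par) (h0 : 0 < n) : G.IsTree := by
  rw [SimpleGraph.isTree_iff_connected_and_card]
  constructor
  · have : Nonempty (Fin n) := ⟨⟨0, h0⟩⟩
    exact ⟨fun x y => (h.reachable_root hG h0 x).trans (h.reachable_root hG h0 y).symm⟩
  · rw [← Nat.card_congr (h.edgeEquiv hG)]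
    simp
    omega

theorem exists_isParent : ∃ G : SimpleGraph (Fin n), IsParent G par := by
  refine ⟨⟨fun x y => ((x : ℕ) ≠ 0 ∧ par x = y) ∨ ((y : ℕ) ≠ 0 ∧ par y = x), ⟨?_⟩, ⟨?_⟩⟩, ?_⟩
  · intro x y hxy
    exact hxy.symm
  · rintro x (hx | hx)
    · exact h.par_ne x.2 hx.1 hx.2
    · exact h.par_ne x.2 hx.1 hx.2
  · intro x y
    rfl

/-- Once the edge above `q` is gone, climbing parents takes every descendant of `q` to `q` and every
other vertex to the root; conversely, no remaining edge changes membership in the subtree, by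
`anc_par_iff`. -/
theorem side_edge {T : CutTree (Fin n)} (hT : IsParent T.graph par) {q : Fin n}
    (hq : (q : ℕ) ≠ 0) (a : Fin n) :
    T.side (h.edge q) a = {z : Fin n | Anc par q z ↔ Anc par q a} := by
  have hadj : ∀ x : Fin n, (x : ℕ) ≠ 0 → x ≠ q →
      (T.graph.deleteEdges {h.edge q}).Adj x ⟨par x, h.par_lt x x.2⟩ := by
    intro x hx hxq
    rw [SimpleGraph.deleteEdges_adj]
    refine ⟨(hT _ _).2 (Or.inl ⟨hx, rfl⟩), fun he => hxq (h.edge_injOn hx hq he)⟩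
  have hin : ∀ x : Fin n, Anc par q x → (T.graph.deleteEdges {h.edge q}).Reachable x q := by
    rintro x ⟨m, hm⟩
    induction m generalizing x with
    | zero => rw [Fin.ext hm]
    | succ m ih =>
      by_cases hxq : x = q
      · rw [hxq]
      · have hx0 : (x : ℕ) ≠ 0 := fun hx0 => hq (by rw [← hm, hx0, h.iterate_zero])
        exact (hadj x hx0 hxq).reachable.trans (ih _ hm)
  have h0 : 0 < n := q.pos
  have hout : ∀ x : Fin n, ¬ Anc par q x →
      (T.graph.deleteEdges {h.edge q}).Reachable x ⟨0, h0⟩ := by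
    intro x
    induction hd : dep x using Nat.strong_induction_on generalizing x with
    | _ d ih =>
      intro hx
      by_cases hx0 : (x : ℕ) = 0
      · have : x = ⟨0, h0⟩ := Fin.ext hx0
        rw [this]
      · have hxq : x ≠ q := by
          rintro rfl
          exact hx (Anc.refl _ _)
        refine (hadj x hx0 hxq).reachable.trans (ih _ (hd ▸ h.dep_par x x.2 hx0) _ rfl ?_)
        rwa [anc_par_iff (fun he => hxq (Fin.ext he))]
  ext z
  simp only [CutTree.side, Set.mem_ofPred_eq]
  constructor
  · rintro ⟨p⟩
    induction p with
    | nil => exact Iff.rfl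
    | @cons u v w huv p ih =>
      rw [ih]
      rw [SimpleGraph.deleteEdges_adj] at huv
      obtain ⟨huv, hne⟩ := huv
      rcases (hT u v).1 huv with ⟨hu0, he⟩ | ⟨hv0, he⟩
      · rw [← he, anc_par_iff]
        intro huq
        apply hne
        rw [← Fin.ext huq]
        simp [edge, he]
      · rw [← he, anc_par_iff]
        intro huq
        apply hne
        rw [← Fin.ext huq]
        simp [edge, he]
  · intro hz
    by_cases ha : Anc par q a
    · exact (hin a ha).trans (hin z (hz.2 ha)).symm
    · exact (hout a ha).trans (hout z fun hc => ha (hz.1 hc)).symm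

theorem isCut_iff {T : CutTree (Fin n)} (hT : IsParent T.graph par) {a b : Fin n}
    {X : Set (Fin n)} {c : ℝ} :
    T.IsCut a b X c ↔ ∃ q : Fin n, (q : ℕ) ≠ 0 ∧ ¬ (Anc par q a ↔ Anc par q b) ∧
      X = {z : Fin n | Anc par q z ↔ Anc par q a} ∧ T.weight (h.edge q) = c := by
  constructor
  · rintro ⟨e, he, rfl, hb, hc⟩
    obtain ⟨q, hq, rfl⟩ := (h.mem_edgeSet hT).1 he
    rw [h.side_edge hT hq] at hb ⊢
    exact ⟨q, hq, fun hc => hb hc.symm, rfl, hc⟩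
  · rintro ⟨q, hq, hs, rfl, hc⟩
    exact ⟨h.edge q, h.edge_mem hT hq, h.side_edge hT hq a, fun hc => hs (Iff.symm hc), hc⟩

end Rooted

/-- The parent is a neighbour closer to vertex 0. The parent edges are n - 1 distinct edges of a
graph with n - 1 edges, so there are no others. -/
theorem exists_rooted {n : ℕ} {G : SimpleGraph (Fin n)} (hG : G.IsTree) (h0 : 0 < n) :
    ∃ par dep : ℕ → ℕ, Rooted n par dep ∧ IsParent G par := by
  set r : Fin n := ⟨0, h0⟩
  have hstep : ∀ x : Fin n, x ≠ r → ∃ y, G.Adj x y ∧ G.dist y r < G.dist x r := by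
    intro x hx
    obtain ⟨p, hp⟩ := hG.1.exists_walk_length_eq_dist x r
    cases p with
    | nil => exact absurd rfl hx
    | @cons _ y _ hxy p =>
      refine ⟨y, hxy, ?_⟩
      rw [← hp, SimpleGraph.Walk.length_cons]
      exact Nat.lt_succ_of_le (SimpleGraph.dist_le p)
  choose! f hf using hstep
  let par : ℕ → ℕ := fun x => if hx : x < n then if x = 0 then 0 else f ⟨x, hx⟩ else 0
  let dep : ℕ → ℕ := fun x => if hx : x < n then G.dist ⟨x, hx⟩ r else 0
  have hpar : ∀ x : Fin n, (x : ℕ) ≠ 0 → par x = f x := by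
    intro x hx
    simp [par, hx]
  have hne : ∀ x : Fin n, (x : ℕ) ≠ 0 → x ≠ r := fun x hx he => hx (by rw [he])
  have hr : Rooted n par dep := by
    refine ⟨fun x hx => ?_, fun x hx hx0 => ?_, by simp [par], ?_⟩
    · simp only [par, hx, dif_pos]
      split_ifs
      · exact h0
      · exact (f ⟨x, hx⟩).2
    · have := (hf ⟨x, hx⟩ (hne _ hx0)).2
      rw [hpar ⟨x, hx⟩ hx0]
      simpa [dep, hx] using this
    · simp only [dep, h0, dif_pos]
      exact SimpleGraph.dist_self
  refine ⟨par, dep, hr, ?_⟩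
  have hadj : ∀ x : Fin n, (x : ℕ) ≠ 0 → G.Adj x (f x) := fun x hx => (hf x (hne x hx)).1
  have hedge : ∀ x : Fin n, (x : ℕ) ≠ 0 → hr.edge x = s(x, f x) := by
    intro x hx
    simp [Rooted.edge, hpar x hx]
  have hsurj : ∀ e ∈ G.edgeSet, ∃ x : Fin n, (x : ℕ) ≠ 0 ∧ hr.edge x = e := by
    let g : Fin (n - 1) → G.edgeSet := fun j => ⟨hr.edge ⟨j + 1, by omega⟩, by
      rw [hedge _ (by simp)]
      exact hadj _ (by simp)⟩
    have hg : Function.Bijective g := by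
      rw [Nat.bijective_iff_injective_and_card]
      constructor
      · intro i j hij
        have := hr.edge_injOn (by simp) (by simp) (congrArg Subtype.val hij)
        simp only [Fin.mk.injEq] at this
        exact Fin.ext (by omega)
      · have := (SimpleGraph.isTree_iff_connected_and_card.1 hG).2
        simp only [Nat.card_eq_fintype_card, Fintype.card_fin] at this ⊢
        omega
    intro e he
    obtain ⟨j, hj⟩ := hg.2 ⟨e, he⟩
    exact ⟨_, by simp, congrArg Subtype.val hj⟩
  intro x y
  constructor
  · intro hxy
    obtain ⟨z, hz, he⟩ := hsurj s(x, y) hxy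
    rw [hedge z hz, Sym2.eq_iff] at he
    rcases he with ⟨rfl, rfl⟩ | ⟨rfl, rfl⟩
    · exact Or.inl ⟨hz, hpar _ hz⟩
    · exact Or.inr ⟨hz, hpar _ hz⟩
  · rintro (⟨hx, he⟩ | ⟨hx, he⟩)
    · rw [hpar x hx] at he
      exact Fin.ext he ▸ hadj x hx
    · rw [hpar y hx] at he
      exact Fin.ext he ▸ (hadj y hx).symm

end CutMerge

/-! ### Families of trees, flow trees, and the tree of best cuts. -/

namespace CutMerge

open Relation

/-! ### Families of rooted trees with numbered edges -/

/-- `k` rooted trees on `0, …, n - 1` whose edges are numbered consecutively, tree after tree. The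
edge `f` has endpoints `U f`, `V f` and weight `W f`, and joins `ch f` to its parent; the edge
from `x` to its parent in tree `i` is `eid i x`. -/
structure Family (n k : ℕ) where
  U : ℕ → ℕ
  V : ℕ → ℕ
  W : ℕ → ℝ
  par : ℕ → ℕ → ℕ
  dep : ℕ → ℕ → ℕ
  eid : ℕ → ℕ → ℕ
  ch : ℕ → ℕ
  n_pos : 0 < n
  k_pos : 0 < k
  rooted : ∀ i < k, Rooted n (par i) (dep i)
  eid_spec : ∀ i < k, ∀ x, 0 < x → x < n →
    i * (n - 1) ≤ eid i x ∧ eid i x < (i + 1) * (n - 1) ∧ ch (eid i x) = x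
  ch_spec : ∀ i < k, ∀ f, i * (n - 1) ≤ f → f < (i + 1) * (n - 1) →
    0 < ch f ∧ ch f < n ∧ eid i (ch f) = f
  ends : ∀ i < k, ∀ x, 0 < x → x < n →
    (U (eid i x) = x ∧ V (eid i x) = par i x) ∨ (V (eid i x) = x ∧ U (eid i x) = par i x)

theorem eqvGen_of_le {α : Type*} {r s : α → α → Prop} (h : ∀ a b, r a b → EqvGen s a b) {a b : α}
    (hab : EqvGen r a b) : EqvGen s a b := by
  induction hab with
  | rel a b hab => exact h a b hab
  | refl a => exact EqvGen.refl _
  | symm a b _ ih => exact ih.symm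
  | trans a b c _ _ ih1 ih2 => exact ih1.trans _ _ _ ih2

/-- The equivalence relation generated by the edges `(u j, v j)` with `J j`. -/
def Link (J : ℕ → Prop) (u v : ℕ → ℕ) : ℕ → ℕ → Prop :=
  EqvGen fun a b => ∃ j, J j ∧ u j = a ∧ v j = b

namespace Family

variable {n k : ℕ} (D : Family n k)

/-- The side without the root of the cut given by an edge. -/
def cut (f z : ℕ) : Prop := Anc (D.par (f / (n - 1))) (D.ch f) z

def Sep (f x y : ℕ) : Prop := ¬ (D.cut f x ↔ D.cut f y)

/-- Edges are ordered by weight, ties being broken by their numbers. -/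
def key (f : ℕ) : ℝ ×ₗ ℕ := toLex (D.W f, f)

def UpClosed (P : ℕ → Prop) : Prop := ∀ f g, P f → D.key f ≤ D.key g → P g

/-- The cut is the first one among those that separate some pair of vertices. -/
def Best (f : ℕ) : Prop :=
  f < k * (n - 1) ∧ ∃ x < n, ∃ y < n, D.Sep f x y ∧
    ∀ g < k * (n - 1), D.Sep g x y → D.key f ≤ D.key g

/-- Best cuts do not cross. -/
def Laminar : Prop :=
  ∀ f g, D.Best f → D.Best g → (∀ z < n, D.cut f z → D.cut g z) ∨
    (∀ z < n, D.cut g z → D.cut f z) ∨ ∀ z < n, ¬ (D.cut f z ∧ D.cut g z)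

theorem key_injective : Function.Injective D.key := by
  intro a b h
  have h : (D.W a, a) = (D.W b, b) := h
  exact (Prod.ext_iff.1 h).2

theorem key_le_iff {a b : ℕ} : D.key a ≤ D.key b ↔ D.W a < D.W b ∨ D.W a = D.W b ∧ a ≤ b :=
  Prod.Lex.le_iff

theorem weight_le {a b : ℕ} (h : D.key a ≤ D.key b) : D.W a ≤ D.W b := by
  rcases D.key_le_iff.1 h with h | h
  · exact h.le
  · exact h.1.le

theorem tree_of_lt {f : ℕ} (hf : f < k * (n - 1)) :
    f / (n - 1) < k ∧ f / (n - 1) * (n - 1) ≤ f ∧ f < (f / (n - 1) + 1) * (n - 1) := by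
  have hn : 0 < n - 1 := Nat.pos_of_ne_zero fun h0 => by simp [h0] at hf
  exact ⟨(Nat.div_lt_iff_lt_mul hn).2 hf, Nat.div_mul_le_self _ _,
    by rw [mul_comm]; exact Nat.lt_mul_div_succ f hn⟩

theorem div_eq {i f : ℕ} (h1 : i * (n - 1) ≤ f) (h2 : f < (i + 1) * (n - 1)) :
    f / (n - 1) = i := by
  have hn : 0 < n - 1 := Nat.pos_of_ne_zero fun h0 => by simp [h0] at h2
  exact Nat.div_eq_of_lt_le h1 h2

theorem lt_of_tree {i f : ℕ} (hi : i < k) (h2 : f < (i + 1) * (n - 1)) : f < k * (n - 1) :=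
  h2.trans_le (Nat.mul_le_mul_right _ hi)

theorem eid_lt {i x : ℕ} (hi : i < k) (hx : 0 < x) (hxn : x < n) : D.eid i x < k * (n - 1) :=
  lt_of_tree hi (D.eid_spec i hi x hx hxn).2.1

theorem cut_eid {i x z : ℕ} (hi : i < k) (hx : 0 < x) (hxn : x < n) :
    D.cut (D.eid i x) z ↔ Anc (D.par i) x z := by
  obtain ⟨h1, h2, h3⟩ := D.eid_spec i hi x hx hxn
  rw [cut, div_eq h1 h2, h3]

theorem not_cut_zero {f : ℕ} (hf : f < k * (n - 1)) : ¬ D.cut f 0 := by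
  obtain ⟨h1, h2, h3⟩ := tree_of_lt hf
  intro h
  have := (D.rooted _ h1).anc_zero.1 h
  have := (D.ch_spec _ h1 f h2 h3).1
  omega

theorem exists_sep {x y : ℕ} (hx : x < n) (hy : y < n) (hxy : x ≠ y) :
    ∃ f < k * (n - 1), D.Sep f x y := by
  obtain ⟨q, hq0, hq, hs⟩ := (D.rooted 0 D.k_pos).exists_sep hx hy hxy
  refine ⟨_, D.eid_lt D.k_pos hq0 hq, ?_⟩
  rwa [Sep, D.cut_eid D.k_pos hq0 hq, D.cut_eid D.k_pos hq0 hq]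

/-- The path description `Rooted.eqvGen_iff`, translated from vertices to edge numbers; orientations
of stored edges disappear because the generated relation is symmetric. -/
theorem link_tree {i : ℕ} (hi : i < k) (P : ℕ → Prop) {x y : ℕ} (hx : x < n) (hy : y < n) :
    Link (fun f => i * (n - 1) ≤ f ∧ f < (i + 1) * (n - 1) ∧ P f) D.U D.V x y ↔
      ∀ f, i * (n - 1) ≤ f → f < (i + 1) * (n - 1) → D.Sep f x y → P f := by
  have h1 : Link (fun f => i * (n - 1) ≤ f ∧ f < (i + 1) * (n - 1) ∧ P f) D.U D.V x y ↔
      EqvGen (fun a b => ∃ q, 0 < q ∧ q < n ∧ P (D.eid i q) ∧ q = a ∧ D.par i q = b) x y := by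
    constructor
    · intro h
      refine eqvGen_of_le ?_ h
      · rintro a b ⟨f, ⟨hf1, hf2, hP⟩, rfl, rfl⟩
        obtain ⟨hc0, hc, hce⟩ := D.ch_spec i hi f hf1 hf2
        have hr : EqvGen (fun a b => ∃ q, 0 < q ∧ q < n ∧ P (D.eid i q) ∧ q = a ∧
            D.par i q = b) (D.ch f) (D.par i (D.ch f)) :=
          EqvGen.rel _ _ ⟨D.ch f, hc0, hc, by rwa [hce], rfl, rfl⟩
        rcases D.ends i hi _ hc0 hc with ⟨e1, e2⟩ | ⟨e1, e2⟩
        · rw [hce] at e1 e2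
          rw [e1, e2]
          exact hr
        · rw [hce] at e1 e2
          rw [e1, e2]
          exact hr.symm
    · intro h
      refine eqvGen_of_le ?_ h
      · rintro a b ⟨q, hq0, hq, hP, rfl, rfl⟩
        obtain ⟨e1, e2, e3⟩ := D.eid_spec i hi q hq0 hq
        have hr : Link (fun f => i * (n - 1) ≤ f ∧ f < (i + 1) * (n - 1) ∧ P f) D.U D.V
            (D.U (D.eid i q)) (D.V (D.eid i q)) :=
          EqvGen.rel _ _ ⟨D.eid i q, ⟨e1, e2, hP⟩, rfl, rfl⟩
        rcases D.ends i hi q hq0 hq with ⟨e1, e2⟩ | ⟨e1, e2⟩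
        · rw [e1, e2] at hr
          exact hr
        · rw [e1, e2] at hr
          exact hr.symm
  rw [h1, (D.rooted i hi).eqvGen_iff (P := fun q => P (D.eid i q)) hx hy]
  constructor
  · intro h f hf1 hf2 hs
    obtain ⟨hc0, hc, hce⟩ := D.ch_spec i hi f hf1 hf2
    have := h (D.ch f) hc0 hc (by rwa [Sep, cut, cut, div_eq hf1 hf2] at hs)
    rwa [hce] at this
  · intro h q hq0 hq hs
    obtain ⟨e1, e2, e3⟩ := D.eid_spec i hi q hq0 hq
    exact h _ e1 e2 (by rwa [Sep, D.cut_eid hi hq0 hq, D.cut_eid hi hq0 hq])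

/-! ### Flow trees -/

/-- The edges `(u j, v j)`, `j < n`, one of which is a loop, are labelled by numbers `e j` of edges
of the family such that, for the first `m` trees of the family, they have the same components when
all edges before some edge of the family are deleted. -/
structure Flow (m : ℕ) (u v e : ℕ → ℕ) : Prop where
  loop : ∃ j < n, u j = v j
  -- The bound on `e j` is not strict: a loop may carry the dummy label 0, which is no edge number
  -- when n = 1.
  lt : ∀ j < n, u j < n ∧ v j < n ∧ e j ≤ k * (n - 1)
  link : ∀ P, D.UpClosed P → ∀ x < n, ∀ y < n, Link (fun j => j < n ∧ P (e j)) u v x y ↔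
    ∀ f < m * (n - 1), D.Sep f x y → P f

theorem exists_best {x y : ℕ} (hx : x < n) (hy : y < n) (hxy : x ≠ y) :
    ∃ f < k * (n - 1), D.Sep f x y ∧ ∀ g < k * (n - 1), D.Sep g x y → D.key f ≤ D.key g := by
  classical
  obtain ⟨f, hf, hs⟩ := D.exists_sep hx hy hxy
  obtain ⟨g, hg, hmin⟩ := Finset.exists_min_image
    ((Finset.range (k * (n - 1))).filter fun f => D.Sep f x y) D.key ⟨f, by simp [hf, hs]⟩
  simp only [Finset.mem_filter, Finset.mem_range] at hg hmin
  exact ⟨g, hg.1, hg.2, fun h h1 h2 => hmin h ⟨h1, h2⟩⟩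

/-- Let `f` be the first cut separating x and y. The flow tree connects x and y by labels with key
at least that of `f`, but not by strictly larger ones. Some edge on the connection is therefore
labelled exactly `f`. -/
theorem Flow.exists_of_best {D : Family n k} {u v e : ℕ → ℕ} (h : D.Flow k u v e) {f : ℕ}
    (hf : D.Best f) : ∃ j < n, u j ≠ v j ∧ e j = f := by
  obtain ⟨hfk, x, hx, y, hy, hs, hmin⟩ := hf
  by_contra hc
  push Not at hc
  have h1 : Link (fun j => j < n ∧ D.key f ≤ D.key (e j)) u v x y :=
    (h.link (fun g => D.key f ≤ D.key g) (fun _ _ h h' => h.trans h') x hx y hy).2 hmin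
  have h2 : Link (fun j => j < n ∧ D.key f < D.key (e j)) u v x y := by
    clear hx hy hs hmin
    induction h1 with
    | rel a b hab =>
      obtain ⟨j, ⟨hj, hle⟩, rfl, rfl⟩ := hab
      by_cases huv : u j = v j
      · exact huv ▸ EqvGen.refl _
      · exact EqvGen.rel _ _ ⟨j, ⟨hj, lt_of_le_of_ne hle fun heq =>
          hc j hj huv (D.key_injective heq).symm⟩, rfl, rfl⟩
    | refl a => exact EqvGen.refl _
    | symm a b _ ih => exact ih.symm
    | trans a b c _ _ ih1 ih2 => exact ih1.trans _ _ _ ih2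
  exact lt_irrefl _ ((h.link (fun g => D.key f < D.key g) (fun _ _ h h' => h.trans_le h')
    x hx y hy).1 h2 f hfk hs)

/-! ### The laminar family of best cuts -/

open Classical in
/-- The number of vertices on the side of the cut without the root. -/
noncomputable def size (f : ℕ) : ℕ := ((Finset.range n).filter (D.cut f)).card

/-- A number that determines the size of a cut and its edge, ordered by size first. -/
noncomputable def code (f : ℕ) : ℕ := D.size f * (k * n) + f

theorem lt_kn {f : ℕ} (hf : f < k * (n - 1)) : f < k * n :=
  hf.trans_le (Nat.mul_le_mul_left _ (Nat.sub_le _ _))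

theorem code_mod {f : ℕ} (hf : f < k * (n - 1)) : D.code f % (k * n) = f := by
  rw [code, mul_comm, Nat.mul_add_mod, Nat.mod_eq_of_lt (lt_kn hf)]

theorem code_inj {f g : ℕ} (hf : f < k * (n - 1)) (hg : g < k * (n - 1))
    (h : D.code f = D.code g) : f = g := by
  rw [← D.code_mod hf, h, D.code_mod hg]

theorem size_le_of_code_le {f g : ℕ} (hg : g < k * (n - 1))
    (h : D.code f ≤ D.code g) : D.size f ≤ D.size g := by
  by_contra hc
  have h1 : (D.size g + 1) * (k * n) ≤ D.size f * (k * n) := Nat.mul_le_mul_right _ (by omega)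
  have := lt_kn hg
  rw [add_mul, one_mul] at h1
  simp only [code] at h
  omega

theorem size_lt {f : ℕ} (hf : f < k * (n - 1)) : D.size f < n := by
  classical
  calc D.size f < (Finset.range n).card := Finset.card_lt_card (by
        rw [Finset.ssubset_iff_of_subset (Finset.filter_subset _ _)]
        exact ⟨0, by simpa using D.n_pos, by simp [D.not_cut_zero hf]⟩)
    _ = n := Finset.card_range n

theorem code_lt {f : ℕ} (hf : f < k * (n - 1)) : D.code f < n * (k * n) := by
  have h1 : (D.size f + 1) * (k * n) ≤ n * (k * n) := Nat.mul_le_mul_right _ (D.size_lt hf)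
  have := lt_kn hf
  rw [add_mul, one_mul] at h1
  simp only [code]
  omega

/-- Of two best cuts that contain a common vertex, the one with the smaller code is contained in
the other one. -/
theorem Laminar.subset {D : Family n k} (hD : D.Laminar) {f g v : ℕ} (hf : D.Best f)
    (hg : D.Best g) (hv : v < n) (hfv : D.cut f v) (hgv : D.cut g v)
    (hle : D.code f ≤ D.code g) : ∀ z < n, D.cut f z → D.cut g z := by
  classical
  rcases hD f g hf hg with h | h | h
  · exact h
  · have hsub : (Finset.range n).filter (D.cut g) ⊆ (Finset.range n).filter (D.cut f) := by
      intro z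
      simp only [Finset.mem_filter, Finset.mem_range]
      exact fun hz => ⟨hz.1, h z hz.1 hz.2⟩
    -- Codes compare sizes first, so the set that should be larger is contained in one of no greater
    -- size: the two coincide.
    have heq := Finset.eq_of_subset_of_card_le hsub (D.size_le_of_code_le hg.1 hle)
    intro z hz hfz
    have : z ∈ (Finset.range n).filter (D.cut g) := by simp [heq, hz, hfz]
    simpa [hz] using this
  · exact absurd ⟨hfv, hgv⟩ (h v hv)

/-- `a` and `b` are the two smallest elements of `S`, where missing elements are replaced by the
strict upper bound `t`. -/
structure LeastTwo (S : ℕ → Prop) (t a b : ℕ) : Prop where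
  lt : ∀ z, S z → z < t
  le : a ≤ b
  le_top : b ≤ t
  fst : a < t → S a
  snd : b < t → S b ∧ a < b
  least : ∀ z, S z → z = a ∨ b ≤ z

/-- The codes of the best cuts that contain `v`. -/
def Codes (v c : ℕ) : Prop := ∃ f, D.Best f ∧ D.cut f v ∧ c = D.code f

section merged

variable {D} (hD : D.Laminar) {c1 c2 : ℕ → ℕ}
  (hc : ∀ v < n, LeastTwo (D.Codes v) (n * (k * n)) (c1 v) (c2 v))

/-- The edge whose cut is the smallest best cut around `v`. -/
def owner (_ : Family n k) (c1 : ℕ → ℕ) (v : ℕ) : ℕ := c1 v % (k * n)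

include hc

/-- The first cut separating `v` from the root 0 is best and has `v` on its side, so the least code
at `v` is never the dummy value. -/
theorem owner_spec {v : ℕ} (hv0 : 0 < v) (hv : v < n) :
    D.Best (D.owner c1 v) ∧ D.cut (D.owner c1 v) v ∧ c1 v = D.code (D.owner c1 v) := by
  obtain ⟨f, hf, hs, hmin⟩ := D.exists_best hv D.n_pos hv0.ne'
  have hcut : D.cut f v := by
    by_contra hcv
    exact hs ⟨fun h => absurd h hcv, fun h => absurd h (D.not_cut_zero hf)⟩
  have hmem : D.Codes v (D.code f) := ⟨f, ⟨hf, v, hv, 0, D.n_pos, hs, hmin⟩, hcut, rfl⟩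
  have hlt := (hc v hv).lt _ hmem
  have hlt1 : c1 v < n * (k * n) := by
    rcases (hc v hv).least _ hmem with h | h
    · omega
    · exact ((hc v hv).le.trans h).trans_lt hlt
  obtain ⟨g, hg, hgv, hge⟩ := (hc v hv).fst hlt1
  have : D.owner c1 v = g := by rw [owner, hge, D.code_mod hg.1]
  rw [this]
  exact ⟨hg, hgv, hge⟩

include hD

theorem owner_subset {v g : ℕ} (hv0 : 0 < v) (hv : v < n) (hg : D.Best g) (hgv : D.cut g v) :
    ∀ z < n, D.cut (D.owner c1 v) z → D.cut g z := by
  obtain ⟨h1, h2, h3⟩ := owner_spec hc hv0 hv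
  refine hD.subset h1 hg hv h2 hgv ?_
  rw [← h3]
  rcases (hc v hv).least _ ⟨g, hg, hgv, rfl⟩ with h | h
  · exact h.ge
  · exact (hc v hv).le.trans h

omit hc hD in
-- Best cuts separate points, because the first cut separating a pair is best by definition.
theorem eq_of_best_iff {u v : ℕ} (hu : u < n) (hv : v < n)
    (h : ∀ g, D.Best g → (D.cut g u ↔ D.cut g v)) : u = v := by
  by_contra huv
  obtain ⟨f, hf, hs, hmin⟩ := D.exists_best hu hv huv
  exact hs (h f ⟨hf, u, hu, v, hv, hs, hmin⟩)

theorem eq_of_owner_subset {u v : ℕ} (hu0 : 0 < u) (hu : u < n) (hv0 : 0 < v) (hv : v < n)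
    (h1 : D.cut (D.owner c1 u) v) (h2 : D.cut (D.owner c1 v) u) : u = v :=
  eq_of_best_iff hu hv fun _ hg =>
    ⟨fun h => owner_subset hD hc hu0 hu hg h v hv h1,
      fun h => owner_subset hD hc hv0 hv hg h u hu h2⟩

/-- Two vertices with the same owner lie in the same best cuts: the owner is contained in every best
cut around either vertex. This injectivity supplies the lower bound n - 1 on the number of best
cuts. -/
theorem owner_inj {u v : ℕ} (hu0 : 0 < u) (hu : u < n) (hv0 : 0 < v) (hv : v < n)
    (h : D.owner c1 u = D.owner c1 v) : u = v :=
  eq_of_owner_subset hD hc hu0 hu hv0 hv (h ▸ (owner_spec hc hv0 hv).2.1)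
    (h ▸ (owner_spec hc hu0 hu).2.1)

omit hc in
/-- The labels of a flow tree are the best cuts; every best cut is the smallest one around some
vertex. -/
theorem Flow.best_iff {u v e : ℕ → ℕ} (hF : D.Flow k u v e) {c1 c2 : ℕ → ℕ}
    (hc : ∀ v < n, LeastTwo (D.Codes v) (n * (k * n)) (c1 v) (c2 v)) :
    (∀ f, D.Best f ↔ ∃ j < n, u j ≠ v j ∧ e j = f) ∧
      ∀ f, D.Best f → ∃ w, 0 < w ∧ w < n ∧ D.owner c1 w = f := by
  classical
  set S := ((Finset.range n).filter fun j => u j ≠ v j).image e with hS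
  set Bs := (Finset.range (k * (n - 1))).filter D.Best with hBs
  set O := (Finset.Ico 1 n).image (D.owner c1) with hO
  have hSc : S.card ≤ n - 1 := by
    obtain ⟨j, hj, hl⟩ := hF.loop
    refine Finset.card_image_le.trans ?_
    have : (Finset.range n).filter (fun j => u j ≠ v j) ⊆ (Finset.range n).erase j := by
      intro i hi
      simp only [Finset.mem_filter, Finset.mem_range] at hi
      simp only [Finset.mem_erase, Finset.mem_range]
      exact ⟨fun h => hi.2 (h ▸ hl), hi.1⟩
    have := Finset.card_le_card this
    rwa [Finset.card_erase_of_mem (by simpa using hj), Finset.card_range] at this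
  have hOc : O.card = n - 1 := by
    rw [hO, Finset.card_image_of_injOn, Nat.card_Ico]
    intro a ha b hb
    simp only [Finset.coe_Ico, Set.mem_Ico] at ha hb
    exact owner_inj hD hc (by omega) ha.2 (by omega) hb.2
  have hOB : O ⊆ Bs := by
    intro f hf
    simp only [hO, Finset.mem_image, Finset.mem_Ico] at hf
    obtain ⟨w, hw, rfl⟩ := hf
    have := (owner_spec hc (by omega) hw.2).1
    simp only [hBs, Finset.mem_filter, Finset.mem_range]
    exact ⟨this.1, this⟩
  have hBS : Bs ⊆ S := by
    intro f hf
    simp only [hBs, Finset.mem_filter, Finset.mem_range] at hf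
    obtain ⟨j, hj, hne, he⟩ := hF.exists_of_best hf.2
    simp only [hS, Finset.mem_image, Finset.mem_filter, Finset.mem_range]
    exact ⟨j, ⟨hj, hne⟩, he⟩
  -- The chain n - 1 = |O| ≤ |Bs| ≤ |S| ≤ n - 1 forces owners, best cuts and labels to coincide.
  have h1 : O = Bs := Finset.eq_of_subset_of_card_le hOB
    ((Finset.card_le_card hBS).trans (by omega))
  have h2 : Bs = S := Finset.eq_of_subset_of_card_le hBS (h1 ▸ by omega)
  constructor
  · intro f
    have h3 : f ∈ Bs ↔ f ∈ S := by rw [h2]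
    simp only [hBs, hS, Finset.mem_image, Finset.mem_filter, Finset.mem_range] at h3
    constructor
    · intro hf
      obtain ⟨j, ⟨hj, hne⟩, he⟩ := h3.1 ⟨hf.1, hf⟩
      exact ⟨j, hj, hne, he⟩
    · rintro ⟨j, hj, hne, he⟩
      exact (h3.2 ⟨j, ⟨hj, hne⟩, he⟩).2
  · intro f hf
    have : f ∈ O := by
      rw [h1]
      simp only [hBs, Finset.mem_filter, Finset.mem_range]
      exact ⟨hf.1, hf⟩
    simp only [hO, Finset.mem_image, Finset.mem_Ico] at this
    obtain ⟨w, hw, he⟩ := this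
    exact ⟨w, by omega, hw.2, he⟩

variable (hsurj : ∀ f, D.Best f → ∃ w, 0 < w ∧ w < n ∧ D.owner c1 w = f)
  {vo : ℕ → ℕ} (hvo : ∀ v < n, vo (c1 v) = v)

omit hD in
-- No cut has the root on its side, so both codes of the root are the dummy value. Consequently a
-- missing second code at another vertex is decoded by `vo` as the root, which is the parent wanted.
theorem codes_zero : c1 0 = n * (k * n) ∧ c2 0 = n * (k * n) := by
  have h := hc 0 D.n_pos
  have h1 : ¬ c1 0 < n * (k * n) := fun hlt => by
    obtain ⟨f, hf, hf0, -⟩ := h.fst hlt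
    exact D.not_cut_zero hf.1 hf0
  have := h.le
  have := h.le_top
  omega

include hsurj hvo

/-- The best cuts around the vertex `vo (c2 v)` are those around `v`, except for the smallest. -/
theorem cut_parent {v : ℕ} (hv0 : 0 < v) (hv : v < n) :
    vo (c2 v) < n ∧ ∀ g, D.Best g → (D.cut g (vo (c2 v)) ↔ D.cut g v ∧ g ≠ D.owner c1 v) := by
  obtain ⟨ho, hov, hoc⟩ := owner_spec hc hv0 hv
  by_cases hlt : c2 v < n * (k * n)
  · obtain ⟨⟨f, hf, hfv, hfc⟩, hlt'⟩ := (hc v hv).snd hlt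
    obtain ⟨u, hu0, hu, hou⟩ := hsurj f hf
    have huv : vo (c2 v) = u := by
      rw [hfc, ← hou, ← (owner_spec hc hu0 hu).2.2, hvo u hu]
    have hfu : D.cut f u := hou ▸ (owner_spec hc hu0 hu).2.1
    rw [huv]
    refine ⟨hu, fun g hg => ⟨fun hgu => ⟨?_, ?_⟩, fun ⟨hgv, hgo⟩ => ?_⟩⟩
    · exact owner_subset hD hc hu0 hu hg hgu v hv (hou.symm ▸ hfv)
    · rintro rfl
      have := eq_of_owner_subset hD hc hu0 hu hv0 hv (hou.symm ▸ hfv) hgu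
      subst this
      rw [hou] at hoc
      omega
    · rcases (hc v hv).least _ ⟨g, hg, hgv, rfl⟩ with h | h
      · rw [hoc] at h
        exact absurd (D.code_inj hg.1 ho.1 h) hgo
      · exact hD.subset hf hg hv hfv hgv (hfc ▸ h) u hu hfu
  -- Without a second best cut around `v`, the lookup returns the root, which lies in no best cut at
  -- all.
  · have h2 : c2 v = c1 0 := by
      rw [(codes_zero hc).1]
      have := (hc v hv).le_top
      omega
    rw [h2, hvo 0 D.n_pos]
    refine ⟨D.n_pos, fun g hg => ⟨fun h => absurd h (D.not_cut_zero hg.1), fun ⟨hgv, hgo⟩ => ?_⟩⟩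
    have hgc : D.Codes v (D.code g) := ⟨g, hg, hgv, rfl⟩
    have := (hc v hv).lt _ hgc
    rcases (hc v hv).least _ hgc with h | h
    · rw [hoc] at h
      exact absurd (D.code_inj hg.1 ho.1 h) hgo
    · omega

/-- The vertices `vo (c2 v)` are the parents in a tree whose cuts are the best cuts. -/
theorem exists_rooted_merged :
    ∃ dep, Rooted n (fun v => vo (c2 v)) dep ∧
      ∀ v z, 0 < v → v < n → z < n →
        (Anc (fun v => vo (c2 v)) v z ↔ D.cut (D.owner c1 v) z) := by
  classical
  -- The number of best cuts around a vertex serves as its depth: passing to the parent removes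
  -- exactly the owner.
  let C : ℕ → Finset ℕ := fun v => (Finset.range (k * (n - 1))).filter
    fun f => D.Best f ∧ D.cut f v
  have hC : ∀ v f, f ∈ C v ↔ D.Best f ∧ D.cut f v := by
    intro v f
    simp only [C, Finset.mem_filter, Finset.mem_range]
    exact ⟨fun h => h.2, fun h => ⟨h.1.1, h⟩⟩
  have h00 : vo (c2 0) = 0 := by
    rw [(codes_zero hc).2, ← (codes_zero hc).1, hvo 0 D.n_pos]
  have hroot : Rooted n (fun v => vo (c2 v)) (fun v => (C v).card) := by
    refine ⟨fun v hv => ?_, fun v hv hv0 => ?_, h00, ?_⟩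
    · rcases Nat.eq_zero_or_pos v with rfl | hv0
      · rw [h00]
        exact D.n_pos
      · exact (cut_parent hD hc hsurj hvo hv0 hv).1
    · refine Finset.card_lt_card ?_
      have h1 := (cut_parent hD hc hsurj hvo (Nat.pos_of_ne_zero hv0) hv).2
      have h2 := owner_spec hc (Nat.pos_of_ne_zero hv0) hv
      rw [Finset.ssubset_iff_of_subset]
      · refine ⟨D.owner c1 v, (hC _ _).2 ⟨h2.1, h2.2.1⟩, fun h => ?_⟩
        exact ((h1 _ h2.1).1 ((hC _ _).1 h).2).2 rfl
      · intro f hf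
        rw [hC] at hf ⊢
        exact ⟨hf.1, ((h1 f hf.1).1 hf.2).1⟩
    · rw [Finset.card_eq_zero, Finset.eq_empty_iff_forall_notMem]
      intro f hf
      rw [hC] at hf
      exact D.not_cut_zero hf.1.1 hf.2
  refine ⟨_, hroot, ?_⟩
  intro v z hv0 hv hz
  have ho := owner_spec hc hv0 hv
  induction hd : (C z).card using Nat.strong_induction_on generalizing z with
  | _ d ih =>
    rcases Nat.eq_zero_or_pos z with rfl | hz0
    · rw [hroot.anc_zero]
      exact ⟨fun h => by omega, fun h => absurd h (D.not_cut_zero ho.1.1)⟩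
    · by_cases hzv : z = v
      · subst hzv
        exact ⟨fun _ => ho.2.1, fun _ => Anc.refl _ _⟩
      · have hstep := ih _ (hd ▸ hroot.dep_par z hz hz0.ne') _ (hroot.par_lt z hz) rfl
        refine ((anc_par_iff hzv).symm.trans hstep).trans
          (((cut_parent hD hc hsurj hvo hz0 hz).2 _ ho.1).trans ?_)
        refine ⟨fun h => h.1, fun h => ⟨h, fun he => hzv ?_⟩⟩
        exact owner_inj hD hc hz0 hz hv0 hv he.symm

end merged

/-! ### Families of cut trees -/

/-- The family consists of the given cut trees. -/
structure Describes (T : Fin k → CutTree (Fin n)) : Prop where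
  parent : ∀ i : Fin k, IsParent (T i).graph (D.par i)
  weight : ∀ (i : Fin k) (x : Fin n), (x : ℕ) ≠ 0 →
    (T i).weight ((D.rooted i i.2).edge x) = D.W (D.eid i x)

namespace Describes

variable {D} {T : Fin k → CutTree (Fin n)} (h : D.Describes T)
include h

theorem isCut_iff {i : Fin k} {a b : Fin n} {X : Set (Fin n)} {c : ℝ} :
    (T i).IsCut a b X c ↔ ∃ f, (i : ℕ) * (n - 1) ≤ f ∧ f < (i + 1) * (n - 1) ∧ D.Sep f a b ∧
      X = {z : Fin n | D.cut f z ↔ D.cut f a} ∧ D.W f = c := by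
  rw [(D.rooted i i.2).isCut_iff (h.parent i)]
  constructor
  · rintro ⟨q, hq, hs, hX, hc⟩
    have hq0 := Nat.pos_of_ne_zero hq
    obtain ⟨e1, e2, e3⟩ := D.eid_spec i i.2 q hq0 q.2
    refine ⟨D.eid i q, e1, e2, ?_, ?_, ?_⟩
    · rwa [Sep, D.cut_eid i.2 hq0 q.2, D.cut_eid i.2 hq0 q.2]
    · rw [hX]
      ext z
      simp only [Set.mem_ofPred_eq, D.cut_eid i.2 hq0 q.2]
    · rw [← hc, h.weight i q hq]
  · rintro ⟨f, h1, h2, hs, hX, hc⟩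
    obtain ⟨hc0, hcn, hce⟩ := D.ch_spec i i.2 f h1 h2
    refine ⟨⟨D.ch f, hcn⟩, hc0.ne', ?_, ?_, ?_⟩
    · rwa [Sep, cut, cut, div_eq h1 h2] at hs
    · rw [hX]
      ext z
      simp only [Set.mem_ofPred_eq, cut, div_eq h1 h2]
    · rw [h.weight i ⟨D.ch f, hcn⟩ hc0.ne', ← hc, hce]

/-- Each tree with a separating edge has a lightest one, so comparing minimum cuts tree by tree
amounts to comparing all separating edges of all trees at once. -/
theorem isBestCut_iff {a b : Fin n} {X : Set (Fin n)} {c : ℝ} :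
    IsBestCut T a b X c ↔ ∃ f < k * (n - 1), D.Sep f a b ∧
      X = {z : Fin n | D.cut f z ↔ D.cut f a} ∧ D.W f = c ∧
      ∀ g < k * (n - 1), D.Sep g a b → c ≤ D.W g := by
  constructor
  · rintro ⟨⟨i, hX, hmin⟩, hbest⟩
    obtain ⟨f, h1, h2, hs, hX, hc⟩ := h.isCut_iff.1 hX
    refine ⟨f, lt_of_tree i.2 h2, hs, hX, hc, fun g hg hgs => ?_⟩
    classical
    obtain ⟨j1, j2, j3⟩ := tree_of_lt hg
    obtain ⟨g', hg', hmin'⟩ := Finset.exists_min_image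
      ((Finset.Ico (g / (n - 1) * (n - 1)) ((g / (n - 1) + 1) * (n - 1))).filter
        fun f => D.Sep f a b) D.W ⟨g, by simp only [Finset.mem_filter, Finset.mem_Ico]; exact
          ⟨⟨j2, j3⟩, hgs⟩⟩
    simp only [Finset.mem_filter, Finset.mem_Ico] at hg' hmin'
    refine (hbest ⟨g / (n - 1), j1⟩ _ (D.W g') ⟨h.isCut_iff.2 ⟨g', hg'.1.1, hg'.1.2, hg'.2, rfl,
      rfl⟩, fun X' c' hX' => ?_⟩).trans (hmin' g ⟨⟨j2, j3⟩, hgs⟩)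
    obtain ⟨f', h1, h2, hs, -, rfl⟩ := h.isCut_iff.1 hX'
    exact hmin' f' ⟨⟨h1, h2⟩, hs⟩
  · rintro ⟨f, hf, hs, hX, hc, hmin⟩
    obtain ⟨h1, h2, h3⟩ := tree_of_lt hf
    have hall : ∀ j X' c', (T j).IsCut a b X' c' → c ≤ c' := by
      intro j X' c' hX'
      obtain ⟨f', h1, h2, hs, -, rfl⟩ := h.isCut_iff.1 hX'
      exact hmin f' (lt_of_tree j.2 h2) hs
    exact ⟨⟨⟨_, h1⟩, h.isCut_iff.2 ⟨f, h2, h3, hs, hX, hc⟩, hall _⟩,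
      fun j X' c' hX' => hall j X' c' hX'.1⟩

/-- If laminarity fails for `f` and `g`, there is a vertex in each difference and one in the
intersection. The root lies outside both, so all four quadrants are occupied. -/
theorem laminar (hT : NonCrossing T) : D.Laminar := by
  rintro f g ⟨hf, x, hx, y, hy, hs, hmin⟩ ⟨hg, x', hx', y', hy', hs', hmin'⟩
  have h1 : IsBestCut T ⟨x, hx⟩ ⟨y, hy⟩ _ (D.W f) := h.isBestCut_iff.2
    ⟨f, hf, hs, rfl, rfl, fun g hg hgs => D.weight_le (hmin g hg hgs)⟩
  have h2 : IsBestCut T ⟨x', hx'⟩ ⟨y', hy'⟩ _ (D.W g) := h.isBestCut_iff.2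
    ⟨g, hg, hs', rfl, rfl, fun g hg hgs => D.weight_le (hmin' g hg hgs)⟩
  have hnc := hT _ _ _ _ _ _ _ _ h1 h2
  by_contra hcon
  push Not at hcon
  obtain ⟨⟨z1, hz1, hf1, hg1⟩, ⟨z2, hz2, hg2, hf2⟩, ⟨z3, hz3, hf3, hg3⟩⟩ := hcon
  have hf0 := D.not_cut_zero hf
  have hg0 := D.not_cut_zero hg
  apply hnc
  -- The bipartitions are given by the sides of `x` and `x'`, which may be the complements of the
  -- cuts. Each case permutes the four witnesses accordingly.
  by_cases hfx : D.cut f x <;> by_cases hgx : D.cut g x'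
  · exact ⟨⟨⟨z3, hz3⟩, by simp [*], by simp [*]⟩, ⟨⟨z1, hz1⟩, by simp [*], by simp [*]⟩,
      ⟨⟨z2, hz2⟩, by simp [*], by simp [*]⟩, ⟨⟨0, D.n_pos⟩, by simp [*], by simp [*]⟩⟩
  · exact ⟨⟨⟨z1, hz1⟩, by simp [*], by simp [*]⟩, ⟨⟨z3, hz3⟩, by simp [*], by simp [*]⟩,
      ⟨⟨0, D.n_pos⟩, by simp [*], by simp [*]⟩, ⟨⟨z2, hz2⟩, by simp [*], by simp [*]⟩⟩
  · exact ⟨⟨⟨z2, hz2⟩, by simp [*], by simp [*]⟩, ⟨⟨0, D.n_pos⟩, by simp [*], by simp [*]⟩,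
      ⟨⟨z3, hz3⟩, by simp [*], by simp [*]⟩, ⟨⟨z1, hz1⟩, by simp [*], by simp [*]⟩⟩
  · exact ⟨⟨⟨0, D.n_pos⟩, by simp [*], by simp [*]⟩, ⟨⟨z2, hz2⟩, by simp [*], by simp [*]⟩,
      ⟨⟨z1, hz1⟩, by simp [*], by simp [*]⟩, ⟨⟨z3, hz3⟩, by simp [*], by simp [*]⟩⟩

/-- A rooted tree whose cuts are the best cuts of the family merges the family. -/
theorem isMerge {par dep own : ℕ → ℕ} (hr : Rooted n par dep)
    (hown : ∀ v, 0 < v → v < n → D.Best (own v)) 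
    (hsurj : ∀ f, D.Best f → ∃ v, 0 < v ∧ v < n ∧ own v = f)
    (hcut : ∀ v z, 0 < v → v < n → z < n → (Anc par v z ↔ D.cut (own v) z))
    {T₀ : CutTree (Fin n)} (hT₀ : IsParent T₀.graph par)
    (hw : ∀ x : Fin n, (x : ℕ) ≠ 0 → T₀.weight (hr.edge x) = D.W (own x)) :
    IsMerge T T₀ := by
  have hiff : ∀ {a b : Fin n} {X : Set (Fin n)} {c : ℝ}, T₀.IsCut a b X c ↔
      ∃ f, D.Best f ∧ D.Sep f a b ∧ X = {z : Fin n | D.cut f z ↔ D.cut f a} ∧ D.W f = c := by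
    intro a b X c
    rw [hr.isCut_iff hT₀]
    constructor
    · rintro ⟨q, hq, hs, hX, hc⟩
      have hq0 := Nat.pos_of_ne_zero hq
      refine ⟨own q, hown q hq0 q.2, ?_, ?_, ?_⟩
      · rwa [Sep, ← hcut q a hq0 q.2 a.2, ← hcut q b hq0 q.2 b.2]
      · rw [hX]
        ext z
        simp only [Set.mem_ofPred_eq, hcut q _ hq0 q.2 (Fin.is_lt _)]
      · rw [← hc, hw q hq]
    · rintro ⟨f, hf, hs, hX, hc⟩
      obtain ⟨q, hq0, hq, rfl⟩ := hsurj f hf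
      refine ⟨⟨q, hq⟩, hq0.ne', ?_, ?_, ?_⟩
      · rwa [hcut q a hq0 hq a.2, hcut q b hq0 hq b.2]
      · rw [hX]
        ext z
        simp only [Set.mem_ofPred_eq, hcut q _ hq0 hq (Fin.is_lt _)]
      · rw [hw ⟨q, hq⟩ hq0.ne', hc]
  intro x y hxy
  obtain ⟨f, hf, hs, hmin⟩ := D.exists_best x.2 y.2 (fun he => hxy (Fin.ext he))
  have hfb : D.Best f := ⟨hf, x, x.2, y, y.2, hs, hmin⟩
  have hle : ∀ g < k * (n - 1), D.Sep g x y → D.W f ≤ D.W g := fun g hg hgs =>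
    D.weight_le (hmin g hg hgs)
  have hmain : ∀ X c, T₀.IsMinCut x y X c → IsBestCut T x y X c := by
    rintro X c ⟨hX, hXmin⟩
    obtain ⟨g, hg, hgs, hX, hc⟩ := hiff.1 hX
    refine h.isBestCut_iff.2 ⟨g, hg.1, hgs, hX, hc, fun g' hg' hgs' => ?_⟩
    exact (hXmin _ (D.W f) (hiff.2 ⟨f, hfb, hs, rfl, rfl⟩)).trans (hle g' hg' hgs')
  refine ⟨fun c => ⟨fun ⟨X, hX⟩ => ⟨X, hmain X c hX⟩, fun ⟨X, hX⟩ => ?_⟩, hmain⟩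
  obtain ⟨g, hg, hgs, -, hc, hgmin⟩ := h.isBestCut_iff.1 hX
  have hcf : D.W f = c := le_antisymm (hc ▸ hle g hg hgs) (hgmin f hf hs)
  refine ⟨_, hiff.2 ⟨f, hfb, hs, rfl, hcf⟩, fun X' c' hX' => ?_⟩
  obtain ⟨g', hg', hgs', -, rfl⟩ := hiff.1 hX'
  exact hgmin g' hg'.1 hgs'

end Describes

end Family

end CutMerge

/-! ### Bottom-up merge sort of the edge table. -/

namespace CutMerge

set_option linter.constructorNameAsVariable false

/-! ### Sorting -/

/-- Let `g` be `1` if the next element comes from the first of the two blocks to be merged. -/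
def pickProg : Stmt :=
  .ite (.lt Var.l Var.md)
    (.ite (.lt Var.r Var.en)
      (.ite (.wlt (.get .ei (.get .p Var.l)) (.get .ei (.get .p Var.r)))
        (.g ::= 0)
        (.ite (.wlt (.get .ei (.get .p Var.r)) (.get .ei (.get .p Var.l)))
          (.g ::= 1)
          -- Equal weights are ordered by edge number, in agreement with `Family.key`.
          (.ite (.lt (.get .ei (.get .p Var.l)) (.get .ei (.get .p Var.r)))
            (.g ::= 0)
            (.g ::= 1))))
      (.g ::= 1))
    (.g ::= 0)

def mergeStepProg : Stmt :=
  pickProg ;;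
  .ite (.eq Var.g 1)
    (.put .q Var.o (.get .p Var.l) ;; .l ::= Var.l + 1)
    (.put .q Var.o (.get .p Var.r) ;; .r ::= Var.r + 1) ;;
  .o ::= Var.o + 1

/-- Merge the sorted blocks `b, …, b + h - 1` and `b + h, …, b + 2 * h - 1` of `p` into `q`. -/
def mergeBlockProg : Stmt :=
  -- With truncated subtraction, a - (a - M) is the minimum of a and M; the last block may be short
  -- or empty.
  .md ::= (Var.b + Var.h) - ((Var.b + Var.h) - Var.M) ;;
  .en ::= (Var.md + Var.h) - ((Var.md + Var.h) - Var.M) ;;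
  .l ::= Var.b ;;
  .r ::= Var.md ;;
  .o ::= Var.b ;;
  .loop (.lt Var.o Var.en) mergeStepProg ;;
  .b ::= Var.en

def sortPassProg : Stmt :=
  .b ::= 0 ;;
  .loop (.lt Var.b Var.M) mergeBlockProg ;;
  .upTo .s Var.M (.put .p Var.s (.get .q Var.s)) ;;
  .h ::= Var.h + Var.h

/-- Sort the numbers of the first `M` table entries by decreasing label. -/
def sortProg : Stmt :=
  .upTo .s Var.M (.put .p Var.s Var.s) ;;
  .h ::= 1 ;;
  .loop (.lt Var.h Var.M) sortPassProg

section merge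

variable {κ : Type*} [LinearOrder κ]

/-- The state of merging `p` on `[b, md)` and `[md, en)` into `q`, after the elements on `[b, l)`
and `[md, r)` have been moved. -/
structure MergeInv (K : ℕ → κ) (p q : ℕ → ℕ) (b md en l r o : ℕ) : Prop where
  bl : b ≤ l
  lmd : l ≤ md
  mdr : md ≤ r
  ren : r ≤ en
  sum : o + md = l + r
  mem : ∀ v, (∃ j, b ≤ j ∧ j < o ∧ q j = v) ↔
    (∃ j, b ≤ j ∧ j < l ∧ p j = v) ∨ (∃ j, md ≤ j ∧ j < r ∧ p j = v)
  sorted : ∀ i j, b ≤ i → i < j → j < o → K (q j) ≤ K (q i)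
  le : ∀ i j, b ≤ i → i < o → (l ≤ j ∧ j < md) ∨ (r ≤ j ∧ j < en) → K (p j) ≤ K (q i)

theorem exists_update_iff {q : ℕ → ℕ} {b o c v : ℕ} (hbo : b ≤ o) :
    (∃ j, b ≤ j ∧ j < o + 1 ∧ Function.update q o c j = v) ↔
      (∃ j, b ≤ j ∧ j < o ∧ q j = v) ∨ c = v := by
  constructor
  · rintro ⟨j, h1, h2, h3⟩
    by_cases hj : j = o
    · subst hj
      right
      simpa using h3
    · left
      rw [Function.update_of_ne hj] at h3
      exact ⟨j, h1, by omega, h3⟩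
  · rintro (⟨j, h1, h2, h3⟩ | rfl)
    · exact ⟨j, h1, by omega, by rwa [Function.update_of_ne (by omega)]⟩
    · exact ⟨o, hbo, by omega, by simp⟩

theorem exists_lt_succ_iff {p : ℕ → ℕ} {b l v : ℕ} (hbl : b ≤ l) :
    (∃ j, b ≤ j ∧ j < l + 1 ∧ p j = v) ↔ (∃ j, b ≤ j ∧ j < l ∧ p j = v) ∨ p l = v := by
  have := exists_update_iff (q := p) (c := p l) (v := v) hbl
  rwa [Function.update_eq_self] at this

variable {K : ℕ → κ} {p q : ℕ → ℕ} {b md en l r o : ℕ}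

theorem MergeInv.append (h : MergeInv K p q b md en l r o) {c : ℕ}
    (hc : ∀ i, b ≤ i → i < o → K c ≤ K (q i)) :
    ∀ i j, b ≤ i → i < j → j < o + 1 →
      K (Function.update q o c j) ≤ K (Function.update q o c i) := by
  intro i j hi hij hj
  rw [Function.update_of_ne (show i ≠ o by omega)]
  by_cases hjo : j = o
  · subst hjo
    simpa using hc i hi hij
  · rw [Function.update_of_ne hjo]
    exact h.sorted i j hi hij (by omega)

/-- Since every output dominates everything still waiting, appending the larger of the two heads
keeps the output decreasing. Comparing heads suffices because each remaining block is decreasing. -/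
theorem MergeInv.left (h : MergeInv K p q b md en l r o) (hl : l < md)
    (hp : ∀ i j, b ≤ i → i < j → j < md → K (p j) ≤ K (p i))
    (hp' : ∀ i j, md ≤ i → i < j → j < en → K (p j) ≤ K (p i))
    (hle : r < en → K (p r) ≤ K (p l)) :
    MergeInv K p (Function.update q o (p l)) b md en (l + 1) r (o + 1) := by
  have hbl := h.bl
  have hmdr := h.mdr
  have hsum := h.sum
  refine ⟨by omega, hl, h.mdr, h.ren, by omega, fun v => ?_,
    h.append fun i hi hio => h.le i l hi hio (Or.inl ⟨le_rfl, hl⟩), ?_⟩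
  · rw [exists_update_iff (by omega), exists_lt_succ_iff h.bl, h.mem v, or_right_comm]
  · intro i j hi hio hj
    by_cases hi' : i = o
    · subst hi'
      rw [Function.update_self]
      rcases hj with hj | hj
      · exact hp l j h.bl (by omega) hj.2
      · rcases eq_or_lt_of_le hj.1 with rfl | hlt
        · exact hle hj.2
        · exact (hp' r j h.mdr hlt hj.2).trans (hle (by omega))
    · rw [Function.update_of_ne hi']
      exact h.le i j hi (by omega) (by omega)

theorem MergeInv.right (h : MergeInv K p q b md en l r o) (hr : r < en)
    (hp : ∀ i j, b ≤ i → i < j → j < md → K (p j) ≤ K (p i))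
    (hp' : ∀ i j, md ≤ i → i < j → j < en → K (p j) ≤ K (p i))
    (hle : l < md → K (p l) ≤ K (p r)) :
    MergeInv K p (Function.update q o (p r)) b md en l (r + 1) (o + 1) := by
  have hbl := h.bl
  have hmdr := h.mdr
  have hsum := h.sum
  refine ⟨h.bl, h.lmd, by omega, hr, by omega, fun v => ?_,
    h.append fun i hi hio => h.le i r hi hio (Or.inr ⟨le_rfl, hr⟩), ?_⟩
  · rw [exists_update_iff (by omega), exists_lt_succ_iff h.mdr, h.mem v, or_assoc]
  · intro i j hi hio hj
    by_cases hi' : i = o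
    · subst hi'
      rw [Function.update_self]
      rcases hj with hj | hj
      · rcases eq_or_lt_of_le hj.1 with rfl | hlt
        · exact hle hj.2
        · exact (hp l j h.bl hlt hj.2).trans (hle (by omega))
      · exact hp' r j h.mdr (by omega) hj.2
    · rw [Function.update_of_ne hi']
      exact h.le i j hi (by omega) (by omega)

/-- The effect of a completed merge on the part of `q` written so far. -/
theorem MergeInv.block {q₀ : ℕ → ℕ} {H c : ℕ} (hI : MergeInv K p q b md en md en en)
    (hqq : ∀ j < b, q j = q₀ j) (hmem : ∀ v, (∃ j < b, q₀ j = v) ↔ ∃ j < b, p j = v)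
    (hq : ∀ i j, i < j → j < b → i / H = j / H → K (q₀ j) ≤ K (q₀ i))
    (hb : b = H * c) (hdiv : ∀ i, b ≤ i → i < en → i / H = c) :
    (∀ v, (∃ j < en, q j = v) ↔ ∃ j < en, p j = v) ∧
      ∀ i j, i < j → j < en → i / H = j / H → K (q j) ≤ K (q i) := by
  have h1 := hI.bl
  have h2 := hI.mdr
  have hsplit : ∀ (g : ℕ → ℕ) v, (∃ j < en, g j = v) ↔
      (∃ j < b, g j = v) ∨ ∃ j, b ≤ j ∧ j < en ∧ g j = v := by
    intro g v
    constructor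
    · rintro ⟨j, hj, hv⟩
      rcases lt_or_ge j b with hjb | hjb
      · exact Or.inl ⟨j, hjb, hv⟩
      · exact Or.inr ⟨j, hjb, hj, hv⟩
    · rintro (⟨j, hj, hv⟩ | ⟨j, hjb, hj, hv⟩)
      · exact ⟨j, by omega, hv⟩
      · exact ⟨j, hj, hv⟩
  have hfst : ∀ v, (∃ j < b, q j = v) ↔ ∃ j < b, p j = v := by
    intro v
    rw [← hmem v]
    constructor <;> rintro ⟨j, hj, hv⟩
    · exact ⟨j, hj, by rw [← hqq j hj, hv]⟩
    · exact ⟨j, hj, by rw [hqq j hj, hv]⟩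
  have hsnd : ∀ v, (∃ j, b ≤ j ∧ j < en ∧ q j = v) ↔ ∃ j, b ≤ j ∧ j < en ∧ p j = v := by
    intro v
    rw [hI.mem v]
    constructor
    · rintro (⟨j, h3, h4, hv⟩ | ⟨j, h3, h4, hv⟩)
      · exact ⟨j, h3, by omega, hv⟩
      · exact ⟨j, by omega, h4, hv⟩
    · rintro ⟨j, h3, h4, hv⟩
      rcases lt_or_ge j md with hj | hj
      · exact Or.inl ⟨j, h3, hj, hv⟩
      · exact Or.inr ⟨j, hj, h4, hv⟩
  refine ⟨fun v => by rw [hsplit, hsplit, hfst, hsnd], fun i j hij hj hd => ?_⟩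
  rcases lt_or_ge j b with hjb | hjb
  · rw [hqq j hjb, hqq i (by omega)]
    exact hq i j hij hjb hd
  · refine hI.sorted i j ?_ hij hj
    rw [hdiv j hjb hj] at hd
    rw [hb, ← hd]
    exact Nat.mul_div_le i H

end merge

section sort

variable {n k : ℕ} (D : Family n k) {Z M : ℕ} {σ : Store}

theorem pick_wp (hW : σ.wt = D.W) (hM : M < Z)
    (hp : ∀ j < M, σ.arr .p j < M) (he : ∀ j < M, σ.arr .ei j < Z)
    (hmd : σ.var .md ≤ M) (hen : σ.var .en ≤ M) (hZ : 1 < Z)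
    (hlr : σ.var .l < σ.var .md ∨ σ.var .r < σ.var .en) :
    Wp Z pickProg σ fun t σ' => t ≤ 6 ∧ σ' = σ.set .g (σ'.var .g) ∧
      (σ'.var .g = 1 ∧ σ.var .l < σ.var .md ∧ (σ.var .r < σ.var .en →
        D.key (σ.arr .ei (σ.arr .p (σ.var .r))) ≤ D.key (σ.arr .ei (σ.arr .p (σ.var .l)))) ∨
      σ'.var .g = 0 ∧ σ.var .r < σ.var .en ∧ (σ.var .l < σ.var .md →
        D.key (σ.arr .ei (σ.arr .p (σ.var .l))) ≤
          D.key (σ.arr .ei (σ.arr .p (σ.var .r))))) := by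
  have hlt : ∀ j < M, j < Z ∧ σ.arr .p j < Z ∧ σ.arr .ei (σ.arr .p j) < Z := fun j hj =>
    ⟨by omega, (hp j hj).trans hM, he _ (hp j hj)⟩
  simp only [pickProg, wp_ite, wp_assign, Cond.Ok, Cond.Holds, Expr.Ok, Expr.eval,
    true_and, hW, D.key_le_iff]
  refine ⟨fun h1 => ⟨fun h2 => ?_, fun h2 => ?_⟩, fun h1 => ?_⟩
  · obtain ⟨a1, a2, a3⟩ := hlt (σ.var .l) (by omega)
    obtain ⟨b1, b2, b3⟩ := hlt (σ.var .r) (by omega)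
    refine ⟨⟨⟨a1, a2⟩, ⟨b1, b2⟩, a3, b3⟩, fun h3 => ?_, fun h3 =>
      ⟨⟨⟨b1, b2⟩, ⟨a1, a2⟩, b3, a3⟩, fun h4 => ?_, fun h4 =>
        ⟨⟨⟨a1, a2⟩, ⟨b1, b2⟩⟩, fun h5 => ?_, fun h5 => ?_⟩⟩⟩
    · simp [h1, h2, h3]
      omega
    · simp [h1, h2, h4]
      omega
    · have := le_antisymm (not_lt.1 h3) (not_lt.1 h4)
      simp [h1, h2, this, h5.le]
      omega
    · have := le_antisymm (not_lt.1 h3) (not_lt.1 h4)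
      simp [h1, h2, this, not_lt.1 h5]
      omega
  · simp [h1, h2]
    omega
  · have h2 : σ.var .r < σ.var .en := by omega
    simp [h1, h2]
    omega

theorem mergeStep_wp (hW : σ.wt = D.W) (hM : M + 1 < Z) {q₀ : ℕ → ℕ} {b : ℕ}
    (hp : ∀ j < M, σ.arr .p j < M) (he : ∀ j < M, σ.arr .ei j < Z)
    (hen : σ.var .en ≤ M) (hmd : σ.var .md ≤ σ.var .en) (hlt : σ.var .o < σ.var .en)
    (hp1 : ∀ i j, b ≤ i → i < j → j < σ.var .md →
      D.key (σ.arr .ei (σ.arr .p j)) ≤ D.key (σ.arr .ei (σ.arr .p i)))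
    (hp2 : ∀ i j, σ.var .md ≤ i → i < j → j < σ.var .en →
      D.key (σ.arr .ei (σ.arr .p j)) ≤ D.key (σ.arr .ei (σ.arr .p i)))
    (hq : ∀ j < b, σ.arr .q j = q₀ j)
    (hI : MergeInv (fun v => D.key (σ.arr .ei v)) (σ.arr .p) (σ.arr .q) b (σ.var .md)
      (σ.var .en) (σ.var .l) (σ.var .r) (σ.var .o)) :
    Wp Z mergeStepProg σ fun t σ' => t ≤ 10 ∧ σ'.var .o = σ.var .o + 1 ∧
      (∀ j < b, σ'.arr .q j = q₀ j) ∧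
      MergeInv (fun v => D.key (σ.arr .ei v)) (σ.arr .p) (σ'.arr .q) b (σ.var .md)
        (σ.var .en) (σ'.var .l) (σ'.var .r) (σ'.var .o) := by
  have h1 := hI.bl
  have h2 := hI.lmd
  have h3 := hI.mdr
  have h4 := hI.ren
  have h5 := hI.sum
  refine wp_seq.2 ((pick_wp D hW (by omega) hp he (by omega) hen (by omega) (by omega)).mono ?_)
  rintro t σ' - ⟨ht, hσ', ⟨hg, hl, hle⟩ | ⟨hg, hr, hle⟩⟩
  · have hI' := hI.left hl hp1 hp2 hle
    have hq' : ∀ j < b, Function.update (σ.arr .q) (σ.var .o) (σ.arr .p (σ.var .l)) j = q₀ j := by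
      intro j hj
      rw [Function.update_of_ne (by omega)]
      exact hq j hj
    rw [hσ']
    simp only [wp_seq, wp_ite, wp_put, wp_assign]
    simp [hg]
    and_intros <;> omega
  · have hI' := hI.right hr hp1 hp2 hle
    have hq' : ∀ j < b, Function.update (σ.arr .q) (σ.var .o) (σ.arr .p (σ.var .r)) j = q₀ j := by
      intro j hj
      rw [Function.update_of_ne (by omega)]
      exact hq j hj
    rw [hσ']
    simp [hg]
    and_intros <;> omega

/-- Being in one block of length `h` is expressed by equal quotients by `h`, so two adjacent blocks
become one block of length `2 * h`. The constant overhead of a merge is charged to its output, which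
is never empty; hence time linear in the progress of `b`. -/
theorem mergeBlock_wp {b h : ℕ} (hW : σ.wt = D.W) (hMv : σ.var .M = M) (hhv : σ.var .h = h)
    (hbv : σ.var .b = b) (hh : 0 < h) (hhM : h < M) (hbM : b < M) (hdvd : 2 * h ∣ b)
    (hM : 4 * M + 1 < Z) (hp : ∀ j < M, σ.arr .p j < M) (he : ∀ j < M, σ.arr .ei j < Z)
    (hs : ∀ i j, i < j → j < M → i / h = j / h →
      D.key (σ.arr .ei (σ.arr .p j)) ≤ D.key (σ.arr .ei (σ.arr .p i)))
    (hmem : ∀ v, (∃ j < b, σ.arr .q j = v) ↔ ∃ j < b, σ.arr .p j = v)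
    (hq : ∀ i j, i < j → j < b → i / (2 * h) = j / (2 * h) →
      D.key (σ.arr .ei (σ.arr .q j)) ≤ D.key (σ.arr .ei (σ.arr .q i))) :
    Wp Z mergeBlockProg σ fun t σ' => b < σ'.var .b ∧ σ'.var .b ≤ M ∧
      t + 1 ≤ (σ'.var .b - b) * 20 ∧ (σ'.var .b = M ∨ 2 * h ∣ σ'.var .b) ∧
      (∀ v, (∃ j < σ'.var .b, σ'.arr .q j = v) ↔ ∃ j < σ'.var .b, σ.arr .p j = v) ∧
      (∀ i j, i < j → j < σ'.var .b → i / (2 * h) = j / (2 * h) →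
        D.key (σ.arr .ei (σ'.arr .q j)) ≤ D.key (σ.arr .ei (σ'.arr .q i))) := by
  obtain ⟨c, hc⟩ := hdvd
  obtain ⟨md, hmd'⟩ : ∃ md, b + h - (b + h - M) = md := ⟨_, rfl⟩
  obtain ⟨en, hen'⟩ : ∃ en, md + h - (md + h - M) = en := ⟨_, rfl⟩
  have hmd1 : b < md ∧ md ≤ M ∧ md ≤ b + h ∧ (md = b + h ∨ md = M) := by omega
  have hen1 : md ≤ en ∧ en ≤ M ∧ en ≤ b + 2 * h ∧ (en = b + 2 * h ∨ en = M) := by omega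
  have hb1 : ∀ i, b ≤ i → i < md → i / h = 2 * c := fun i h1 h2 =>
    Nat.div_eq_of_lt_le (by linarith) (by linarith)
  have hb2 : ∀ i, md ≤ i → i < en → i / h = 2 * c + 1 := fun i h1 h2 =>
    Nat.div_eq_of_lt_le (by
      have : md = b + h := by omega
      linarith) (by linarith)
  have hb3 : ∀ i, b ≤ i → i < en → i / (2 * h) = c := fun i h1 h2 =>
    Nat.div_eq_of_lt_le (by linarith) (by linarith)
  have hs1 : ∀ i j, b ≤ i → i < j → j < md →
      D.key (σ.arr .ei (σ.arr .p j)) ≤ D.key (σ.arr .ei (σ.arr .p i)) := fun i j h1 h2 h3 =>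
    hs i j h2 (by omega) (by rw [hb1 i h1 (h2.trans h3), hb1 j (h1.trans h2.le) h3])
  have hs2 : ∀ i j, md ≤ i → i < j → j < en →
      D.key (σ.arr .ei (σ.arr .p j)) ≤ D.key (σ.arr .ei (σ.arr .p i)) := fun i j h1 h2 h3 =>
    hs i j h2 (by omega) (by rw [hb2 i h1 (h2.trans h3), hb2 j (h1.trans h2.le) h3])
  clear hs
  simp [mergeBlockProg, hMv, hhv, hbv, hmd', hen']
  refine ⟨by omega, by omega, ?_⟩
  refine Wp.loop (fun t σ' => t ≤ (σ'.var .o - b) * 11 ∧ (∀ j < b,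
      σ'.arr .q j = σ.arr .q j) ∧ MergeInv (fun v => D.key (σ.arr .ei v)) (σ.arr .p) (σ'.arr .q)
      (b) md en (σ'.var .l) (σ'.var .r) (σ'.var .o)) (fun σ' => en - σ'.var .o) ?_ ?_ ?_ ?_
  · refine ⟨by simp, by simp, ?_⟩
    simp only [Store.set_var, Store.set_arr, reduceCtorEq, if_true, if_false]
    refine ⟨le_rfl, by omega, le_rfl, by omega, rfl, fun v => ?_, fun i j => by omega,
      fun i j => by omega⟩
    constructor
    · rintro ⟨j, h1, h2, -⟩
      omega
    · rintro (⟨j, h1, h2, -⟩ | ⟨j, h1, h2, -⟩) <;> omega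
  · intros
    exact ⟨trivial, trivial⟩
  · rintro t σ' hsame ⟨ht, hqq, hI⟩ hlt
    have e1 : σ'.var .md = md := by simp [hsame.var .md]
    have e2 : σ'.var .en = en := by simp [hsame.var .en]
    have e3 : σ'.arr .p = σ.arr .p := by simp [hsame.arr .p]
    have e4 : σ'.arr .ei = σ.arr .ei := by simp [hsame.arr .ei]
    have e5 : σ'.wt = D.W := by simp [hsame.wt, hW]
    simp only [Cond.Holds, Expr.eval, e2] at hlt
    have hbo : b ≤ σ'.var .o := by
      have := hI.bl
      have := hI.mdr
      have := hI.sum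
      omega
    refine (mergeStep_wp D (σ := σ') (M := M) (q₀ := σ.arr .q) (b := b) e5 (by omega)
      (by rwa [e3]) (by rwa [e4]) (by omega) (by omega) (by omega) (by rwa [e1, e3, e4])
      (by rwa [e1, e2, e3, e4]) hqq (by rwa [e1, e2, e3, e4])).mono ?_
    rintro t' σ'' - ⟨ht', ho, hqq', hI'⟩
    rw [e1, e2, e3, e4] at hI'
    exact ⟨⟨by omega, hqq', hI'⟩, by omega⟩
  · rintro t σ' hsame ⟨ht, hqq, hI⟩ hlt
    have e2 : σ'.var .en = en := by simp [hsame.var .en]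
    simp only [Cond.Holds, Expr.eval, e2] at hlt
    have h1 := hI.bl
    have h2 := hI.lmd
    have h3 := hI.ren
    have h4 := hI.sum
    have ho : σ'.var .o = en := by omega
    have hl : σ'.var .l = md := by omega
    have hr : σ'.var .r = en := by omega
    rw [ho, hl, hr] at hI
    simp only [e2]
    refine ⟨by omega, by omega, by omega, ?_, hI.block hqq hmem hq hc hb3⟩
    by_cases hlast : en = b + 2 * h
    · right
      exact ⟨c + 1, by rw [mul_add, ← hc]; omega⟩
    · left
      omega

theorem sortPass_wp {h : ℕ} (hW : σ.wt = D.W) (hMv : σ.var .M = M) (hhv : σ.var .h = h)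
    (hh : 0 < h) (hhM : h < M)
    (hM : 4 * M + 1 < Z) (hp : ∀ j < M, σ.arr .p j < M) (he : ∀ j < M, σ.arr .ei j < Z)
    (hs : ∀ i j, i < j → j < M → i / h = j / h →
      D.key (σ.arr .ei (σ.arr .p j)) ≤ D.key (σ.arr .ei (σ.arr .p i))) :
    Wp Z sortPassProg σ fun t σ' => t ≤ M * 23 + 5 ∧ σ'.var .h = 2 * h ∧
      (∀ v, (∃ j < M, σ'.arr .p j = v) ↔ ∃ j < M, σ.arr .p j = v) ∧
      (∀ i j, i < j → j < M → i / (2 * h) = j / (2 * h) →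
        D.key (σ.arr .ei (σ'.arr .p j)) ≤ D.key (σ.arr .ei (σ'.arr .p i))) := by
  simp [sortPassProg]
  refine ⟨by omega, ?_⟩
  refine Wp.loop (fun t σ' => t ≤ σ'.var .b * 20 ∧ σ'.var .b ≤ M ∧
    (σ'.var .b = M ∨ 2 * h ∣ σ'.var .b) ∧
    (∀ v, (∃ j < σ'.var .b, σ'.arr .q j = v) ↔ ∃ j < σ'.var .b, σ.arr .p j = v) ∧
    (∀ i j, i < j → j < σ'.var .b → i / (2 * h) = j / (2 * h) →
        D.key (σ.arr .ei (σ'.arr .q j)) ≤ D.key (σ.arr .ei (σ'.arr .q i))))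
    (fun σ' => M - σ'.var .b) ?_ ?_ ?_ ?_
  · simp
  · intros
    exact ⟨trivial, trivial⟩
  · rintro t σ' hsame ⟨ht, hbM, hdvd, hmem, hq⟩ hlt
    have e1 : σ'.var .M = M := by simp [hsame.var .M, hMv]
    have e2 : σ'.var .h = h := by simp [hsame.var .h, hhv]
    have e3 : σ'.arr .p = σ.arr .p := by simp [hsame.arr .p]
    have e4 : σ'.arr .ei = σ.arr .ei := by simp [hsame.arr .ei]
    have e5 : σ'.wt = D.W := by simp [hsame.wt, hW]
    simp only [Cond.Holds, Expr.eval, e1] at hlt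
    refine (mergeBlock_wp D (σ := σ') (M := M) e5 e1 e2 rfl hh hhM hlt (by omega) hM
      (by rwa [e3]) (by rwa [e4]) (by rwa [e3, e4]) (by rwa [e3]) (by rwa [e4])).mono ?_
    rintro t' σ'' - ⟨h1, h2, h3, h4, h5, h6⟩
    rw [e3] at h5
    rw [e4] at h6
    exact ⟨⟨by omega, h2, h4, h5, h6⟩, by omega⟩
  · rintro t σ' hsame ⟨ht, hbM, hdvd, hmem, hq⟩ hlt
    have e1 : σ'.var .M = M := by simp [hsame.var .M, hMv]
    have e2 : σ'.var .h = h := by simp [hsame.var .h, hhv]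
    simp only [Cond.Holds, Expr.eval, e1] at hlt
    have hb : σ'.var .b = M := by omega
    rw [hb] at ht hmem hq
    refine Wp.upTo M 1 (by omega) (fun j σ'' => ∀ i < j, σ''.arr .p i = σ'.arr .q i) ?_ ?_ ?_ ?_
    · intro σ'' hs'
      exact ⟨trivial, by simp [hs'.var .M, e1]⟩
    · simp
    · intro j σ'' hj hs' hsv hI
      simp [hsv, hs'.arr .q]
      refine ⟨by omega, fun i hi => ?_⟩
      by_cases hij : i = j
      · simp [hij]
      · rw [Function.update_of_ne hij]
        exact hI i (by omega)
    · intro t' σ'' ht' hs' hI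
      simp [hs'.var .h, e2]
      refine ⟨by omega, by omega, by omega, fun v => ?_, fun i j hij hj hd => ?_⟩
      · rw [← hmem v]
        constructor
        · rintro ⟨j, hj, hv⟩
          exact ⟨j, hj, by rw [← hI j hj, hv]⟩
        · rintro ⟨j, hj, hv⟩
          exact ⟨j, hj, by rw [hI j hj, hv]⟩
      · rw [hI i (by omega), hI j hj]
        exact hq i j hij hj hd

theorem sort_wp (hW : σ.wt = D.W) (hMv : σ.var .M = M)
    (hM : 4 * M + 1 < Z) (he : ∀ j < M, σ.arr .ei j < Z) :
    Wp Z sortProg σ fun t σ' => t ≤ (Nat.log 2 M + 1) * (M * 23 + 6) + M * 3 + 4 ∧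
      (∀ v, (∃ j < M, σ'.arr .p j = v) ↔ v < M) ∧
      (∀ i j, i < j → j < M →
        D.key (σ.arr .ei (σ'.arr .p j)) ≤ D.key (σ.arr .ei (σ'.arr .p i))) := by
  refine wp_seq.2 (Wp.upTo M 1 (by omega) (fun j σ' => ∀ i < j, σ'.arr .p i = i) ?_ (by simp) ?_ ?_)
  · intro σ' hs'
    exact ⟨trivial, by simp [hs'.var .M, hMv]⟩
  · intro j σ' hj hs' hsv hI
    simp [hsv]
    refine ⟨by omega, fun i hi => ?_⟩
    by_cases hij : i = j
    · simp [hij]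
    · rw [Function.update_of_ne hij]
      exact hI i (by omega)
  intro t₀ σ₀ ht₀ hs₀ hI₀
  simp
  refine ⟨by omega, ?_⟩
  have a1 : σ₀.arr .ei = σ.arr .ei := by simp [hs₀.arr .ei]
  -- The block length is 2 ^ a after a passes, and its half was still below `M`; this bounds the
  -- number of passes by `Nat.log 2 M + 1`.
  refine Wp.loop (fun t σ' => ∃ a, t ≤ a * (M * 23 + 6) ∧ σ'.var .h = 2 ^ a ∧
    (a = 0 ∨ 2 ^ (a - 1) < M) ∧
    (∀ v, (∃ j < M, σ'.arr .p j = v) ↔ v < M) ∧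
    (∀ i j, i < j → j < M → i / 2 ^ a = j / 2 ^ a →
        D.key (σ.arr .ei (σ'.arr .p j)) ≤ D.key (σ.arr .ei (σ'.arr .p i))))
    (fun σ' => 2 * M - σ'.var .h) ?_ ?_ ?_ ?_
  · refine ⟨0, by simp, by simp, Or.inl rfl, fun v => ?_, fun i j hij _ hd => ?_⟩
    · simp
      constructor
      · rintro ⟨j, hj, hv⟩
        rw [hI₀ j hj] at hv
        omega
      · intro hv
        exact ⟨v, hv, hI₀ v hv⟩
    · simp at hd
      omega
  · intros
    exact ⟨trivial, trivial⟩
  · rintro t σ' hsame ⟨a, ht, hh, -, hmem, hsrt⟩ hlt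
    have e1 : σ'.var .M = M := by simp [hsame.var .M, hs₀.var .M, hMv]
    have e4 : σ'.arr .ei = σ.arr .ei := by simp [hsame.arr .ei, a1]
    have e5 : σ'.wt = D.W := by simp [hsame.wt, hs₀.wt, hW]
    simp only [Cond.Holds, Expr.eval, e1] at hlt
    have hpos : 0 < σ'.var .h := by rw [hh]; positivity
    refine (sortPass_wp D (σ := σ') (M := M) e5 e1 rfl hpos hlt hM
      (fun j hj => (hmem _).1 ⟨j, hj, rfl⟩) (by rwa [e4]) (by rwa [e4, hh])).mono ?_
    rintro t' σ'' - ⟨h1, h2, h3, h4⟩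
    refine ⟨⟨a + 1, ?_, ?_, ?_, ?_, ?_⟩, by omega⟩
    · rw [add_mul]
      omega
    · rw [h2, hh]
      ring
    · right
      rw [hh] at hlt
      simpa using hlt
    · intro v
      rw [h3, hmem]
    · rw [e4, hh] at h4
      rw [pow_succ, mul_comm]
      exact h4
  · rintro t σ' hsame ⟨a, ht, hh, ha, hmem, hsrt⟩ hlt
    have e1 : σ'.var .M = M := by simp [hsame.var .M, hs₀.var .M, hMv]
    simp only [Cond.Holds, Expr.eval, e1, hh] at hlt
    have hale : a ≤ Nat.log 2 M + 1 := by
      rcases ha with rfl | ha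
      · omega
      · have := Nat.le_log_of_pow_le (by norm_num) ha.le
        omega
    have := Nat.mul_le_mul_right (M * 23 + 6) hale
    refine ⟨by omega, hmem, fun i j hij hj => hsrt i j hij hj ?_⟩
    -- The block length has reached `M`, so all indices lie in block 0 and sortedness is global.
    rw [Nat.div_eq_of_lt (by omega), Nat.div_eq_of_lt (by omega)]

end sort

end CutMerge

/-! ### Component labels with linked lists, and their amortized cost. -/

namespace CutMerge

open Relation

/-! ### Bucket lists -/

/-- `L` is the list stored from the pointer `h` on; pointers are shifted by one, and `0` is the
null pointer. -/
def Chained (nxt : ℕ → ℕ) : ℕ → List ℕ → Prop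
  | h, [] => h = 0
  | h, z :: L => h = z + 1 ∧ Chained nxt (nxt z) L

theorem Chained.update {nxt : ℕ → ℕ} {z c : ℕ} : ∀ {h : ℕ} {L : List ℕ}, z ∉ L →
    Chained nxt h L → Chained (Function.update nxt z c) h L
  | _, [], _, hc => hc
  | _, w :: L, hz, hc => by
    simp only [List.mem_cons, not_or] at hz
    refine ⟨hc.1, ?_⟩
    rw [Function.update_of_ne (Ne.symm hz.1)]
    exact hc.2.update hz.2

/-- For every label, the elements below `m` with this label are stored in a linked list. -/
def Buckets (m : ℕ) (lab hd nxt sz : ℕ → ℕ) : Prop :=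
  ∀ ℓ < m, ∃ L : List ℕ, Chained nxt (hd ℓ) L ∧ L.Nodup ∧ (∀ z, z ∈ L ↔ z < m ∧ lab z = ℓ) ∧
    sz ℓ = L.length

theorem buckets_of_singletons {m : ℕ} {lab hd nxt sz : ℕ → ℕ} (h1 : ∀ z < m, lab z = z)
    (h2 : ∀ z < m, hd z = z + 1) (h3 : ∀ z < m, nxt z = 0) (h4 : ∀ z < m, sz z = 1) :
    Buckets m lab hd nxt sz := by
  intro ℓ hℓ
  refine ⟨[ℓ], ⟨h2 ℓ hℓ, h3 ℓ hℓ⟩, by simp, fun z => ?_, h4 ℓ hℓ⟩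
  simp only [List.mem_singleton]
  constructor
  · rintro rfl
    exact ⟨hℓ, h1 z hℓ⟩
  · rintro ⟨hz, hl⟩
    rw [← hl, h1 z hz]

section buckets

variable {m : ℕ} {lab hd nxt sz : ℕ → ℕ} (h : Buckets m lab hd nxt sz)
include h

theorem Buckets.size_eq {ℓ : ℕ} (hℓ : ℓ < m) :
    sz ℓ = ((Finset.range m).filter fun z => lab z = ℓ).card := by
  obtain ⟨L, -, hn, hm, hs⟩ := h ℓ hℓ
  rw [hs, ← List.toFinset_card_of_nodup hn]
  congr 1
  ext z
  simp [hm]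

theorem Buckets.head {ℓ : ℕ} (hℓ : ℓ < m) (h0 : hd ℓ ≠ 0) :
    hd ℓ - 1 < m ∧ lab (hd ℓ - 1) = ℓ ∧ hd ℓ = hd ℓ - 1 + 1 := by
  obtain ⟨L, hc, -, hm, -⟩ := h ℓ hℓ
  cases L with
  | nil => exact absurd hc h0
  | cons z L =>
    have := (hm z).1 (by simp)
    rw [hc.1]
    simpa using this

theorem Buckets.empty {ℓ : ℕ} (hℓ : ℓ < m) (h0 : hd ℓ = 0) {z : ℕ} (hz : z < m) : lab z ≠ ℓ := by
  obtain ⟨L, hc, -, hm, -⟩ := h ℓ hℓ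
  cases L with
  | nil =>
    intro hl
    simpa using (hm z).2 ⟨hz, hl⟩
  | cons w L =>
    have := hc.1
    omega

/-- Moving the first element of a bucket to another one. -/
theorem Buckets.move {X Y z : ℕ} (hX : X < m) (hY : Y < m) (hXY : X ≠ Y) (hz : hd X = z + 1) :
    Buckets m (Function.update lab z Y)
      (Function.update (Function.update hd X (nxt z)) Y (z + 1))
      (Function.update nxt z (hd Y))
      (Function.update (Function.update sz X (sz X - 1)) Y (sz Y + 1)) := by
  obtain ⟨LX, hcX, hnX, hmX, hsX⟩ := h X hX
  obtain ⟨w, L, rfl⟩ : ∃ w L, LX = w :: L := by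
    cases LX with
    | nil => exact absurd (hcX.symm.trans hz) (by omega)
    | cons w L => exact ⟨w, L, rfl⟩
  obtain rfl : z = w := by
    have := hcX.1
    omega
  have hzX := (hmX z).1 (by simp)
  rw [List.nodup_cons] at hnX
  have hne : ∀ v, v ∈ L → v ≠ z := fun v hv he => hnX.1 (he ▸ hv)
  intro ℓ hℓ
  by_cases hℓY : ℓ = Y
  · subst hℓY
    obtain ⟨LY, hcY, hnY, hmY, hsY⟩ := h ℓ hY
    have hzY : z ∉ LY := fun hc => hXY (hzX.2.symm.trans ((hmY z).1 hc).2)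
    refine ⟨z :: LY, ⟨by simp, ?_⟩, List.nodup_cons.2 ⟨hzY, hnY⟩, fun v => ?_, by simp [hsY]⟩
    · simpa using hcY.update hzY
    · rw [List.mem_cons, hmY]
      by_cases hv : v = z
      · subst hv
        simp [hzX.1]
      · simp [hv]
  · by_cases hℓX : ℓ = X
    · subst hℓX
      refine ⟨L, ?_, hnX.2, fun v => ?_, ?_⟩
      · rw [Function.update_of_ne hℓY, Function.update_self]
        exact hcX.2.update hnX.1
      · have := hmX v
        rw [List.mem_cons] at this
        by_cases hv : v = z
        · subst hv
          simp [hnX.1, Ne.symm hℓY]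
        · rw [Function.update_of_ne hv, ← this]
          simp [hv]
      · rw [Function.update_of_ne hℓY, Function.update_self, hsX]
        simp
    · obtain ⟨L', hc', hn', hm', hs'⟩ := h ℓ hℓ
      have hz' : z ∉ L' := fun hc => hℓX (((hm' z).1 hc).2.symm.trans hzX.2)
      refine ⟨L', ?_, hn', fun v => ?_, ?_⟩
      · rw [Function.update_of_ne hℓY, Function.update_of_ne hℓX]
        exact hc'.update hz'
      · rw [hm']
        by_cases hv : v = z
        · subst hv
          simp only [Function.update_self, Ne.symm hℓY, and_false, iff_false, not_and]
          exact fun _ hc => hℓX (hc.symm.trans hzX.2)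
        · rw [Function.update_of_ne hv]
      · rw [Function.update_of_ne hℓY, Function.update_of_ne hℓX, hs']

end buckets

/-! ### The potential for small-to-large relabelling -/

/-- The labels after all elements with label `X` have got the label `Y`. -/
def relabel (X Y : ℕ) (lab : ℕ → ℕ) (z : ℕ) : ℕ := if lab z = X then Y else lab z

/-- Every element contributes the logarithm of the size of its class. This never exceeds m log m in
total and pays for all relabellings. -/
def potential (m : ℕ) (lab : ℕ → ℕ) : ℕ :=
  ∑ z ∈ Finset.range m, Nat.log 2 ((Finset.range m).filter fun w => lab w = lab z).card

theorem potential_le (m : ℕ) (lab : ℕ → ℕ) : potential m lab ≤ m * Nat.log 2 m := by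
  refine (Finset.sum_le_card_nsmul _ _ (Nat.log 2 m) fun z _ => Nat.log_mono_right ?_).trans
    (by simp)
  exact (Finset.card_filter_le _ _).trans (by simp)

/-- An element of the class `X` ends in a class at least twice as large, since `X` is no larger than
`Y`. Its logarithm grows by at least 1, and no other summand decreases. -/
theorem potential_relabel {m X Y : ℕ} {lab : ℕ → ℕ} (hXY : X ≠ Y)
    (hle : ((Finset.range m).filter fun w => lab w = X).card ≤
      ((Finset.range m).filter fun w => lab w = Y).card) :
    potential m lab + ((Finset.range m).filter fun w => lab w = X).card ≤
      potential m (relabel X Y lab) := by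
  have hsum : ((Finset.range m).filter fun w => lab w = X).card =
      ∑ z ∈ Finset.range m, if lab z = X then 1 else 0 := by
    rw [Finset.card_filter]
  conv_lhs => rw [hsum]
  rw [potential, potential, ← Finset.sum_add_distrib]
  refine Finset.sum_le_sum fun z hz => ?_
  by_cases hzX : lab z = X
  · rw [if_pos hzX, hzX]
    have hsub : ((Finset.range m).filter fun w => lab w = X) ∪
        ((Finset.range m).filter fun w => lab w = Y) ⊆
        (Finset.range m).filter fun w => relabel X Y lab w = relabel X Y lab z := by
      intro w
      simp only [Finset.mem_union, Finset.mem_filter, relabel, hzX, if_true]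
      rintro (⟨h1, h2⟩ | ⟨h1, h2⟩)
      · exact ⟨h1, by simp [h2]⟩
      · exact ⟨h1, by simp [h2]⟩
    have hcard := Finset.card_le_card hsub
    rw [Finset.card_union_of_disjoint] at hcard
    · have hpos : ((Finset.range m).filter fun w => lab w = X).card ≠ 0 :=
        Finset.card_ne_zero_of_mem (a := z) (by simpa [hzX] using hz)
      rw [← Nat.log_mul_base (by norm_num) hpos]
      exact Nat.log_mono_right (by omega)
    · rw [Finset.disjoint_filter]
      intro w _ h1 h2
      exact hXY (h1.symm.trans h2)
  · rw [if_neg hzX, add_zero]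
    refine Nat.log_mono_right (Finset.card_le_card fun w => ?_)
    simp only [Finset.mem_filter, relabel, if_neg hzX]
    rintro ⟨h1, h2⟩
    exact ⟨h1, by rw [if_neg (by rw [h2]; exact hzX), h2]⟩

/-! ### Connectivity -/

theorem eqvGen_map {α β : Type*} {r : α → α → Prop} {s : β → β → Prop} (g : α → β)
    (h : ∀ a b, r a b → EqvGen s (g a) (g b)) {a b : α} (hab : EqvGen r a b) :
    EqvGen s (g a) (g b) := by
  induction hab with
  | rel a b hab => exact h a b hab
  | refl a => exact EqvGen.refl _
  | symm a b _ ih => exact ih.symm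
  | trans a b c _ _ ih1 ih2 => exact ih1.trans _ _ _ ih2

theorem Link.mono {J J' : ℕ → Prop} {u v u' v' : ℕ → ℕ}
    (h : ∀ j, J j → u j = v j ∨ (J' j ∧ u' j = u j ∧ v' j = v j)) {x y : ℕ}
    (hxy : Link J u v x y) : Link J' u' v' x y := by
  refine eqvGen_of_le ?_ hxy
  rintro a b ⟨j, hj, rfl, rfl⟩
  rcases h j hj with he | ⟨h1, h2, h3⟩
  · exact he ▸ EqvGen.refl _
  · exact EqvGen.rel _ _ ⟨j, h1, h2, h3⟩

theorem Link.edge {J : ℕ → Prop} {u v : ℕ → ℕ} {j : ℕ} (hj : J j) : Link J u v (u j) (v j) :=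
  EqvGen.rel _ _ ⟨j, hj, rfl, rfl⟩

/-- An invariant of the edges is an invariant of linked vertices. -/
theorem Link.invariant {J : ℕ → Prop} {u v : ℕ → ℕ} {α : Type*} (g : ℕ → α)
    (h : ∀ j, J j → g (u j) = g (v j)) {x y : ℕ} (hxy : Link J u v x y) : g x = g y := by
  induction hxy with
  | rel a b hab =>
    obtain ⟨j, hj, rfl, rfl⟩ := hab
    exact h j hj
  | refl a => rfl
  | symm a b _ ih => exact ih.symm
  | trans a b c _ _ ih1 ih2 => exact ih1.trans ih2

/-- Labels of the components after the insertion of an edge. -/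
theorem link_insert {J J' : ℕ → Prop} {u v lab lab' : ℕ → ℕ} {m j₀ : ℕ}
    (hlt : ∀ j, J' j → u j < m ∧ v j < m) (hJ : ∀ j, J' j ↔ J j ∨ j = j₀)
    (hlab : ∀ z < m, ∀ w < m, lab z = lab w ↔ Link J u v z w)
    (hlab' : ∀ z < m, ∀ w < m, lab' z = lab' w ↔ lab z = lab w ∨
      (lab z = lab (u j₀) ∧ lab w = lab (v j₀)) ∨ (lab z = lab (v j₀) ∧ lab w = lab (u j₀))) :
    ∀ z < m, ∀ w < m, lab' z = lab' w ↔ Link J' u v z w := by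
  have h0 := hlt j₀ ((hJ j₀).2 (Or.inr rfl))
  have hmono : ∀ {z w}, Link J u v z w → Link J' u v z w := fun h =>
    h.mono fun j hj => Or.inr ⟨(hJ j).2 (Or.inl hj), rfl, rfl⟩
  have hedge : Link J' u v (u j₀) (v j₀) := Link.edge ((hJ j₀).2 (Or.inr rfl))
  intro z hz w hw
  rw [hlab' z hz w hw]
  constructor
  · rintro (h | ⟨h1, h2⟩ | ⟨h1, h2⟩)
    · exact hmono ((hlab z hz w hw).1 h)
    · exact (hmono ((hlab z hz _ h0.1).1 h1)).trans _ _ _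
        (hedge.trans _ _ _ (hmono ((hlab w hw _ h0.2).1 h2)).symm)
    · exact (hmono ((hlab z hz _ h0.2).1 h1)).trans _ _ _
        (hedge.symm.trans _ _ _ (hmono ((hlab w hw _ h0.1).1 h2)).symm)
  · intro h
    rw [← hlab' z hz w hw]
    have : (if z < m then lab' z else m) = if w < m then lab' w else m := by
      refine h.invariant (fun z => if z < m then lab' z else m) fun j hj => ?_
      obtain ⟨h1, h2⟩ := hlt j hj
      simp only [h1, h2, if_true]
      rw [hlab' _ h1 _ h2]
      rcases (hJ j).1 hj with hj | rfl
      · exact Or.inl ((hlab _ h1 _ h2).2 (Link.edge hj))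
      · exact Or.inr (Or.inl ⟨rfl, rfl⟩)
    simpa [hz, hw] using this

theorem relabel_eq_iff {X Y : ℕ} {lab : ℕ → ℕ} {z w : ℕ} :
    relabel X Y lab z = relabel X Y lab w ↔ lab z = lab w ∨
      (lab z = X ∧ lab w = Y) ∨ (lab z = Y ∧ lab w = X) := by
  simp only [relabel]
  split_ifs with h1 h2 h2
  · simp [h1, h2]
  · simp only [h1, true_and]
    constructor
    · exact fun h => Or.inr (Or.inl h.symm)
    · rintro (h | h | h)
      · exact absurd h.symm h2
      · exact h.symm
      · exact absurd h.2 h2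
  · simp only [h2, and_true]
    constructor
    · exact fun h => Or.inr (Or.inr h)
    · rintro (h | h | h)
      · exact absurd h h1
      · exact absurd h.1 h1
      · exact h
  · simp [h1, h2]

end CutMerge

/-! ### Maintaining the common refinement of two partitions. -/

namespace CutMerge

open Relation

/-! ### Classes of vertices that are equivalent for two labellings -/

/-- `c x` is the cell of the vertex `x`; the table `tab` holds for every cell in use a
representative of the vertices in it (shifted by one), and `par` links exactly the vertices in a
common cell. -/
structure Cells (n : ℕ) (used : ℕ → Prop) (c tab par : ℕ → ℕ) : Prop where
  rep : ∀ x < n, ∃ r < n, tab (c x) = r + 1 ∧ c r = c x ∧ par r = r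
  inhabited : ∀ m, used m → tab m ≠ 0 → ∃ x < n, c x = m
  par_lt : ∀ x < n, par x < n
  link : ∀ x < n, ∀ y < n, Link (· < n) id par x y ↔ c x = c y

/-- The vertices in `A` change their cells from `c₀` to `c₁`. -/
structure Shift (n : ℕ) (used₀ used₁ A : ℕ → Prop) (c₀ c₁ : ℕ → ℕ) : Prop where
  mono : ∀ m, used₁ m → used₀ m
  used : ∀ x < n, used₁ (c₁ x)
  -- A vacated cell goes out of use for good, so its stale table entry need not be erased.
  leave : ∀ x < n, A x → ¬ used₁ (c₀ x)
  stay : ∀ x < n, ¬ A x → c₁ x = c₀ x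
  congr : ∀ x < n, ∀ y < n, c₀ x = c₀ y → c₁ x = c₁ y

/-- The tables after the vertices in `Q` have moved. -/
structure Moving (n : ℕ) (A Q : ℕ → Prop) (c₀ c₁ tab₀ par₀ pid₀ tab par pid : ℕ → ℕ) (f : ℕ) :
    Prop where
  sub : ∀ x, Q x → x < n ∧ A x
  keep : ∀ m, tab₀ m ≠ 0 → tab m = tab₀ m
  fresh : ∀ m, tab m ≠ 0 → tab₀ m ≠ 0 ∨ ∃ r, Q r ∧ tab m = r + 1 ∧ c₁ r = m ∧ tab₀ (c₀ r) = r + 1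
  done : ∀ x, Q x → tab₀ (c₀ x) = x + 1 → ∃ r < n, tab (c₁ x) = r + 1 ∧ c₁ r = c₁ x ∧ par r = r ∧
    (r = x ∨ par x = r ∧ pid x = f)
  same : ∀ x, ¬ (Q x ∧ tab₀ (c₀ x) = x + 1) → par x = par₀ x ∧ pid x = pid₀ x
  pid_or : ∀ x, pid x = pid₀ x ∨ pid x = f

section moving

variable {n : ℕ} {used₀ used₁ A Q : ℕ → Prop} {c₀ c₁ tab₀ par₀ pid₀ tab par pid : ℕ → ℕ} {f : ℕ}

theorem Moving.start : Moving n A (fun _ => False) c₀ c₁ tab₀ par₀ pid₀ tab₀ par₀ pid₀ f :=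
  ⟨fun _ h => h.elim, fun _ _ => rfl, fun _ h => Or.inl h, fun _ h => h.elim,
    fun _ _ => ⟨rfl, rfl⟩, fun _ => Or.inl rfl⟩

theorem Moving.congr {Q' : ℕ → Prop} (h : Moving n A Q c₀ c₁ tab₀ par₀ pid₀ tab par pid f)
    (hQ : ∀ x, Q' x ↔ Q x) : Moving n A Q' c₀ c₁ tab₀ par₀ pid₀ tab par pid f := by
  obtain rfl : Q' = Q := funext fun x => propext (hQ x)
  exact h

variable (hC : Cells n used₀ c₀ tab₀ par₀) (hS : Shift n used₀ used₁ A c₀ c₁)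
include hC

theorem Cells.tab_ne_zero {x : ℕ} (hx : x < n) : tab₀ (c₀ x) ≠ 0 := by
  obtain ⟨r, -, h, -⟩ := hC.rep x hx
  omega

theorem Cells.par_rep {x : ℕ} (hx : x < n) (h : tab₀ (c₀ x) = x + 1) : par₀ x = x := by
  obtain ⟨r, -, h', -, h''⟩ := hC.rep x hx
  obtain rfl : r = x := by omega
  exact h''

include hS

/-- The old representative of a cell that stays in use does not move. -/
theorem Shift.rep_stays {m s : ℕ} (hm : used₁ m) (h : tab₀ m = s + 1) :
    s < n ∧ c₀ s = m ∧ par₀ s = s ∧ ¬ A s ∧ c₁ s = m := by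
  obtain ⟨z, hz, rfl⟩ := hC.inhabited m (hS.mono m hm) (by omega)
  obtain ⟨r, hr, h1, h2, h3⟩ := hC.rep z hz
  obtain rfl : r = s := by omega
  have hA : ¬ A r := fun hA => hS.leave r hr hA (h2 ▸ hm)
  exact ⟨hr, h2, h3, hA, (hS.stay r hr hA).trans h2⟩

variable (hM : Moving n A Q c₀ c₁ tab₀ par₀ pid₀ tab par pid f)
include hM

/-- What is found in the table at the destination of a vertex. -/
theorem Moving.target {x s : ℕ} (hx : x < n) (h : tab (c₁ x) = s + 1) :
    s < n ∧ c₁ s = c₁ x ∧ par s = s ∧ (A s → Q s) := by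
  rcases hM.fresh (c₁ x) (by omega) with h0 | ⟨r, hQ, hr, hrx, hrep⟩
  · have h1 := hM.keep _ h0
    obtain ⟨h2, h3, h4, h5, h6⟩ := hS.rep_stays hC (hS.used x hx) (by rw [← h1, h])
    refine ⟨h2, h6, ?_, fun hA => absurd hA h5⟩
    rw [(hM.same s fun hQ => h5 (hM.sub s hQ.1).2).1, h4]
  · obtain rfl : r = s := by omega
    obtain ⟨r', h1, h2, h3, h4, -⟩ := hM.done r hQ hrep
    rw [hrx] at h2
    obtain rfl : r' = r := by omega
    exact ⟨h1, hrx, h4, fun _ => hQ⟩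

-- A vertex that does not represent its cell needs no treatment: its links in `par` to the old
-- representative carry it along.
omit hS in
theorem Moving.skip {x : ℕ} (hx : x < n) (hA : A x) (h : tab (c₀ x) ≠ x + 1) :
    Moving n A (fun y => Q y ∨ y = x) c₀ c₁ tab₀ par₀ pid₀ tab par pid f := by
  have h0 : tab₀ (c₀ x) ≠ x + 1 := by
    rwa [hM.keep _ (hC.tab_ne_zero hx)] at h
  refine ⟨?_, hM.keep, fun m hm => ?_, ?_, fun y hy => ?_, hM.pid_or⟩
  · rintro y (hy | rfl)
    · exact hM.sub y hy
    · exact ⟨hx, hA⟩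
  · rcases hM.fresh m hm with h1 | ⟨r, h1, h2⟩
    · exact Or.inl h1
    · exact Or.inr ⟨r, Or.inl h1, h2⟩
  · rintro y (hy | rfl) hrep
    · exact hM.done y hy hrep
    · exact absurd hrep h0
  · exact hM.same y fun hy' => hy ⟨Or.inl hy'.1, hy'.2⟩

omit hS in
theorem Moving.insert {x : ℕ} (hx : x < n) (hA : A x) (hQx : ¬ Q x) (h : tab (c₀ x) = x + 1)
    (h0 : tab (c₁ x) = 0) :
    Moving n A (fun y => Q y ∨ y = x) c₀ c₁ tab₀ par₀ pid₀ (Function.update tab (c₁ x) (x + 1))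
      par pid f := by
  have hrep : tab₀ (c₀ x) = x + 1 := by
    rwa [hM.keep _ (hC.tab_ne_zero hx)] at h
  have hpar : par x = x := by
    rw [(hM.same x fun h => hQx h.1).1, hC.par_rep hx hrep]
  refine ⟨?_, fun m hm => ?_, fun m hm => ?_, ?_, fun y hy => ?_, hM.pid_or⟩
  · rintro y (hy | rfl)
    · exact hM.sub y hy
    · exact ⟨hx, hA⟩
  · have := hM.keep m hm
    rw [Function.update_of_ne, this]
    rintro rfl
    omega
  · by_cases hmx : m = c₁ x
    · exact Or.inr ⟨x, Or.inr rfl, by rw [hmx, Function.update_self], hmx.symm, hrep⟩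
    · rw [Function.update_of_ne hmx] at hm ⊢
      rcases hM.fresh m hm with h1 | ⟨r, h1, h2⟩
      · exact Or.inl h1
      · exact Or.inr ⟨r, Or.inl h1, h2⟩
  · rintro y (hy | rfl) hrep'
    · obtain ⟨r, h1, h2, h3⟩ := hM.done y hy hrep'
      refine ⟨r, h1, ?_, h3⟩
      rw [Function.update_of_ne, h2]
      intro he
      rw [he] at h2
      omega
    · exact ⟨y, hx, Function.update_self _ _ _, rfl, hpar, Or.inl rfl⟩
  · exact hM.same y fun hy' => hy ⟨Or.inl hy'.1, hy'.2⟩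

/-- The moving representative was a root of `par`, so redirecting it to the representative of the
destination unites two classes without destroying a link. The label `f` records the edge
responsible. -/
theorem Moving.join {x : ℕ} (hx : x < n) (hA : A x) (hQx : ¬ Q x) (h : tab (c₀ x) = x + 1)
    (h0 : tab (c₁ x) ≠ 0) :
    Moving n A (fun y => Q y ∨ y = x) c₀ c₁ tab₀ par₀ pid₀ tab
      (Function.update par x (tab (c₁ x) - 1)) (Function.update pid x f) f := by
  have hrep : tab₀ (c₀ x) = x + 1 := by
    rwa [hM.keep _ (hC.tab_ne_zero hx)] at h
  obtain ⟨s, hs⟩ : ∃ s, tab (c₁ x) = s + 1 := ⟨tab (c₁ x) - 1, by omega⟩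
  rw [hs, Nat.add_sub_cancel]
  refine ⟨?_, hM.keep, fun m hm => ?_, ?_, fun y hy => ?_, fun y => ?_⟩
  · rintro y (hy | rfl)
    · exact hM.sub y hy
    · exact ⟨hx, hA⟩
  · rcases hM.fresh m hm with h1 | ⟨r, h1, h2⟩
    · exact Or.inl h1
    · exact Or.inr ⟨r, Or.inl h1, h2⟩
  · rintro y (hy | rfl) hrep'
    · obtain ⟨r, h1, h2, h3, h4, h5⟩ := hM.done y hy hrep'
      -- A representative in a destination either did not have to move or has moved already, while
      -- `x` is only about to move. So the roots found earlier remain roots.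
      have hrx : r ≠ x := by
        rintro rfl
        exact hQx ((hM.target hC hS (hM.sub y hy).1 h2).2.2.2 hA)
      have hyx : y ≠ x := by
        rintro rfl
        exact hQx hy
      refine ⟨r, h1, h2, h3, by rwa [Function.update_of_ne hrx], ?_⟩
      rwa [Function.update_of_ne hyx, Function.update_of_ne hyx]
    · obtain ⟨h1, h2, h3, h4⟩ := hM.target hC hS hx hs
      have hsy : s ≠ y := by
        rintro rfl
        exact hQx (h4 hA)
      exact ⟨s, h1, hs, h2, by rwa [Function.update_of_ne hsy], Or.inr (by simp)⟩
  · have hyx : y ≠ x := by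
      rintro rfl
      exact hy ⟨Or.inr rfl, hrep⟩
    rw [Function.update_of_ne hyx, Function.update_of_ne hyx]
    exact hM.same y fun hy' => hy ⟨Or.inl hy'.1, hy'.2⟩
  · by_cases hyx : y = x
    · exact Or.inr (by simp [hyx])
    · rw [Function.update_of_ne hyx]
      exact hM.pid_or y

theorem Moving.par_cell {x : ℕ} (hx : x < n) : par x < n ∧ c₁ (par x) = c₁ x := by
  by_cases h : Q x ∧ tab₀ (c₀ x) = x + 1
  · obtain ⟨r, h1, h2, h3, h4, rfl | h5⟩ := hM.done x h.1 h.2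
    · rw [h4]
      exact ⟨h1, rfl⟩
    · rw [h5.1]
      exact ⟨h1, h3⟩
  · rw [(hM.same x h).1]
    have hp := hC.par_lt x hx
    exact ⟨hp, hS.congr _ hp _ hx ((hC.link _ hp _ hx).1 (Link.edge (j := x) hx).symm)⟩

omit hS in
/-- Only loops change. -/
theorem Moving.changed {x : ℕ} (hx : x < n) :
    (par x = par₀ x ∧ pid x = pid₀ x) ∨ (par₀ x = x ∧ (par x = x ∧ pid x = pid₀ x ∨ pid x = f)) := by
  by_cases h : Q x ∧ tab₀ (c₀ x) = x + 1
  · refine Or.inr ⟨hC.par_rep hx h.2, ?_⟩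
    obtain ⟨r, h1, h2, h3, h4, rfl | h5⟩ := hM.done x h.1 h.2
    · exact (hM.pid_or r).imp_left fun h5 => ⟨h4, h5⟩
    · exact Or.inr h5.2
  · exact Or.inl (hM.same x h)

omit hS in
theorem Moving.link_of_link {x y : ℕ} (h : Link (· < n) id par₀ x y) : Link (· < n) id par x y := by
  refine h.mono fun j hj => ?_
  rcases hM.changed hC hj with h1 | h1
  · exact Or.inr ⟨hj, rfl, h1.1⟩
  · exact Or.inl h1.1.symm

/-- When all affected vertices have moved, every old class hangs below the representative of its new
cell, so cells and classes of `par` agree again. -/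
theorem Moving.cells (hQ : ∀ x < n, A x → Q x) : Cells n used₁ c₁ tab par := by
  have hrep : ∀ x < n, ∃ r < n, tab (c₁ x) = r + 1 ∧ c₁ r = c₁ x ∧ par r = r ∧
      Link (· < n) id par x r := by
    intro x hx
    obtain ⟨r, hr, h1, h2, h3⟩ := hC.rep x hx
    have hl := hM.link_of_link hC ((hC.link x hx r hr).2 h2.symm)
    have h2' := hS.congr r hr x hx h2
    by_cases hA : A r
    · obtain ⟨s, hs, k1, k2, k3, k4⟩ := hM.done r (hQ r hr hA) (by rw [h2, h1])
      refine ⟨s, hs, by rw [← h2', k1], k2.trans h2', k3, hl.trans _ _ _ ?_⟩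
      rcases k4 with rfl | k4
      · exact EqvGen.refl _
      · rw [← k4.1]
        exact Link.edge (j := r) hr
    · have hc := hS.stay r hr hA
      refine ⟨r, hr, ?_, h2', ?_, hl⟩
      · rw [← h2', hc, h2, hM.keep _ (by omega), h1]
      · rw [(hM.same r fun h => hA (hM.sub r h.1).2).1, h3]
  refine ⟨fun x hx => ?_, fun m hm h0 => ?_, fun x hx => (hM.par_cell hC hS hx).1,
    fun x hx y hy => ⟨fun h => ?_, fun h => ?_⟩⟩
  · obtain ⟨r, hr, h1, h2, h3, -⟩ := hrep x hx
    exact ⟨r, hr, h1, h2, h3⟩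
  · rcases hM.fresh m h0 with h1 | ⟨r, h1, h2, h3, -⟩
    · obtain ⟨s, hs⟩ : ∃ s, tab₀ m = s + 1 := ⟨tab₀ m - 1, by omega⟩
      obtain ⟨h2, -, -, -, h3⟩ := hS.rep_stays hC hm hs
      exact ⟨s, h2, h3⟩
    · exact ⟨r, (hM.sub r h1).1, h3⟩
  · have := h.invariant (fun z => if z < n then c₁ z else c₁ x) fun j hj => by
      obtain ⟨h1, h2⟩ := hM.par_cell hC hS hj
      simp [h1, h2, show j < n from hj]
    simpa [hx, hy] using this
  · obtain ⟨r, hr, h1, -, -, h2⟩ := hrep x hx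
    obtain ⟨s, hs, h3, -, -, h4⟩ := hrep y hy
    rw [h] at h1
    obtain rfl : r = s := by omega
    exact h2.trans _ _ _ h4.symm

end moving

/-! ### Merging two flow trees -/

/-- The cell of the vertex `x`, of which `x` and `x + n` are two copies. -/
def cell (n : ℕ) (ad : ℕ → ℕ → ℕ) (lab : ℕ → ℕ) (x : ℕ) : ℕ := ad (lab x) (lab (x + n))

def UsedCell (n : ℕ) (ad : ℕ → ℕ → ℕ) (lab : ℕ → ℕ) (m : ℕ) : Prop :=
  ∃ y < 2 * n, ∃ z < 2 * n, m = ad (lab y) (lab z)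

/-- The state after the first `a` edges in the order `p` have been inserted. -/
structure Family.RoundInv {n k : ℕ} (D : Family n k) (ad : ℕ → ℕ → ℕ) (eu ev ei p : ℕ → ℕ) (a : ℕ)
    (lab tab par pid : ℕ → ℕ) : Prop where
  lab_lt : ∀ z < 2 * n, lab z < 2 * n
  lab_iff : ∀ z < 2 * n, ∀ w < 2 * n,
    lab z = lab w ↔ Link (fun j => ∃ a' < a, p a' = j) eu ev z w
  cells : Cells n (UsedCell n ad lab) (cell n ad lab) tab par
  pid_mem : ∀ x < n, (par x = x ∧ pid x = 0) ∨ ∃ a' < a, pid x = ei (p a')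
  -- This is the purpose of a round: above every threshold, the new forest connects exactly the
  -- pairs that are connected in both copies.
  up : ∀ P, D.UpClosed P → ∀ x < n, ∀ y < n, Link (fun j => j < n ∧ P (pid j)) id par x y ↔
    Link (fun j => (∃ a' < a, p a' = j) ∧ P (ei j)) eu ev x y ∧
    Link (fun j => (∃ a' < a, p a' = j) ∧ P (ei j)) eu ev (x + n) (y + n)

/-- Every edge joins two vertices of the same copy of the vertex set. -/
def TwoSided (n M : ℕ) (eu ev : ℕ → ℕ) : Prop :=
  ∀ j < M, (eu j < n ∧ ev j < n) ∨ (n ≤ eu j ∧ eu j < 2 * n ∧ n ≤ ev j ∧ ev j < 2 * n)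

/-- Distinct pairs of labels have distinct cells. -/
def CellInj (N : ℕ) (ad : ℕ → ℕ → ℕ) : Prop :=
  ∀ a < N, ∀ b < N, ∀ a' < N, ∀ b' < N, ad a b = ad a' b' → a = a' ∧ b = b'

section round

variable {n k M a : ℕ} {D : Family n k} {ad : ℕ → ℕ → ℕ}
  {eu ev ei p lab tab par pid lab' tab' par' pid' : ℕ → ℕ}
  (hE : TwoSided n M eu ev) (hp : ∀ a < M, p a < M) (had : CellInj (2 * n) ad)

include had in
theorem cell_eq_iff (hlt : ∀ z < 2 * n, lab z < 2 * n) {x y : ℕ} (hx : x < n) (hy : y < n) :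
    cell n ad lab x = cell n ad lab y ↔ lab x = lab y ∧ lab (x + n) = lab (y + n) :=
  ⟨fun h => had _ (hlt _ (by omega)) _ (hlt _ (by omega)) _ (hlt _ (by omega)) _
    (hlt _ (by omega)) h, fun h => by rw [cell, cell, h.1, h.2]⟩

theorem Family.RoundInv.start (hlab : ∀ z < 2 * n, lab z = z) (hpar : ∀ x < n, par x = x)
    (hpid : ∀ x < n, pid x = 0) (had : CellInj (2 * n) ad)
    (htab : ∀ x < n, tab (ad x (x + n)) = x + 1)
    (htab' : ∀ y < 2 * n, ∀ z < 2 * n, tab (ad y z) ≠ 0 → ∃ x < n, ad y z = ad x (x + n)) :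
    D.RoundInv ad eu ev ei p 0 lab tab par pid := by
  have hl : ∀ {J : ℕ → Prop} {u v : ℕ → ℕ} {x y : ℕ}, (∀ j, J j → u j = v j) →
      (Link J u v x y ↔ x = y) := fun hJ =>
    ⟨fun h => h.invariant _root_.id hJ, fun h => h ▸ EqvGen.refl _⟩
  have hpar' : ∀ j, j < n → _root_.id j = par j := fun j hj => (hpar j hj).symm
  have hc : ∀ x < n, cell n ad lab x = ad x (x + n) := fun x hx => by
    rw [cell, hlab x (by omega), hlab (x + n) (by omega)]
  refine ⟨fun z hz => by rwa [hlab z hz], fun z hz w hw => ?_, ⟨fun x hx => ?_, ?_, ?_, ?_⟩,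
    fun x hx => Or.inl ⟨hpar x hx, hpid x hx⟩, fun P _ x hx y hy => ?_⟩
  · rw [hlab z hz, hlab w hw, hl (by simp)]
  · exact ⟨x, hx, by rw [hc x hx, htab x hx], rfl, hpar x hx⟩
  · rintro m ⟨y, hy, z, hz, rfl⟩ h
    rw [hlab y hy, hlab z hz] at h ⊢
    obtain ⟨x, hx, h⟩ := htab' y hy z hz h
    exact ⟨x, hx, by rw [hc x hx, h]⟩
  · intro x hx
    rwa [hpar x hx]
  · intro x hx y hy
    rw [hl hpar', cell_eq_iff had (fun z hz => by rwa [hlab z hz]) hx hy, hlab x (by omega),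
      hlab y (by omega), hlab (x + n) (by omega), hlab (y + n) (by omega)]
    omega
  · rw [hl fun j hj => hpar' j hj.1, hl (by simp), hl (by simp)]
    omega

-- No edge runs between the copies, so a label belongs to one copy only. Renaming a label therefore
-- changes at most one coordinate of the cell of any vertex.
include hE hp in
theorem Family.RoundInv.side (h : D.RoundInv ad eu ev ei p a lab tab par pid) (ha : a ≤ M) {z w : ℕ}
    (hz : z < 2 * n) (hw : w < 2 * n) (hzw : lab z = lab w) : z < n ↔ w < n := by
  have := ((h.lab_iff z hz w hw).1 hzw).invariant (fun z => (z < n : Prop)) fun j hj => by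
    obtain ⟨a', ha', rfl⟩ := hj
    have := hE (p a') (hp a' (by omega))
    exact propext (by omega)
  exact this.to_iff

-- New links carry the current label, which is the smallest so far. A threshold that excludes this
-- label sees no change, and one that includes it admits all inserted edges, where the claim reduces
-- to the correctness of the cells.
include hE hp had in
theorem Family.RoundInv.step (h : D.RoundInv ad eu ev ei p a lab tab par pid) (ha : a < M)
    (hsort : ∀ a' < a, D.key (ei (p a)) ≤ D.key (ei (p a')))
    (hlt' : ∀ z < 2 * n, lab' z < 2 * n)
    (hlab' : ∀ z < 2 * n, ∀ w < 2 * n, lab' z = lab' w ↔ lab z = lab w ∨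
      (lab z = lab (eu (p a)) ∧ lab w = lab (ev (p a))) ∨
      (lab z = lab (ev (p a)) ∧ lab w = lab (eu (p a))))
    (hC : Cells n (UsedCell n ad lab') (cell n ad lab') tab' par')
    (hch : ∀ x < n, (par' x = par x ∧ pid' x = pid x) ∨
      (par x = x ∧ (par' x = x ∧ pid' x = pid x ∨ pid' x = ei (p a)))) :
    D.RoundInv ad eu ev ei p (a + 1) lab' tab' par' pid' := by
  have hJ : ∀ j, (∃ a' < a + 1, p a' = j) ↔ (∃ a' < a, p a' = j) ∨ j = p a := by
    intro j
    constructor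
    · rintro ⟨a', h1, rfl⟩
      by_cases he : a' = a
      · exact Or.inr (by rw [he])
      · exact Or.inl ⟨a', by omega, rfl⟩
    · rintro (⟨a', h1, rfl⟩ | rfl)
      · exact ⟨a', by omega, rfl⟩
      · exact ⟨a, by omega, rfl⟩
  have hiff : ∀ z < 2 * n, ∀ w < 2 * n,
      lab' z = lab' w ↔ Link (fun j => ∃ a' < a + 1, p a' = j) eu ev z w := by
    refine link_insert (fun j hj => ?_) hJ h.lab_iff hlab'
    obtain ⟨a', h1, rfl⟩ := hj
    have := hE (p a') (hp a' (by omega))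
    omega
  have hmem : ∀ x < n, (par' x = x ∧ pid' x = 0) ∨ ∃ a' < a + 1, pid' x = ei (p a') := by
    intro x hx
    rcases hch x hx with ⟨h1, h2⟩ | ⟨h1, ⟨h2, h3⟩ | h2⟩
    · rw [h1, h2]
      exact (h.pid_mem x hx).imp_right fun ⟨a', h3, h4⟩ => ⟨a', by omega, h4⟩
    · rw [h2, h3]
      exact (h.pid_mem x hx).imp (fun h4 => ⟨rfl, h4.2⟩) fun ⟨a', h3, h4⟩ => ⟨a', by omega, h4⟩
    · exact Or.inr ⟨a, by omega, h2⟩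
  refine ⟨hlt', hiff, hC, hmem, fun P hP x hx y hy => ?_⟩
  -- If the current label is admitted, so are all earlier ones by sortedness, and the threshold
  -- imposes no restriction on inserted edges.
  by_cases hPa : P (ei (p a))
  · have hall : ∀ a' < a + 1, P (ei (p a')) := fun a' ha' => by
      by_cases he : a' = a
      · rwa [he]
      · exact hP _ _ hPa (hsort a' (by omega))
    have e : (fun j => (∃ a' < a + 1, p a' = j) ∧ P (ei j)) = fun j => ∃ a' < a + 1, p a' = j := by
      funext j
      refine propext ⟨fun h => h.1, fun h => ⟨h, ?_⟩⟩
      obtain ⟨a', h1, rfl⟩ := h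
      exact hall a' h1
    rw [e, ← hiff x (by omega) y (by omega), ← hiff (x + n) (by omega) (y + n) (by omega),
      ← cell_eq_iff had hlt' hx hy, ← hC.link x hx y hy]
    constructor
    · exact fun hl => hl.mono fun j hj => Or.inr ⟨hj.1, rfl, rfl⟩
    · refine fun hl => hl.mono fun j hj => ?_
      rcases hmem j hj with h1 | ⟨a', h1, h2⟩
      · exact Or.inl h1.1.symm
      · exact Or.inr ⟨⟨hj, h2 ▸ hall a' h1⟩, rfl, rfl⟩
  · have e : (fun j => (∃ a' < a + 1, p a' = j) ∧ P (ei j)) =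
        fun j => (∃ a' < a, p a' = j) ∧ P (ei j) := by
      funext j
      rw [hJ]
      refine propext ⟨?_, fun h => ⟨Or.inl h.1, h.2⟩⟩
      rintro ⟨h1 | rfl, h2⟩
      · exact ⟨h1, h2⟩
      · exact absurd h2 hPa
    rw [e, ← h.up P hP x hx y hy]
    constructor
    · refine fun hl => hl.mono fun j hj => ?_
      rcases hch j hj.1 with ⟨h1, h2⟩ | ⟨h1, ⟨h2, h3⟩ | h2⟩
      · exact Or.inr ⟨⟨hj.1, h2 ▸ hj.2⟩, rfl, h1.symm⟩
      · exact Or.inl h2.symm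
      · exact absurd (h2 ▸ hj.2) hPa
    · refine fun hl => hl.mono fun j hj => ?_
      rcases hch j hj.1 with ⟨h1, h2⟩ | ⟨h1, h2⟩
      · exact Or.inr ⟨⟨hj.1, h2.symm ▸ hj.2⟩, rfl, h1⟩
      · exact Or.inl h1.symm

-- After the renaming no vertex has the label `X`, so precisely the cells with a coordinate `X` go
-- out of use. All remaining pairs of labels already existed.
include had in
theorem shift_relabel {X Y : ℕ} (hlt : ∀ z < 2 * n, lab z < 2 * n) (hXY : X ≠ Y)
    (hY : ∃ w < 2 * n, lab w = Y) :
    Shift n (UsedCell n ad lab) (UsedCell n ad (relabel X Y lab))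
      (fun x => lab x = X ∨ lab (x + n) = X) (cell n ad lab) (cell n ad (relabel X Y lab)) := by
  obtain ⟨w, hw, rfl⟩ := hY
  have hre : ∀ y < 2 * n, ∃ y' < 2 * n, relabel X (lab w) lab y = lab y' := by
    intro y hy
    rw [relabel]
    split_ifs
    · exact ⟨w, hw, rfl⟩
    · exact ⟨y, hy, rfl⟩
  have hne : ∀ y, relabel X (lab w) lab y ≠ X := by
    intro y
    rw [relabel]
    split_ifs with h
    · exact hXY.symm
    · exact h
  refine ⟨?_, fun x hx => ⟨x, by omega, x + n, by omega, rfl⟩, ?_, ?_, fun x hx y hy h => ?_⟩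
  · rintro m ⟨y, hy, z, hz, rfl⟩
    obtain ⟨y', hy', h1⟩ := hre y hy
    obtain ⟨z', hz', h2⟩ := hre z hz
    exact ⟨y', hy', z', hz', by rw [h1, h2]⟩
  · rintro x hx hA ⟨y, hy, z, hz, h⟩
    obtain ⟨y', hy', h1⟩ := hre y hy
    obtain ⟨z', hz', h2⟩ := hre z hz
    have h3 := hne y
    have h4 := hne z
    rw [h1] at h3
    rw [h2] at h4
    rw [h1, h2] at h
    obtain ⟨h5, h6⟩ := had _ (hlt _ (by omega)) _ (hlt _ (by omega)) _ (hlt _ hy') _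
      (hlt _ hz') h
    omega
  · intro x hx hA
    rw [not_or] at hA
    rw [cell, cell, relabel, relabel, if_neg hA.1, if_neg hA.2]
  · obtain ⟨h1, h2⟩ := (cell_eq_iff had hlt hx hy).1 h
    simp only [cell, relabel, h1, h2]

/-- The insertion of all edges of a flow tree and of the next tree gives a flow tree. -/
theorem Family.RoundInv.flow {i : ℕ} {u v e : ℕ → ℕ}
    (h : D.RoundInv ad eu ev ei p (n + (n - 1)) lab tab par pid) (hi : i < k)
    (hF : D.Flow i eu ev ei)
    (hp : ∀ j, (∃ a < n + (n - 1), p a = j) ↔ j < n + (n - 1))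
    (htree : ∀ j < n - 1, eu (n + j) = D.U (i * (n - 1) + j) + n ∧
      ev (n + j) = D.V (i * (n - 1) + j) + n ∧ ei (n + j) = i * (n - 1) + j)
    (hu : ∀ j < n, u j = j) (hv : ∀ j < n, v j = par j) (he : ∀ j < n, e j = pid j) :
    D.Flow (i + 1) u v e := by
  have hk : (i + 1) * (n - 1) ≤ k * (n - 1) := Nat.mul_le_mul_right _ hi
  have hi1 : (i + 1) * (n - 1) = i * (n - 1) + (n - 1) := by ring
  have hei : ∀ j < n + (n - 1), ei j ≤ k * (n - 1) := by
    intro j hj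
    by_cases hjn : j < n
    · exact (hF.lt j hjn).2.2
    · obtain ⟨j', rfl⟩ : ∃ j', j = n + j' := ⟨j - n, by omega⟩
      rw [(htree j' (by omega)).2.2]
      omega
  refine ⟨?_, fun j hj => ?_, fun P hP x hx y hy => ?_⟩
  · obtain ⟨r, hr, -, -, h1⟩ := h.cells.rep 0 D.n_pos
    exact ⟨r, hr, by rw [hu r hr, hv r hr, h1]⟩
  · rw [hu j hj, hv j hj, he j hj]
    refine ⟨hj, h.cells.par_lt j hj, ?_⟩
    rcases h.pid_mem j hj with h1 | ⟨a, ha, h1⟩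
    · omega
    · rw [h1]
      exact hei _ ((hp _).1 ⟨a, ha, rfl⟩)
  have e1 : Link (fun j => j < n ∧ P (e j)) u v x y ↔
      Link (fun j => j < n ∧ P (pid j)) _root_.id par x y := by
    constructor
    · exact fun hl => hl.mono fun j hj => Or.inr ⟨⟨hj.1, he j hj.1 ▸ hj.2⟩, (hu j hj.1).symm,
        (hv j hj.1).symm⟩
    · exact fun hl => hl.mono fun j hj => Or.inr ⟨⟨hj.1, (he j hj.1).symm ▸ hj.2⟩, hu j hj.1,
        hv j hj.1⟩
  simp only [e1, h.up P hP x hx y hy, hp]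
  have e2 : Link (fun j => j < n + (n - 1) ∧ P (ei j)) eu ev x y ↔
      Link (fun j => j < n ∧ P (ei j)) eu ev x y := by
    constructor
    · intro hl
      -- Collapsing the second copy to the vertex 0 turns its edges into loops, so they do not help
      -- to connect vertices of the first copy.
      have := eqvGen_map (s := fun a b => ∃ j, (j < n ∧ P (ei j)) ∧ eu j = a ∧ ev j = b)
        (fun z => if z < n then z else 0) ?_ hl
      · simp only [hx, hy, if_true] at this
        exact this
      · rintro _ _ ⟨j, ⟨h1, h2⟩, rfl, rfl⟩
        by_cases hjn : j < n
        · obtain ⟨h3, h4, -⟩ := hF.lt j hjn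
          simp only [h3, h4, if_true]
          exact EqvGen.rel _ _ ⟨j, ⟨hjn, h2⟩, rfl, rfl⟩
        · obtain ⟨j', rfl⟩ : ∃ j', j = n + j' := ⟨j - n, by omega⟩
          obtain ⟨h3, h4, -⟩ := htree j' (by omega)
          rw [if_neg (by omega), if_neg (by omega)]
          exact EqvGen.refl _
    · exact fun hl => hl.mono fun j hj => Or.inr ⟨⟨by omega, hj.2⟩, rfl, rfl⟩
  have e3 : Link (fun j => j < n + (n - 1) ∧ P (ei j)) eu ev (x + n) (y + n) ↔
      Link (fun f => i * (n - 1) ≤ f ∧ f < (i + 1) * (n - 1) ∧ P f) D.U D.V x y := by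
    constructor
    · intro hl
      -- Truncated subtraction of n shifts the second copy back and collapses the first one to 0.
      have := eqvGen_map (s := fun a b => ∃ f, (i * (n - 1) ≤ f ∧ f < (i + 1) * (n - 1) ∧ P f) ∧
        D.U f = a ∧ D.V f = b) (fun z => z - n) ?_ hl
      · simp only [Nat.add_sub_cancel] at this
        exact this
      · rintro _ _ ⟨j, ⟨h1, h2⟩, rfl, rfl⟩
        by_cases hjn : j < n
        · obtain ⟨h3, h4, -⟩ := hF.lt j hjn
          simp only [show eu j - n = 0 by omega, show ev j - n = 0 by omega]
          exact EqvGen.refl _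
        · obtain ⟨j', rfl⟩ : ∃ j', j = n + j' := ⟨j - n, by omega⟩
          obtain ⟨h3, h4, h5⟩ := htree j' (by omega)
          rw [h5] at h2
          exact EqvGen.rel _ _ ⟨i * (n - 1) + j', ⟨by omega, by omega, h2⟩, by omega, by omega⟩
    · intro hl
      refine eqvGen_map (fun z => z + n) ?_ hl
      rintro _ _ ⟨f, ⟨h1, h2, h3⟩, rfl, rfl⟩
      obtain ⟨j', rfl⟩ : ∃ j', f = i * (n - 1) + j' := ⟨f - i * (n - 1), by omega⟩
      obtain ⟨h4, h5, h6⟩ := htree j' (by omega)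
      exact EqvGen.rel _ _ ⟨n + j', ⟨by omega, by rwa [h6]⟩, h4, h5⟩
  rw [e2, e3, hF.link P hP x hx y hy, D.link_tree hi P hx hy]
  constructor
  · rintro ⟨h1, h2⟩ f hf hs
    by_cases hfi : f < i * (n - 1)
    · exact h1 f hfi hs
    · exact h2 f (by omega) hf hs
  · intro h1
    exact ⟨fun f hf => h1 f (by omega), fun f _ hf => h1 f hf⟩

/-- Some elements with label `X` have already got the label `Y`. -/
def PartlyRelabelled (n X Y : ℕ) (lab l : ℕ → ℕ) : Prop :=
  ∀ w < 2 * n, l w = lab w ∨ (lab w = X ∧ l w = Y)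

/-- The vertices whose cells have changed. -/
def Relabelled (n : ℕ) (lab l : ℕ → ℕ) (x : ℕ) : Prop :=
  x < n ∧ (l x ≠ lab x ∨ l (x + n) ≠ lab (x + n))

/-- Only one copy of `x` has the label `X`, so `x` is met once: immediately before, its cell is the
original one, and immediately after, it is the final one. -/
theorem PartlyRelabelled.next {X Y z x : ℕ} {l : ℕ → ℕ} (h : PartlyRelabelled n X Y lab l)
    (hXY : X ≠ Y) (hside : ∀ x < n, ¬ (lab x = X ∧ lab (x + n) = X)) (hz : l z = X) (hx : x < n)
    (hzx : z = x ∨ z = x + n) :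
    (lab x = X ∨ lab (x + n) = X) ∧ ¬ Relabelled n lab l x ∧ cell n ad l x = cell n ad lab x ∧
      cell n ad (Function.update l z Y) x = cell n ad (relabel X Y lab) x ∧
      PartlyRelabelled n X Y lab (Function.update l z Y) ∧
      ∀ y, Relabelled n lab (Function.update l z Y) y ↔ Relabelled n lab l y ∨ y = x := by
  have h1 := h x (by omega)
  have h2 := h (x + n) (by omega)
  have h3 := hside x hx
  have hz2 : z < 2 * n := by omega
  have hlz : lab z = X := by
    rcases h z hz2 with h4 | h4
    · rw [← h4, hz]
    · exact h4.1
  have hl : l x = lab x ∧ l (x + n) = lab (x + n) := by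
    rcases hzx with rfl | rfl <;> omega
  refine ⟨by rcases hzx with rfl | rfl <;> simp [hlz], ?_, by rw [cell, cell, hl.1, hl.2], ?_, ?_,
    fun y => ?_⟩
  · simp [Relabelled, hl.1, hl.2]
  · simp only [cell, relabel]
    rcases hzx with rfl | rfl
    · rw [Function.update_self, Function.update_of_ne (by omega), if_pos hlz, hl.2,
        if_neg fun h4 => h3 ⟨hlz, h4⟩]
    · rw [Function.update_self, Function.update_of_ne (by omega), if_pos hlz, hl.1,
        if_neg fun h4 => h3 ⟨h4, hlz⟩]
  · intro w hw
    by_cases hwz : w = z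
    · rw [hwz, Function.update_self]
      exact Or.inr ⟨hlz, rfl⟩
    · rw [Function.update_of_ne hwz]
      exact h w hw
  · by_cases hyx : y = x
    · subst hyx
      simp only [Relabelled, hx, true_and, or_true, iff_true]
      rcases hzx with rfl | rfl
      · left
        rw [Function.update_self, hlz]
        exact hXY.symm
      · right
        rw [Function.update_self, hlz]
        exact hXY.symm
    · simp only [Relabelled, hyx, or_false]
      constructor
      · rintro ⟨h4, h5⟩
        rw [Function.update_of_ne (by omega), Function.update_of_ne (by omega)] at h5
        exact ⟨h4, h5⟩
      · rintro ⟨h4, h5⟩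
        rw [Function.update_of_ne (by omega), Function.update_of_ne (by omega)]
        exact ⟨h4, h5⟩

theorem PartlyRelabelled.finish {X Y : ℕ} {l : ℕ → ℕ} (h : PartlyRelabelled n X Y lab l)
    (hX : ∀ w < 2 * n, l w ≠ X) : ∀ w < 2 * n, l w = relabel X Y lab w := by
  intro w hw
  rw [relabel]
  have h1 := hX w hw
  rcases h w hw with h2 | h2
  · rw [if_neg (h2 ▸ h1), h2]
  · rw [if_pos h2.1, h2.2]

end round

end CutMerge

/-! ### Renaming one label on the machine. -/

namespace CutMerge

open Relation

/-! ### The program that adds a tree to a flow tree -/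

/-- The address of the cell of the vertex `x`. -/
def cellExpr : Expr :=
  (Var.i * (2 * Var.n) + .get .lab Var.x) * (2 * Var.n) + .get .lab (Var.x + Var.n)

/-- Round `i` uses its own block of (2n)² table entries. No earlier round has written there, so the
table need never be cleared; initial zeros mean that a cell has no representative. -/
def cellAddr (n i a b : ℕ) : ℕ := (i * (2 * n) + a) * (2 * n) + b

/-- Move the first element `z` of the bucket `X` to the bucket `Y`, and let `x` be the vertex of
which `z` is a copy. -/
def moveListProg : Stmt :=
  .z ::= .get .hd Var.X - 1 ;;
  .put .hd Var.X (.get .nxt Var.z) ;;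
  .put .nxt Var.z (.get .hd Var.Y) ;;
  .put .hd Var.Y (Var.z + 1) ;;
  .put .sz Var.X (.get .sz Var.X - 1) ;;
  .put .sz Var.Y (.get .sz Var.Y + 1) ;;
  .ite (.lt Var.z Var.n) (.x ::= Var.z) (.x ::= Var.z - Var.n)

/-- If `x` represents its cell, then it represents its new cell `d`, or is linked to the
representative of `d`. -/
def moveRepProg : Stmt :=
  .ite (.eq (.get .tab Var.o) (Var.x + 1))
    (.ite (.eq (.get .tab Var.d) 0)
      (.put .tab Var.d (Var.x + 1))
      (.put .par Var.x (.get .tab Var.d - 1) ;; .put .pid Var.x (.get .ei Var.e)))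
    .skip

def moveCellProg : Stmt :=
  .o ::= cellExpr ;; .put .lab Var.z Var.Y ;; .d ::= cellExpr ;; moveRepProg

def moveProg : Stmt := moveListProg ;; moveCellProg

theorem cellAddr_lt {n i a b : ℕ} (ha : a < 2 * n) (hb : b < 2 * n) :
    i * (2 * n) + a < (i + 1) * (2 * n) * (2 * n) ∧
    (i * (2 * n) + a) * (2 * n) < (i + 1) * (2 * n) * (2 * n) ∧
    cellAddr n i a b < (i + 1) * (2 * n) * (2 * n) := by
  have h3 : (i * (2 * n) + a + 1) * (2 * n) ≤ (i + 1) * (2 * n) * (2 * n) :=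
    Nat.mul_le_mul_right _ (by rw [add_mul]; omega)
  have h4 : i * (2 * n) + a ≤ (i * (2 * n) + a) * (2 * n) :=
    Nat.le_mul_of_pos_right _ (by omega)
  rw [add_mul, one_mul] at h3
  rw [cellAddr]
  omega

theorem cellInj_cellAddr (n i : ℕ) : CellInj (2 * n) (cellAddr n i) := by
  intro a ha b hb a' ha' b' hb' h
  have hn : 0 < 2 * n := by omega
  have h1 : ∀ a b, b < 2 * n → cellAddr n i a b / (2 * n) = i * (2 * n) + a := by
    intro a b hb
    rw [cellAddr, mul_comm, Nat.mul_add_div hn, Nat.div_eq_of_lt hb, add_zero]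
  have h2 := h1 a b hb
  rw [h, h1 a' b' hb'] at h2
  simp only [cellAddr] at h
  have h3 : a = a' := by omega
  subst h3
  exact ⟨rfl, by omega⟩

section move

variable {Z : ℕ} {σ : Store} {n i x z X Y : ℕ}

theorem moveList_wp (hn : σ.var .n = n) (hXv : σ.var .X = X) (hYv : σ.var .Y = Y)
    (hXY : X ≠ Y) (hX : X < 2 * n) (hY : Y < 2 * n) (hz : σ.arr .hd X = z + 1) (hx : x < n)
    (hzx : z = x ∨ z = x + n) (hsX : σ.arr .sz X ≤ 2 * n) (hsY : σ.arr .sz Y ≤ 2 * n)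
    (hZ : 2 * n + 2 < Z) :
    Wp Z moveListProg σ fun t σ' => t = 8 ∧ σ'.var .x = x ∧ σ'.var .z = z ∧
      σ'.arr .hd = Function.update (Function.update (σ.arr .hd) X (σ.arr .nxt z)) Y (z + 1) ∧
      σ'.arr .nxt = Function.update (σ.arr .nxt) z (σ.arr .hd Y) ∧
      σ'.arr .sz = Function.update (Function.update (σ.arr .sz) X (σ.arr .sz X - 1)) Y
        (σ.arr .sz Y + 1) := by
  simp [moveListProg, hn, hXv, hYv, hz, Function.update_of_ne hXY.symm]
  and_intros <;> omega

theorem moveRep_wp {o d : ℕ} {Q : ℕ → Store → Prop} (hov : σ.var .o = o) (hdv : σ.var .d = d)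
    (hxv : σ.var .x = x) (hx : x + 1 < Z) (ho : o < Z) (hd : d < Z) (he : σ.var .e < Z)
    (htab : σ.arr .tab d ≤ Z)
    (q1 : σ.arr .tab o ≠ x + 1 → Q 2 σ)
    (q2 : σ.arr .tab o = x + 1 → σ.arr .tab d = 0 → Q 3 (σ.put .tab d (x + 1)))
    (q3 : σ.arr .tab o = x + 1 → σ.arr .tab d ≠ 0 →
      Q 4 ((σ.put .par x (σ.arr .tab d - 1)).put .pid x (σ.arr .ei (σ.var .e)))) :
    Wp Z moveRepProg σ Q := by
  simp [moveRepProg, hov, hdv, hxv]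
  exact ⟨⟨ho, by omega, by omega⟩, fun h1 => ⟨⟨by omega, by omega⟩, fun h2 =>
    ⟨⟨by omega, by omega⟩, by omega, q2 h1 h2⟩, fun h2 =>
    ⟨⟨by omega, by omega, by omega⟩, by omega, by omega, by omega, q3 h1 h2⟩⟩, q1⟩

theorem moveCell_wp (hn : σ.var .n = n) (hi : σ.var .i = i) (hYv : σ.var .Y = Y)
    (hxv : σ.var .x = x) (hzv : σ.var .z = z) (hY : Y < 2 * n) (hx : x < n)
    (hzx : z = x ∨ z = x + n) (hlab : ∀ w < 2 * n, σ.arr .lab w < 2 * n) (he : σ.var .e < Z)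
    (htab : σ.arr .tab (cell n (cellAddr n i) (Function.update (σ.arr .lab) z Y) x) ≤ n)
    (hZ : (i + 1) * (2 * n) * (2 * n) + 2 * n + 2 < Z) :
    Wp Z moveCellProg σ fun t σ' => t ≤ 7 ∧
      σ'.arr .lab = Function.update (σ.arr .lab) z Y ∧
      ((σ.arr .tab (cell n (cellAddr n i) (σ.arr .lab) x) ≠ x + 1 ∧
          σ'.arr .tab = σ.arr .tab ∧ σ'.arr .par = σ.arr .par ∧ σ'.arr .pid = σ.arr .pid) ∨
        (σ.arr .tab (cell n (cellAddr n i) (σ.arr .lab) x) = x + 1 ∧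
          σ.arr .tab (cell n (cellAddr n i) (Function.update (σ.arr .lab) z Y) x) = 0 ∧
          σ'.arr .tab = Function.update (σ.arr .tab)
            (cell n (cellAddr n i) (Function.update (σ.arr .lab) z Y) x) (x + 1) ∧
          σ'.arr .par = σ.arr .par ∧ σ'.arr .pid = σ.arr .pid) ∨
        (σ.arr .tab (cell n (cellAddr n i) (σ.arr .lab) x) = x + 1 ∧
          σ.arr .tab (cell n (cellAddr n i) (Function.update (σ.arr .lab) z Y) x) ≠ 0 ∧
          σ'.arr .tab = σ.arr .tab ∧
          σ'.arr .par = Function.update (σ.arr .par) x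
            (σ.arr .tab (cell n (cellAddr n i) (Function.update (σ.arr .lab) z Y) x) - 1) ∧
          σ'.arr .pid = Function.update (σ.arr .pid) x (σ.arr .ei (σ.var .e)))) := by
  have hlab' : ∀ w < 2 * n, Function.update (σ.arr .lab) z Y w < 2 * n := by
    intro w hw
    by_cases hwz : w = z
    · rw [hwz, Function.update_self]
      exact hY
    · rw [Function.update_of_ne hwz]
      exact hlab w hw
  obtain ⟨o1, o2, o3⟩ := cellAddr_lt (i := i) (hlab x (by omega)) (hlab (x + n) (by omega))
  obtain ⟨d1, d2, d3⟩ := cellAddr_lt (i := i) (hlab' x (by omega)) (hlab' (x + n) (by omega))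
  have hc1 : (i * (2 * n) + σ.arr .lab x) * (2 * n) + σ.arr .lab (x + n) =
    cell n (cellAddr n i) (σ.arr .lab) x := rfl
  have hc2 : (i * (2 * n) + Function.update (σ.arr .lab) z Y x) * (2 * n) +
    Function.update (σ.arr .lab) z Y (x + n) =
    cell n (cellAddr n i) (Function.update (σ.arr .lab) z Y) x := rfl
  rw [cellAddr, hc1] at o3
  rw [cellAddr, hc2] at d3
  generalize cell n (cellAddr n i) (Function.update (σ.arr .lab) z Y) x = d at *
  generalize cell n (cellAddr n i) (σ.arr .lab) x = o at *
  rw [moveCellProg, wp_seq, wp_assign]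
  refine ⟨?_, ?_⟩
  · simp [cellExpr, hxv, hn, hi]
    and_intros <;> omega
  rw [wp_seq, wp_put]
  refine ⟨trivial, trivial, ?_, ?_⟩
  · simp [hzv]
    omega
  rw [wp_seq, wp_assign]
  refine ⟨?_, moveRep_wp (x := x) (o := o) (d := d) ?_ ?_ ?_ ?_ ?_ ?_ ?_ ?_ ?_ ?_ ?_⟩
  · simp [cellExpr, hxv, hn, hi, hYv, hzv]
    and_intros <;> omega
  all_goals try simp [cellExpr, hxv, hn, hi, hYv, hzv, hc1, hc2]
  all_goals omega

end move

theorem Buckets.size_pos {m ℓ : ℕ} {lab hd nxt sz : ℕ → ℕ} (h : Buckets m lab hd nxt sz)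
    (hℓ : ℓ < m) (h0 : hd ℓ ≠ 0) : 0 < sz ℓ := by
  rw [h.size_eq hℓ, Finset.card_pos]
  obtain ⟨h1, h2, -⟩ := h.head hℓ h0
  exact ⟨hd ℓ - 1, by simp [h1, h2]⟩

theorem Buckets.size_le {m ℓ : ℕ} {lab hd nxt sz : ℕ → ℕ} (h : Buckets m lab hd nxt sz)
    (hℓ : ℓ < m) : sz ℓ ≤ m := by
  rw [h.size_eq hℓ]
  exact (Finset.card_filter_le _ _).trans (by simp)

theorem Cells.congr {n : ℕ} {used used' : ℕ → Prop} {c c' tab par : ℕ → ℕ}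
    (h : Cells n used c tab par) (hu : ∀ m, used' m → used m) (hc : ∀ x < n, c' x = c x) :
    Cells n used' c' tab par := by
  refine ⟨fun x hx => ?_, fun m hm h0 => ?_, h.par_lt, fun x hx y hy => ?_⟩
  · obtain ⟨r, hr, h1, h2, h3⟩ := h.rep x hx
    exact ⟨r, hr, by rw [hc x hx, h1], by rw [hc x hx, hc r hr, h2], h3⟩
  · obtain ⟨x, hx, h1⟩ := h.inhabited m (hu m hm) h0
    exact ⟨x, hx, by rw [hc x hx, h1]⟩
  · rw [h.link x hx y hy, hc x hx, hc y hy]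

section drain

variable {Z : ℕ} {σ : Store} {n i X Y : ℕ}

/-- Each element of the bucket costs at most 16 steps: 8 for moving it between the lists, up to 7
for its cell, and 1 for the loop test. -/
theorem drain_wp (hn : σ.var .n = n) (hi : σ.var .i = i) (hXv : σ.var .X = X) (hYv : σ.var .Y = Y)
    (hXY : X ≠ Y) (hX : X < 2 * n) (hY : ∃ w < 2 * n, σ.arr .lab w = Y)
    (hside : ∀ x < n, ¬ (σ.arr .lab x = X ∧ σ.arr .lab (x + n) = X))
    (hlab : ∀ w < 2 * n, σ.arr .lab w < 2 * n) (he : σ.var .e < Z)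
    (hB : Buckets (2 * n) (σ.arr .lab) (σ.arr .hd) (σ.arr .nxt) (σ.arr .sz))
    (hC : Cells n (UsedCell n (cellAddr n i) (σ.arr .lab)) (cell n (cellAddr n i) (σ.arr .lab))
      (σ.arr .tab) (σ.arr .par))
    (hZ : (i + 1) * (2 * n) * (2 * n) + 2 * n + 2 < Z) :
    Wp Z (.loop (.lt 0 (.get .hd Var.X)) moveProg) σ fun t σ' => t ≤ 16 * σ.arr .sz X + 1 ∧
      (∀ w < 2 * n, σ'.arr .lab w = relabel X Y (σ.arr .lab) w) ∧
      (∀ w < 2 * n, σ'.arr .lab w < 2 * n) ∧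
      Buckets (2 * n) (σ'.arr .lab) (σ'.arr .hd) (σ'.arr .nxt) (σ'.arr .sz) ∧
      Cells n (UsedCell n (cellAddr n i) (σ'.arr .lab)) (cell n (cellAddr n i) (σ'.arr .lab))
        (σ'.arr .tab) (σ'.arr .par) ∧
      (∀ x < n, (σ'.arr .par x = σ.arr .par x ∧ σ'.arr .pid x = σ.arr .pid x) ∨
        (σ.arr .par x = x ∧ (σ'.arr .par x = x ∧ σ'.arr .pid x = σ.arr .pid x ∨
          σ'.arr .pid x = σ.arr .ei (σ.var .e)))) ∧
      ∀ m, (i + 1) * (2 * n) * (2 * n) ≤ m → σ'.arr .tab m = σ.arr .tab m := by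
  have hS := shift_relabel (cellInj_cellAddr n i) hlab hXY hY
  have hYlt : Y < 2 * n := by
    obtain ⟨w, hw, rfl⟩ := hY
    exact hlab w hw
  refine Wp.loop (fun t τ => t + 16 * τ.arr .sz X ≤ 16 * σ.arr .sz X ∧
    PartlyRelabelled n X Y (σ.arr .lab) (τ.arr .lab) ∧
    (∀ w < 2 * n, τ.arr .lab w < 2 * n) ∧
    Buckets (2 * n) (τ.arr .lab) (τ.arr .hd) (τ.arr .nxt) (τ.arr .sz) ∧
    Moving n (fun x => σ.arr .lab x = X ∨ σ.arr .lab (x + n) = X)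
      (Relabelled n (σ.arr .lab) (τ.arr .lab)) (cell n (cellAddr n i) (σ.arr .lab))
      (cell n (cellAddr n i) (relabel X Y (σ.arr .lab))) (σ.arr .tab) (σ.arr .par) (σ.arr .pid)
      (τ.arr .tab) (τ.arr .par) (τ.arr .pid) (σ.arr .ei (σ.var .e)) ∧
    ∀ m, (i + 1) * (2 * n) * (2 * n) ≤ m → τ.arr .tab m = σ.arr .tab m)
    (fun τ => τ.arr .sz X) ?_ ?_ ?_ ?_
  · refine ⟨by simp, fun w _ => Or.inl rfl, hlab, hB, Moving.start.congr fun x => ?_, fun _ _ => rfl⟩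
    simp [Relabelled]
  · intro t τ hs _
    simp [hs.var .X, hXv]
    omega
  · rintro t τ hs ⟨ht, hP, hl, hb, hM, htab⟩ hhd
    have v1 := hs.var .n
    have v2 := hs.var .i
    have v3 := hs.var .X
    have v4 := hs.var .Y
    have v5 := hs.var .e
    have v6 := hs.arr .ei
    rw [hn] at v1
    rw [hi] at v2
    rw [hXv] at v3
    rw [hYv] at v4
    simp only [Cond.Holds, Expr.eval, v3] at hhd
    obtain ⟨h1, h2, h3⟩ := hb.head hX (by omega)
    have h4 := hb.size_pos hX (by omega)
    have h5 := hb.size_le hX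
    have h6 := hb.size_le hYlt
    generalize τ.arr .hd X - 1 = z at h1 h2 h3
    obtain ⟨x, hx, hzx⟩ : ∃ x < n, z = x ∨ z = x + n := by
      by_cases hzn : z < n
      · exact ⟨z, hzn, Or.inl rfl⟩
      · exact ⟨z - n, by omega, Or.inr (by omega)⟩
    obtain ⟨k1, k2, k3, k4, k5, k6⟩ := hP.next (ad := cellAddr n i) hXY hside h2 hx hzx
    -- The entry at the destination is null or a vertex shifted by one; this bounds the value that
    -- is about to be decremented.
    have htabn : τ.arr .tab (cell n (cellAddr n i) (Function.update (τ.arr .lab) z Y) x) ≤ n := by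
      rw [k4]
      by_contra hc
      obtain ⟨s, hs⟩ : ∃ s, τ.arr .tab (cell n (cellAddr n i) (relabel X Y (σ.arr .lab)) x) =
        s + 1 := ⟨_ - 1, (Nat.sub_add_cancel (by omega)).symm⟩
      have := (hM.target hC hS hx hs).1
      omega
    rw [moveProg, wp_seq]
    refine (moveList_wp v1 v3 v4 hXY hX hYlt h3 hx hzx h5 h6 (by omega)).mono ?_
    rintro t₁ τ₁ hs₁ ⟨ht₁, m1, m2, m3, m4, m5⟩
    have w1 := (hs₁.var .n).trans v1
    have w2 := (hs₁.var .i).trans v2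
    have w4 := (hs₁.var .Y).trans v4
    have w5 := (hs₁.var .e).trans v5
    have w6 := (hs₁.arr .ei).trans v6
    have w7 := hs₁.arr .lab
    have w8 := hs₁.arr .tab
    have w9 := hs₁.arr .par
    have w10 := hs₁.arr .pid
    refine (moveCell_wp (Z := Z) w1 w2 w4 m1 m2 hYlt hx hzx (by rwa [w7]) (by rwa [w5])
      (by rwa [w7, w8]) hZ).mono ?_
    rintro t₂ τ₂ hs₂ ⟨ht₂, l1, l2⟩
    have u1 := hs₂.arr .hd
    have u2 := hs₂.arr .nxt
    have u3 := hs₂.arr .sz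
    rw [w7] at l1
    rw [w5, w6, w7, w8, w9, w10, k3, k4] at l2
    rw [m3] at u1
    rw [m4] at u2
    rw [m5] at u3
    have hl' : ∀ w < 2 * n, τ₂.arr .lab w < 2 * n := by
      rw [l1]
      intro w hw
      by_cases hwz : w = z
      · rw [hwz, Function.update_self]
        exact hYlt
      · rw [Function.update_of_ne hwz]
        exact hl w hw
    have hx1 : relabel X Y (σ.arr .lab) x < 2 * n ∧ relabel X Y (σ.arr .lab) (x + n) < 2 * n := by
      have g1 := hlab x (by omega)
      have g2 := hlab (x + n) (by omega)
      simp only [relabel]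
      split_ifs <;> omega
    have hd := (cellAddr_lt (i := i) hx1.1 hx1.2).2.2
    have hsz : τ₂.arr .sz X = τ.arr .sz X - 1 := by
      rw [u3, Function.update_of_ne hXY, Function.update_self]
    refine ⟨⟨by omega, by rwa [l1], hl', ?_, ?_⟩, by omega⟩
    · rw [l1, u1, u2, u3]
      exact hb.move hX hYlt hXY h3
    · rw [l1]
      rcases l2 with ⟨g1, g2, g3, g4⟩ | ⟨g1, g2, g3, g4, g5⟩ | ⟨g1, g2, g3, g4, g5⟩
      · rw [g2, g3, g4]
        exact ⟨(hM.skip hC hx k1 g1).congr k6, htab⟩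
      · rw [g3, g4, g5]
        refine ⟨(hM.insert hC hx k1 k2 g1 g2).congr k6, fun m hm => ?_⟩
        rw [Function.update_of_ne, htab m hm]
        rintro rfl
        rw [cell] at hm
        omega
      · rw [g3, g4, g5]
        exact ⟨(hM.join hC hS hx k1 k2 g1 g2).congr k6, htab⟩
  · rintro t τ hs ⟨ht, hP, hl, hb, hM, htab⟩ hhd
    simp only [Cond.Holds, Expr.eval, hs.var .X, hXv] at hhd
    have hfin := hP.finish fun w hw => hb.empty hX (by omega) hw
    refine ⟨by omega, hfin, hl, hb, ?_, fun x hx => hM.changed hC hx, htab⟩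
    refine (hM.cells hC hS fun x hx hA => ⟨hx, ?_⟩).congr ?_ fun x hx => ?_
    · rw [hfin x (by omega), hfin (x + n) (by omega)]
      simp only [relabel]
      rcases hA with hA | hA
      · left
        rw [if_pos hA, hA]
        exact hXY.symm
      · right
        rw [if_pos hA, hA]
        exact hXY.symm
    · rintro m ⟨y, hy, z, hz, rfl⟩
      exact ⟨y, hy, z, hz, by rw [hfin y hy, hfin z hz]⟩
    · rw [cell, cell, hfin x (by omega), hfin (x + n) (by omega)]

end drain

end CutMerge

/-! ### Inserting one edge, with amortized cost. -/

namespace CutMerge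

open Relation

/-- Insert the edge number `s` in the sorted order. -/
def insertProg : Stmt :=
  .e ::= .get .p Var.s ;;
  .X ::= .get .lab (.get .eu Var.e) ;;
  .Y ::= .get .lab (.get .ev Var.e) ;;
  .ite (.eq Var.X Var.Y) .skip
    (.ite (.lt (.get .sz Var.Y) (.get .sz Var.X))
      (.g ::= Var.X ;; .X ::= Var.Y ;; .Y ::= Var.g) .skip ;;
    .loop (.lt 0 (.get .hd Var.X)) moveProg)

theorem potential_congr {m : ℕ} {lab lab' : ℕ → ℕ} (h : ∀ w < m, lab w = lab' w) :
    potential m lab = potential m lab' := by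
  refine Finset.sum_congr rfl fun z hz => ?_
  rw [h z (Finset.mem_range.1 hz)]
  congr 2
  exact Finset.filter_congr fun w hw => by rw [h w (Finset.mem_range.1 hw)]

section insert

variable {Z n k M a i : ℕ} {D : Family n k} {σ : Store}

/-- The state of the tables after the insertion of the first `a` edges. -/
structure Family.TableInv (D : Family n k) (i a : ℕ) (eu ev ei p : ℕ → ℕ) (σ : Store) : Prop where
  round : D.RoundInv (cellAddr n i) eu ev ei p a (σ.arr .lab) (σ.arr .tab) (σ.arr .par)
    (σ.arr .pid)
  buckets : Buckets (2 * n) (σ.arr .lab) (σ.arr .hd) (σ.arr .nxt) (σ.arr .sz)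
  fresh : ∀ m, (i + 1) * (2 * n) * (2 * n) ≤ m → σ.arr .tab m = 0

/-- Emptying the smaller bucket costs 16 steps per element, and `potential_relabel` says that the
potential rises by at least that many elements. -/
theorem absorb_wp {X Y : ℕ} (hn : σ.var .n = n) (hi : σ.var .i = i) (hXv : σ.var .X = X)
    (hYv : σ.var .Y = Y) (hev : σ.var .e = σ.arr .p a) (ha : a < M)
    (hE : TwoSided n M (σ.arr .eu) (σ.arr .ev)) (hp : ∀ a < M, σ.arr .p a < M)
    (hsort : ∀ i j, i < j → j < M →
      D.key (σ.arr .ei (σ.arr .p j)) ≤ D.key (σ.arr .ei (σ.arr .p i)))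
    (hI : D.TableInv i a (σ.arr .eu) (σ.arr .ev) (σ.arr .ei) (σ.arr .p) σ)
    (hXY : X ≠ Y)
    (hends : (X = σ.arr .lab (σ.arr .eu (σ.arr .p a)) ∧ Y = σ.arr .lab (σ.arr .ev (σ.arr .p a))) ∨
      (X = σ.arr .lab (σ.arr .ev (σ.arr .p a)) ∧ Y = σ.arr .lab (σ.arr .eu (σ.arr .p a))))
    (hsz : σ.arr .sz X ≤ σ.arr .sz Y) (hM : M < Z)
    (hZ : (i + 1) * (2 * n) * (2 * n) + 2 * n + 2 < Z) :
    Wp Z (.loop (.lt 0 (.get .hd Var.X)) moveProg) σ fun t σ' =>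
      t + 16 * potential (2 * n) (σ.arr .lab) ≤ 16 * potential (2 * n) (σ'.arr .lab) + 1 ∧
      D.TableInv i (a + 1) (σ.arr .eu) (σ.arr .ev) (σ.arr .ei) (σ.arr .p) σ' := by
  obtain ⟨hR, hB, h0⟩ := hI
  have hlt := hR.lab_lt
  have hpa := hp a ha
  have hEa := hE _ hpa
  have hX : X < 2 * n := by
    rcases hends with h | h
    · rw [h.1]; exact hlt _ (by omega)
    · rw [h.1]; exact hlt _ (by omega)
  have hY : ∃ w < 2 * n, σ.arr .lab w = Y := by
    rcases hends with h | h
    · exact ⟨_, by omega, h.2.symm⟩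
    · exact ⟨_, by omega, h.2.symm⟩
  have hYlt : Y < 2 * n := by
    obtain ⟨w, hw, rfl⟩ := hY
    exact hlt w hw
  refine (drain_wp hn hi hXv hYv hXY hX hY ?_ hlt (by omega) hB hR.cells hZ).mono ?_
  · rintro x hx ⟨h1, h2⟩
    have := hR.side hE hp ha.le (z := x) (w := x + n) (by omega) (by omega) (h1.trans h2.symm)
    omega
  · rintro t σ' - ⟨ht, h1, h2, h3, h4, h5, h6⟩
    refine ⟨?_, ?_, h3, fun m hm => (h6 m hm).trans (h0 m hm)⟩
    · rw [hB.size_eq hX, hB.size_eq hYlt] at hsz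
      have := potential_relabel hXY hsz
      rw [← hB.size_eq hX] at this
      rw [potential_congr h1]
      omega
    · refine hR.step hE hp (cellInj_cellAddr n i) ha (fun a' ha' => hsort a' a ha' ha) h2
        (fun z hz w hw => ?_) h4 (by rwa [hev] at h5)
      rw [h1 z hz, h1 w hw, relabel_eq_iff]
      rcases hends with ⟨rfl, rfl⟩ | ⟨rfl, rfl⟩
      · rfl
      · tauto

theorem insert_wp (hn : σ.var .n = n) (hi : σ.var .i = i) (hs : σ.var .s = a) (ha : a < M)
    (hE : TwoSided n M (σ.arr .eu) (σ.arr .ev)) (hp : ∀ a < M, σ.arr .p a < M)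
    (hsort : ∀ i j, i < j → j < M →
      D.key (σ.arr .ei (σ.arr .p j)) ≤ D.key (σ.arr .ei (σ.arr .p i)))
    (hI : D.TableInv i a (σ.arr .eu) (σ.arr .ev) (σ.arr .ei) (σ.arr .p) σ) (hM : M < Z)
    (hZ : (i + 1) * (2 * n) * (2 * n) + 2 * n + 2 < Z) :
    Wp Z insertProg σ fun t σ' =>
      t + 16 * potential (2 * n) (σ.arr .lab) ≤ 16 * potential (2 * n) (σ'.arr .lab) + 10 ∧
      D.TableInv i (a + 1) (σ.arr .eu) (σ.arr .ev) (σ.arr .ei) (σ.arr .p) σ' := by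
  have hpa := hp a ha
  have hEa := hE _ hpa
  have hlt := hI.round.lab_lt
  have hX := hlt (σ.arr .eu (σ.arr .p a)) (by omega)
  have hY := hlt (σ.arr .ev (σ.arr .p a)) (by omega)
  have hcong : ∀ τ : Store, τ.arr = σ.arr → D.TableInv i a (σ.arr .eu) (σ.arr .ev) (σ.arr .ei)
      (σ.arr .p) τ := by
    intro τ hτ
    constructor
    · rw [hτ]; exact hI.round
    · rw [hτ]; exact hI.buckets
    · rw [hτ]; exact hI.fresh
  rw [insertProg]
  simp only [wp_seq, wp_assign, wp_ite]
  simp [hs]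
  refine ⟨by omega, ⟨by omega, by omega⟩, ⟨by omega, by omega⟩, fun heq => ⟨by omega, ?_⟩,
    fun hne => ⟨⟨by omega, by omega⟩, fun hlt' => ?_, fun hle => ?_⟩⟩
  -- The ends are already connected. The edge is recorded as inserted, but neither labels nor links
  -- change.
  · have hR := hI.round
    refine ⟨hR.step hE hp (cellInj_cellAddr n i) ha (fun a' ha' => hsort a' a ha' ha) hlt
      (fun z hz w hw => ?_) hR.cells fun x hx => Or.inl ⟨rfl, rfl⟩, hI.buckets, hI.fresh⟩
    rw [heq]
    constructor
    · exact Or.inl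
    · rintro (h | ⟨h1, h2⟩ | ⟨h1, h2⟩)
      · exact h
      · exact h1.trans h2.symm
      · exact h1.trans h2.symm
  · refine (absorb_wp (D := D) (σ := Store.set _ _ _) (M := M) (a := a)
      (X := σ.arr .lab (σ.arr .ev (σ.arr .p a)))
      (Y := σ.arr .lab (σ.arr .eu (σ.arr .p a))) (by simp [hn]) (by simp [hi]) (by simp)
      (by simp) (by simp) ha (by simpa using hE) (by simpa using hp) (by simpa using hsort)
      ?_ (Ne.symm hne) (Or.inr ⟨by simp, by simp⟩) (by simpa using hlt'.le) hM hZ).mono ?_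
    · exact hcong _ rfl
    · rintro t σ' - ⟨h1, h2⟩
      simp at h1 h2
      exact ⟨by omega, h2⟩
  · refine (absorb_wp (D := D) (σ := Store.set _ _ _) (M := M) (a := a)
      (X := σ.arr .lab (σ.arr .eu (σ.arr .p a)))
      (Y := σ.arr .lab (σ.arr .ev (σ.arr .p a))) (by simp [hn]) (by simp [hi]) (by simp)
      (by simp) (by simp) ha (by simpa using hE) (by simpa using hp) (by simpa using hsort)
      ?_ hne (Or.inl ⟨by simp, by simp⟩) (by simpa using hle) hM hZ).mono ?_
    · exact hcong _ rfl
    · rintro t σ' - ⟨h1, h2⟩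
      simp at h1 h2
      exact ⟨by omega, h2⟩

end insert

end CutMerge

/-! ### One round: from a flow tree of i trees to one of i + 1 trees. -/

namespace CutMerge

open Relation

/-- Append tree `i` to the table of edges. -/
def loadTreeProg : Stmt :=
  .upTo .j Var.m
    (.put .eu (Var.n + Var.j) (.get .io (2 * (Var.i * Var.m + Var.j)) + Var.n) ;;
    .put .ev (Var.n + Var.j) (.get .io (2 * (Var.i * Var.m + Var.j) + 1) + Var.n) ;;
    .put .ei (Var.n + Var.j) (Var.i * Var.m + Var.j))

def initLabelsProg : Stmt :=
  .upTo .x (2 * Var.n) (.put .lab Var.x Var.x ;; .put .nxt Var.x 0 ;; .put .hd Var.x (Var.x + 1) ;;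
    .put .sz Var.x 1)

def initCellsProg : Stmt :=
  .upTo .x Var.n (.put .par Var.x Var.x ;; .put .pid Var.x 0 ;;
    .put .tab ((Var.i * (2 * Var.n) + Var.x) * (2 * Var.n) + (Var.x + Var.n)) (Var.x + 1))

def saveTreeProg : Stmt :=
  .upTo .x Var.n (.put .eu Var.x Var.x ;; .put .ev Var.x (.get .par Var.x) ;;
    .put .ei Var.x (.get .pid Var.x))

/-- Replace the flow tree of the first `i` trees by one of the first `i + 1` trees. -/
def roundProg : Stmt :=
  loadTreeProg ;; .M ::= Var.n + Var.m ;; sortProg ;; initLabelsProg ;; initCellsProg ;;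
  .upTo .s Var.M insertProg ;; saveTreeProg

theorem Family.ends_lt {n k : ℕ} (D : Family n k) {f : ℕ} (hf : f < k * (n - 1)) :
    D.U f < n ∧ D.V f < n := by
  obtain ⟨h1, h2, h3⟩ := tree_of_lt hf
  obtain ⟨h4, h5, h6⟩ := D.ch_spec _ h1 f h2 h3
  have h7 := D.ends _ h1 _ h4 h5
  have h8 := (D.rooted _ h1).par_lt _ h5
  rw [h6] at h7
  omega

section round

variable {Z n k M i : ℕ} {D : Family n k} {σ : Store}

theorem loadTree_wp (hn : σ.var .n = n) (hm : σ.var .m = n - 1) (hi : σ.var .i = i) (hik : i < k)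
    (hio : ∀ f < k * (n - 1), σ.arr .io (2 * f) = D.U f ∧ σ.arr .io (2 * f + 1) = D.V f)
    (hZ : k * (2 * n) * (2 * n) + 10 * (k * n) + 20 < Z) :
    Wp Z loadTreeProg σ fun t σ' => t ≤ 5 * n + 2 ∧
      (∀ j < n, σ'.arr .eu j = σ.arr .eu j ∧ σ'.arr .ev j = σ.arr .ev j ∧
        σ'.arr .ei j = σ.arr .ei j) ∧
      ∀ j < n - 1, σ'.arr .eu (n + j) = D.U (i * (n - 1) + j) + n ∧
        σ'.arr .ev (n + j) = D.V (i * (n - 1) + j) + n ∧ σ'.arr .ei (n + j) = i * (n - 1) + j := by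
  have hkn : n ≤ k * n := Nat.le_mul_of_pos_left n D.k_pos
  have hk : (i + 1) * (n - 1) ≤ k * (n - 1) := Nat.mul_le_mul_right _ hik
  have hk' : k * (n - 1) ≤ k * n := Nat.mul_le_mul_left _ (Nat.sub_le _ _)
  have hi1 : (i + 1) * (n - 1) = i * (n - 1) + (n - 1) := by ring
  refine Wp.upTo (n - 1) 3 (by omega) (fun a τ =>
    (∀ j < n, τ.arr .eu j = σ.arr .eu j ∧ τ.arr .ev j = σ.arr .ev j ∧
        τ.arr .ei j = σ.arr .ei j) ∧
      ∀ j < a, τ.arr .eu (n + j) = D.U (i * (n - 1) + j) + n ∧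
        τ.arr .ev (n + j) = D.V (i * (n - 1) + j) + n ∧ τ.arr .ei (n + j) = i * (n - 1) + j)
    ?_ ?_ ?_ ?_
  · intro τ hs
    exact ⟨trivial, by simp [hs.var .m, hm]⟩
  · simp
  · rintro a τ ha hs hv ⟨h1, h2⟩
    have hf : i * (n - 1) + a < k * (n - 1) := by omega
    obtain ⟨e1, e2⟩ := hio _ hf
    obtain ⟨e3, e4⟩ := D.ends_lt hf
    have v1 := hs.var .n
    have v2 := hs.var .m
    have v3 := hs.var .i
    have v4 := hs.arr .io
    simp [v1, v2, v3, v4, hv, hn, hm, hi, e1, e2]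
    and_intros
    any_goals omega
    · intro j hj
      simpa [Function.update_of_ne (show j ≠ n + a by omega)] using h1 j hj
    · intro j hj
      by_cases hja : j = a
      · subst hja
        simp
      · simpa [Function.update_of_ne (show n + j ≠ n + a by omega)] using h2 j (by omega)
  · rintro t τ ht hs ⟨h1, h2⟩
    exact ⟨by omega, h1, h2⟩

theorem initLabels_wp (hn : σ.var .n = n) (hZ : 2 * n + 2 < Z) :
    Wp Z initLabelsProg σ fun t σ' => t ≤ 12 * n + 2 ∧ (∀ z < 2 * n, σ'.arr .lab z = z) ∧
      Buckets (2 * n) (σ'.arr .lab) (σ'.arr .hd) (σ'.arr .nxt) (σ'.arr .sz) := by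
  refine Wp.upTo (2 * n) 4 (by omega) (fun a τ => ∀ z < a, τ.arr .lab z = z ∧ τ.arr .hd z = z + 1 ∧
    τ.arr .nxt z = 0 ∧ τ.arr .sz z = 1) ?_ (by simp) ?_ ?_
  · intro τ hs
    simp [hs.var .n, hn]
    omega
  · intro a τ ha hs hv h
    simp [hv]
    and_intros
    any_goals omega
    intro z hz
    by_cases hza : z = a
    · subst hza
      simp
    · simpa [Function.update_of_ne hza] using h z (by omega)
  · intro t τ ht hs h
    exact ⟨by omega, fun z hz => (h z hz).1, buckets_of_singletons (fun z hz => (h z hz).1)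
      (fun z hz => (h z hz).2.1) (fun z hz => (h z hz).2.2.1) fun z hz => (h z hz).2.2.2⟩

theorem initCells_wp (hn : σ.var .n = n) (hi : σ.var .i = i)
    (hlab : ∀ z < 2 * n, σ.arr .lab z = z) {eu ev ei p : ℕ → ℕ}
    (hB : Buckets (2 * n) (σ.arr .lab) (σ.arr .hd) (σ.arr .nxt) (σ.arr .sz))
    (htab : ∀ m, i * (2 * n) * (2 * n) ≤ m → σ.arr .tab m = 0)
    (hZ : (i + 1) * (2 * n) * (2 * n) + 2 * n + 2 < Z) :
    Wp Z initCellsProg σ fun t σ' => t ≤ 5 * n + 2 ∧ D.TableInv i 0 eu ev ei p σ' := by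
  have hc : ∀ x, (i * (2 * n) + x) * (2 * n) + (x + n) = cellAddr n i x (x + n) := fun _ => rfl
  refine Wp.upTo n 3 (by omega) (fun a τ => (∀ x < a, τ.arr .par x = x ∧ τ.arr .pid x = 0 ∧
    τ.arr .tab (cellAddr n i x (x + n)) = x + 1) ∧
    ∀ m, i * (2 * n) * (2 * n) ≤ m → τ.arr .tab m ≠ 0 → ∃ x < a, m = cellAddr n i x (x + n))
    ?_ ?_ ?_ ?_
  · intro τ hs
    simp [hs.var .n, hn]
  · simp
    exact htab
  · rintro a τ ha hs hv ⟨h1, h2⟩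
    have v1 := hs.var .n
    have v2 := hs.var .i
    obtain ⟨c1, c2, c3⟩ := cellAddr_lt (i := i) (a := a) (b := a + n) (n := n) (by omega) (by omega)
    simp [v1, v2, hv, hn, hi, hc]
    and_intros
    any_goals omega
    · intro x hx
      by_cases hxa : x = a
      · subst hxa
        simp
      · have : cellAddr n i x (x + n) ≠ cellAddr n i a (a + n) := fun h =>
          hxa (cellInj_cellAddr n i _ (by omega) _ (by omega) _ (by omega) _ (by omega) h).1
        simpa [Function.update_of_ne hxa, Function.update_of_ne this] using h1 x (by omega)
    · intro m hm h0
      by_cases hma : m = cellAddr n i a (a + n)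
      · exact ⟨a, by omega, hma⟩
      · rw [Function.update_of_ne hma] at h0
        obtain ⟨x, hx, h⟩ := h2 m hm h0
        exact ⟨x, by omega, h⟩
  · rintro t τ ht hs ⟨h1, h2⟩
    have v1 := hs.arr .lab
    refine ⟨by omega, ?_, ?_, ?_⟩
    · refine Family.RoundInv.start (by rwa [v1]) (fun x hx => (h1 x hx).1)
        (fun x hx => (h1 x hx).2.1) (cellInj_cellAddr n i) (fun x hx => (h1 x hx).2.2)
        fun y hy z hz h0 => h2 _ ?_ h0
      rw [cellAddr, add_mul]
      omega
    · rwa [v1, hs.arr .hd, hs.arr .nxt, hs.arr .sz]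
    · intro m hm
      by_contra h0
      have hle : i * (2 * n) * (2 * n) ≤ (i + 1) * (2 * n) * (2 * n) := by gcongr; omega
      obtain ⟨x, hx, rfl⟩ := h2 m (by omega) h0
      have := (cellAddr_lt (i := i) (a := x) (b := x + n) (n := n) (by omega) (by omega)).2.2
      omega

/-- The costs telescope against the potential on 2n vertices, which is at most 2n log(2n), leaving
12 steps of overhead per edge. -/
theorem insertAll_wp (hn : σ.var .n = n) (hi : σ.var .i = i) (hMv : σ.var .M = M)
    (hE : TwoSided n M (σ.arr .eu) (σ.arr .ev)) (hp : ∀ a < M, σ.arr .p a < M)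
    (hsort : ∀ i j, i < j → j < M →
      D.key (σ.arr .ei (σ.arr .p j)) ≤ D.key (σ.arr .ei (σ.arr .p i)))
    (hI : D.TableInv i 0 (σ.arr .eu) (σ.arr .ev) (σ.arr .ei) (σ.arr .p) σ) (hM : M < Z)
    (hZ : (i + 1) * (2 * n) * (2 * n) + 2 * n + 2 < Z) :
    Wp Z (.upTo .s Var.M insertProg) σ fun t σ' =>
      t ≤ 16 * (2 * n * Nat.log 2 (2 * n)) + 12 * M + 2 ∧
      D.TableInv i M (σ.arr .eu) (σ.arr .ev) (σ.arr .ei) (σ.arr .p) σ' := by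
  have hcong : ∀ (a b : ℕ) (τ : Store), D.TableInv i a (σ.arr .eu) (σ.arr .ev) (σ.arr .ei)
      (σ.arr .p) τ → D.TableInv i a (σ.arr .eu) (σ.arr .ev) (σ.arr .ei) (σ.arr .p)
      (τ.set .s b) := fun a b τ h => ⟨h.round, h.buckets, h.fresh⟩
  refine Wp.upTo_of_cost M hM (fun a t τ => t ≤ 16 * potential (2 * n) (τ.arr .lab) + 12 * a ∧
    D.TableInv i a (σ.arr .eu) (σ.arr .ev) (σ.arr .ei) (σ.arr .p) τ) ?_ ?_ ?_ ?_
  · intro τ hs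
    simp [hs.var .M, hMv]
  · exact ⟨by simp, hcong _ _ _ hI⟩
  · rintro a t τ ha hs hv ⟨ht, h⟩
    have w1 := hs.arr .eu
    have w2 := hs.arr .ev
    have w3 := hs.arr .ei
    have w4 := hs.arr .p
    refine (insert_wp (D := D) (M := M) (i := i) ((hs.var .n).trans hn) ((hs.var .i).trans hi) hv ha
      (by rwa [w1, w2]) (by rwa [w4]) (by rwa [w3, w4]) (by rwa [w1, w2, w3, w4]) hM hZ).mono ?_
    rintro t' τ' - ⟨h1, h2⟩
    rw [w1, w2, w3, w4] at h2
    refine ⟨?_, hcong _ _ _ h2⟩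
    simp only [Store.set_arr]
    omega
  · rintro t τ hs ⟨ht, h⟩
    have := potential_le (2 * n) (τ.arr .lab)
    exact ⟨by omega, h⟩

theorem saveTree_wp (hn : σ.var .n = n) (hZ : n < Z) :
    Wp Z saveTreeProg σ fun t σ' => t ≤ 5 * n + 2 ∧ ∀ x < n, σ'.arr .eu x = x ∧
      σ'.arr .ev x = σ.arr .par x ∧ σ'.arr .ei x = σ.arr .pid x := by
  refine Wp.upTo n 3 hZ (fun a τ => ∀ x < a, τ.arr .eu x = x ∧
      τ.arr .ev x = σ.arr .par x ∧ τ.arr .ei x = σ.arr .pid x) ?_ (by simp) ?_ ?_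
  · intro τ hs
    simp [hs.var .n, hn]
  · intro a τ ha hs hv h
    simp [hv, hs.arr .par, hs.arr .pid]
    refine ⟨by omega, fun x hx => ?_⟩
    by_cases hxa : x = a
    · subst hxa
      simp
    · simpa [Function.update_of_ne hxa] using h x (by omega)
  · intro t τ ht hs h
    exact ⟨by omega, h⟩

/-- Sorting contributes 104 n L and relabelling 32 n L, with L = log n + 1; the other passes are
linear in n and fit into the rest of the constant. -/
theorem round_wp (hn : σ.var .n = n) (hm : σ.var .m = n - 1) (hi : σ.var .i = i) (hik : i < k)
    (hW : σ.wt = D.W)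
    (hio : ∀ f < k * (n - 1), σ.arr .io (2 * f) = D.U f ∧ σ.arr .io (2 * f + 1) = D.V f)
    (hF : D.Flow i (σ.arr .eu) (σ.arr .ev) (σ.arr .ei))
    (htab : ∀ m, i * (2 * n) * (2 * n) ≤ m → σ.arr .tab m = 0)
    (hZ : k * (2 * n) * (2 * n) + 10 * (k * n) + 20 < Z) :
    Wp Z roundProg σ fun t σ' => t ≤ 210 * (n * (Nat.log 2 n + 1)) ∧
      D.Flow (i + 1) (σ'.arr .eu) (σ'.arr .ev) (σ'.arr .ei) ∧
      ∀ m, (i + 1) * (2 * n) * (2 * n) ≤ m → σ'.arr .tab m = 0 := by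
  have hn0 := D.n_pos
  have hkn : n ≤ k * n := Nat.le_mul_of_pos_left n D.k_pos
  have hk : (i + 1) * (n - 1) ≤ k * (n - 1) := Nat.mul_le_mul_right _ hik
  have hk' : k * (n - 1) ≤ k * n := Nat.mul_le_mul_left _ (Nat.sub_le _ _)
  have hi1 : (i + 1) * (n - 1) = i * (n - 1) + (n - 1) := by ring
  have hki : (i + 1) * (2 * n) * (2 * n) ≤ k * (2 * n) * (2 * n) := by gcongr; omega
  rw [roundProg, wp_seq]
  refine (loadTree_wp hn hm hi hik hio hZ).mono fun t₁ σ₁ s₁ ⟨ht₁, hA, hT⟩ => ?_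
  have n₁ := (s₁.var .n).trans hn
  have m₁ := (s₁.var .m).trans hm
  -- Loading the new tree writes only table entries from n on, so the stored flow tree is intact.
  have hF₁ : D.Flow i (σ₁.arr .eu) (σ₁.arr .ev) (σ₁.arr .ei) := by
    obtain ⟨⟨j, hj, hl⟩, hlt, hlink⟩ := hF
    refine ⟨⟨j, hj, by rw [(hA j hj).1, (hA j hj).2.1, hl]⟩, fun j hj => ?_,
      fun P hP x hx y hy => ?_⟩
    · rw [(hA j hj).1, (hA j hj).2.1, (hA j hj).2.2]
      exact hlt j hj
    · rw [← hlink P hP x hx y hy]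
      constructor
      · exact fun hl => hl.mono fun j hj => Or.inr ⟨⟨hj.1, (hA j hj.1).2.2 ▸ hj.2⟩,
          (hA j hj.1).1.symm, (hA j hj.1).2.1.symm⟩
      · exact fun hl => hl.mono fun j hj => Or.inr ⟨⟨hj.1, (hA j hj.1).2.2.symm ▸ hj.2⟩,
          (hA j hj.1).1, (hA j hj.1).2.1⟩
  have hE₁ : TwoSided n (n + (n - 1)) (σ₁.arr .eu) (σ₁.arr .ev) := by
    intro j hj
    by_cases hjn : j < n
    · have := hF₁.lt j hjn
      omega
    · obtain ⟨j', rfl⟩ : ∃ j', j = n + j' := ⟨j - n, by omega⟩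
      have h1 := hT j' (by omega)
      have h2 := D.ends_lt (f := i * (n - 1) + j') (by omega)
      omega
  have hei : ∀ j < n + (n - 1), σ₁.arr .ei j < Z := by
    intro j hj
    by_cases hjn : j < n
    · have := hF₁.lt j hjn
      omega
    · obtain ⟨j', rfl⟩ : ∃ j', j = n + j' := ⟨j - n, by omega⟩
      have h1 := hT j' (by omega)
      omega
  rw [wp_seq, wp_assign]
  refine ⟨by simp [n₁, m₁]; omega, ?_⟩
  rw [wp_seq]
  refine (sort_wp D (M := n + (n - 1)) (by simp [s₁.wt, hW]) (by simp [n₁, m₁]) (by omega)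
    (by simpa using hei)).mono fun t₂ σ₂ s₂ ⟨ht₂, hperm, hsort⟩ => ?_
  have n₂ : σ₂.var .n = n := by simp [s₂.var .n, n₁]
  have i₂ : σ₂.var .i = i := by simp [s₂.var .i, s₁.var .i, hi]
  have M₂ : σ₂.var .M = n + (n - 1) := by simp [s₂.var .M, n₁, m₁]
  have eu₂ : σ₂.arr .eu = σ₁.arr .eu := by simp [s₂.arr .eu]
  have ev₂ : σ₂.arr .ev = σ₁.arr .ev := by simp [s₂.arr .ev]
  have ei₂ : σ₂.arr .ei = σ₁.arr .ei := by simp [s₂.arr .ei]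
  have tab₂ : σ₂.arr .tab = σ.arr .tab := by simp [s₂.arr .tab, s₁.arr .tab]
  simp only [Store.set_arr] at hsort
  rw [wp_seq]
  refine (initLabels_wp (n := n) n₂ (by omega)).mono fun t₃ σ₃ s₃ ⟨ht₃, hlab, hB⟩ => ?_
  rw [wp_seq]
  refine (initCells_wp (D := D) (n := n) (i := i) (eu := σ₁.arr .eu) (ev := σ₁.arr .ev)
    (ei := σ₁.arr .ei) (p := σ₂.arr .p) ((s₃.var .n).trans n₂)
    ((s₃.var .i).trans i₂) hlab hB (by rwa [s₃.arr .tab, tab₂]) (by omega)).mono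
    fun t₄ σ₄ s₄ ⟨ht₄, hI⟩ => ?_
  have n₄ : σ₄.var .n = n := (s₄.var .n).trans ((s₃.var .n).trans n₂)
  have i₄ : σ₄.var .i = i := (s₄.var .i).trans ((s₃.var .i).trans i₂)
  have M₄ : σ₄.var .M = n + (n - 1) := (s₄.var .M).trans ((s₃.var .M).trans M₂)
  have eu₄ : σ₄.arr .eu = σ₁.arr .eu := (s₄.arr .eu).trans ((s₃.arr .eu).trans eu₂)
  have ev₄ : σ₄.arr .ev = σ₁.arr .ev := (s₄.arr .ev).trans ((s₃.arr .ev).trans ev₂)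
  have ei₄ : σ₄.arr .ei = σ₁.arr .ei := (s₄.arr .ei).trans ((s₃.arr .ei).trans ei₂)
  have p₄ : σ₄.arr .p = σ₂.arr .p := (s₄.arr .p).trans (s₃.arr .p)
  rw [wp_seq]
  refine (insertAll_wp (D := D) n₄ i₄ M₄ (by rwa [eu₄, ev₄])
    (fun a ha => by rw [p₄]; exact (hperm _).1 ⟨a, ha, rfl⟩) (by rwa [ei₄, p₄])
    (by rwa [eu₄, ev₄, ei₄, p₄]) (by omega) (by omega)).mono fun t₅ σ₅ s₅ ⟨ht₅, hI'⟩ => ?_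
  rw [eu₄, ev₄, ei₄, p₄] at hI'
  refine (saveTree_wp (n := n) ((s₅.var .n).trans n₄) (by omega)).mono
    fun t₆ σ₆ s₆ ⟨ht₆, hout⟩ => ⟨?_, ?_, ?_⟩
  · have hlog : Nat.log 2 (2 * n) = Nat.log 2 n + 1 := by
      rw [mul_comm]
      exact Nat.log_mul_base (by norm_num) (by omega)
    have hlogM : Nat.log 2 (n + (n - 1)) ≤ Nat.log 2 n + 1 := by
      rw [← hlog]
      exact Nat.log_mono_right (by omega)
    rw [hlog] at ht₅
    have hL : 1 ≤ Nat.log 2 n + 1 := by omega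
    generalize Nat.log 2 n + 1 = L at *
    have h1 : (Nat.log 2 (n + (n - 1)) + 1) * ((n + (n - 1)) * 23 + 6) ≤ 2 * L * (52 * n) :=
      Nat.mul_le_mul (by omega) (by omega)
    have h2 : 2 * L * (52 * n) = 104 * (n * L) := by ring
    have h3 : 16 * (2 * n * L) = 32 * (n * L) := by ring
    have h4 : n ≤ n * L := Nat.le_mul_of_pos_right n hL
    omega
  · exact hI'.round.flow hik hF₁ hperm hT (fun x hx => (hout x hx).1) (fun x hx => (hout x hx).2.1)
      fun x hx => (hout x hx).2.2
  · rw [s₆.arr .tab]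
    exact hI'.fresh

end round

end CutMerge

/-! ### Leaf stripping as a way to root a tree without adjacency lists. -/

namespace CutMerge

/-! ### Stripping the leaves of a tree -/

theorem Anc.total {par : ℕ → ℕ} {a b z : ℕ} (ha : Anc par a z) (hb : Anc par b z) :
    Anc par a b ∨ Anc par b a := by
  obtain ⟨p, rfl⟩ := ha
  obtain ⟨q, rfl⟩ := hb
  rcases le_total p q with h | h
  · exact Or.inr ⟨q - p, by rw [← Function.iterate_add_apply, Nat.sub_add_cancel h]⟩
  · exact Or.inl ⟨p - q, by rw [← Function.iterate_add_apply, Nat.sub_add_cancel h]⟩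

open Classical in
/-- The number of descendants of a vertex. -/
noncomputable def subtreeSize (n : ℕ) (par : ℕ → ℕ) (x : ℕ) : ℕ :=
  ((Finset.range n).filter fun z => Anc par x z).card

section strip

variable {n : ℕ} {par dep : ℕ → ℕ}

theorem subtreeSize_le (x : ℕ) : subtreeSize n par x ≤ n := by
  classical
  rw [subtreeSize]
  exact (Finset.card_filter_le _ _).trans (by simp)

/-- The subtree of `x` consists of `x` and the subtrees of its children. These are disjoint because
ancestors of a common vertex form a chain. -/
theorem Rooted.subtreeSize_eq (h : Rooted n par dep) {x : ℕ} (hx : x < n) :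
    subtreeSize n par x =
      1 + ∑ y ∈ (Finset.range n).erase 0, if par y = x then subtreeSize n par y else 0 := by
  classical
  rw [← Finset.sum_filter]
  have hd : ∀ y ∈ ((Finset.range n).erase 0).filter (par · = x),
      ∀ y' ∈ ((Finset.range n).erase 0).filter (par · = x), y ≠ y' → Disjoint
        ((Finset.range n).filter fun z => Anc par y z)
        ((Finset.range n).filter fun z => Anc par y' z) := by
    intro y hy y' hy' hne
    simp only [Finset.mem_filter, Finset.mem_erase, Finset.mem_range] at hy hy'
    rw [Finset.disjoint_filter]
    intro z _ h1 h2
    rcases h1.total h2 with h3 | h3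
    · rw [← anc_par_iff hne.symm, hy'.2, ← hy.2] at h3
      exact h.not_anc_par hy.1.2 hy.1.1 h3
    · rw [← anc_par_iff hne, hy.2, ← hy'.2] at h3
      exact h.not_anc_par hy'.1.2 hy'.1.1 h3
  simp only [subtreeSize]
  rw [← Finset.card_biUnion hd]
  have hu : ((Finset.range n).filter fun z => Anc par x z) = insert x
      ((((Finset.range n).erase 0).filter (par · = x)).biUnion fun y =>
        (Finset.range n).filter fun z => Anc par y z) := by
    ext z
    simp only [Finset.mem_filter, Finset.mem_range, Finset.mem_insert, Finset.mem_biUnion,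
      Finset.mem_erase]
    constructor
    · rintro ⟨hz, hxz⟩
      by_cases hzx : z = x
      · exact Or.inl hzx
      · right
        have hlt : ∀ m, par^[m] z < n := by
          intro m
          induction m with
          | zero => exact hz
          | succ m ih =>
            rw [Function.iterate_succ_apply']
            exact h.par_lt _ ih
        -- The child sought is the last vertex before the climb from z first reaches x.
        have hm := Nat.find_spec hxz
        obtain ⟨m, hm'⟩ : ∃ m, Nat.find hxz = m + 1 := by
          refine Nat.exists_eq_succ_of_ne_zero fun h0 => ?_
          rw [h0] at hm
          exact hzx hm
        have hmin : par^[m] z ≠ x := Nat.find_min hxz (by omega)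
        rw [hm', Function.iterate_succ_apply'] at hm
        refine ⟨par^[m] z, ⟨⟨fun h0 => ?_, hlt m⟩, hm⟩, hz, m, rfl⟩
        rw [h0, h.par_zero] at hm
        exact hmin (h0.trans hm)
    · rintro (rfl | ⟨y, ⟨⟨hy0, hy⟩, rfl⟩, hz, hyz⟩)
      · exact ⟨hx, Anc.refl _ _⟩
      · exact ⟨hz, Anc.trans ⟨1, rfl⟩ hyz⟩
  rw [hu, Finset.card_insert_of_notMem, add_comm]
  simp only [Finset.mem_biUnion, Finset.mem_filter, Finset.mem_erase, Finset.mem_range]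
  rintro ⟨y, ⟨⟨hy0, hy⟩, rfl⟩, -, ha⟩
  exact h.not_anc_par hy hy0 ha

/-- The sum, over the edges `y, par y` with `y ∈ R` that contain `w`, of `A y` if `w` is the lower
end and of `B y` if it is the upper one. -/
def edgeSum (par : ℕ → ℕ) (R : Finset ℕ) (A B : ℕ → ℕ) (w : ℕ) : ℕ :=
  ∑ y ∈ R.erase 0, ((if y = w then A y else 0) + if par y = w then B y else 0)

theorem edgeSum_erase {R : Finset ℕ} {x : ℕ} (hx : x ∈ R) (h0 : x ≠ 0) (A B : ℕ → ℕ) (w : ℕ) :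
    edgeSum par R A B w = ((if x = w then A x else 0) + if par x = w then B x else 0) +
      edgeSum par (R.erase x) A B w := by
  rw [edgeSum, edgeSum, Finset.erase_right_comm]
  exact (Finset.add_sum_erase _ _ (by simp [hx, h0])).symm

theorem edgeSum_le {R : Finset ℕ} (hR : ∀ y ∈ R, y < n) {A B : ℕ → ℕ} {c : ℕ}
    (hA : ∀ y ∈ R, y ≠ 0 → A y ≤ c ∧ B y ≤ c) (w : ℕ) : edgeSum par R A B w ≤ n * (2 * c) := by
  have hcard : (R.erase 0).card ≤ n := by
    refine (Finset.card_le_card (t := Finset.range n) fun y hy => ?_).trans (by simp)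
    exact Finset.mem_range.2 (hR y (Finset.mem_of_mem_erase hy))
  calc edgeSum par R A B w ≤ (R.erase 0).card • (2 * c) := by
        refine Finset.sum_le_card_nsmul _ _ _ fun y hy => ?_
        obtain ⟨h1, h2⟩ := Finset.mem_erase.1 hy
        have := hA y h2 h1
        split_ifs <;> omega
    _ ≤ n * (2 * c) := by
      rw [smul_eq_mul]
      exact Nat.mul_le_mul_right _ hcard

/-- At a leaf with a parent, a sum over incident edges has a single term. So the stored sums of
neighbours and of edge numbers are the parent and the edge to it. -/
theorem edgeSum_leaf {R : Finset ℕ} {x : ℕ} (hx : x ∈ R) (h0 : x ≠ 0)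
    (h1 : edgeSum par R (fun _ => 1) (fun _ => 1) x = 1) :
    (∀ y ∈ R, y ≠ 0 → par y ≠ x) ∧ ∀ A B, edgeSum par R A B x = A x := by
  rw [edgeSum_erase hx h0, if_pos rfl] at h1
  have h2 : par x ≠ x := by
    intro h
    rw [if_pos h] at h1
    omega
  rw [if_neg h2] at h1
  have h3 : edgeSum par (R.erase x) (fun _ => 1) (fun _ => 1) x = 0 := by omega
  rw [edgeSum, Finset.sum_eq_zero_iff] at h3
  have h4 : ∀ y ∈ R, y ≠ 0 → par y ≠ x := by
    intro y hy hy0 h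
    by_cases hyx : y = x
    · exact h2 (hyx ▸ h)
    · have := h3 y (by simp [hy, hy0, hyx])
      rw [if_pos h] at this
      omega
  refine ⟨h4, fun A B => ?_⟩
  rw [edgeSum_erase hx h0, if_pos rfl, if_neg h2, edgeSum, Finset.sum_eq_zero, add_zero, add_zero]
  intro y hy
  simp only [Finset.mem_erase] at hy
  rw [if_neg hy.2.1, if_neg (h4 y hy.2.2 hy.1), add_zero]

/-- The state of the leaf-stripping procedure: the vertices in `R` remain. -/
structure Strip (n : ℕ) (par eid : ℕ → ℕ) (R : Finset ℕ) (deg sN sE siz pr pe ord : ℕ → ℕ)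
    (cnt : ℕ) : Prop where
  lt : ∀ x ∈ R, x < n
  root : 0 ∈ R
  closed : ∀ x ∈ R, par x ∈ R
  card : cnt + R.card = n
  -- The extra 2 at the root keeps its recorded degree away from 1, so the root is never stripped.
  deg_eq : ∀ x ∈ R, deg x =
    (if x = 0 then 2 else 0) + edgeSum par R (fun _ => 1) (fun _ => 1) x
  deg_zero : ∀ x < n, x ∉ R → deg x = 0
  sN_eq : ∀ x ∈ R, sN x = edgeSum par R par (fun y => y) x
  sE_eq : ∀ x ∈ R, sE x = edgeSum par R eid eid x
  siz_eq : ∀ x < n, siz x = 1 + ∑ y ∈ (Finset.range n).erase 0,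
    if par y = x ∧ y ∉ R then subtreeSize n par y else 0
  pr_eq : ∀ x < n, x ∉ R → pr x = par x ∧ pe x = eid x
  ord_iff : ∀ x < n, x ∉ R ↔ ∃ t < cnt, ord t = x
  ord_lt : ∀ t < cnt, ord t < n
  ord_par : ∀ t < cnt, par (ord t) ∈ R ∨ ∃ s, t < s ∧ s < cnt ∧ ord s = par (ord t)
  ord_inj : ∀ s t, s < t → t < cnt → ord s ≠ ord t

variable {eid deg sN sE siz pr pe ord : ℕ → ℕ} {R : Finset ℕ} {cnt : ℕ}

theorem Strip.siz_le (h : Strip n par eid R deg sN sE siz pr pe ord cnt) (hr : Rooted n par dep)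
    {x : ℕ} (hx : x < n) : siz x ≤ subtreeSize n par x := by
  rw [h.siz_eq x hx, hr.subtreeSize_eq hx]
  gcongr with y hy
  split_ifs with h1 h2 h2
  · exact le_rfl
  · exact absurd h1.1 h2
  · exact Nat.zero_le _
  · exact le_rfl

theorem Strip.leaf (h : Strip n par eid R deg sN sE siz pr pe ord cnt) (hr : Rooted n par dep)
    {x : ℕ} (hx : x < n) (h1 : deg x = 1) :
    x ∈ R ∧ x ≠ 0 ∧ par x ∈ R ∧ par x < n ∧ par x ≠ x ∧ cnt < n ∧ sN x = par x ∧ sE x = eid x ∧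
      siz x = subtreeSize n par x ∧ 1 ≤ deg (par x) ∧ ∀ y ∈ R, y ≠ 0 → par y ≠ x := by
  have hxR : x ∈ R := by
    by_contra hc
    rw [h.deg_zero x hx hc] at h1
    omega
  have hx0 : x ≠ 0 := by
    rintro rfl
    rw [h.deg_eq 0 hxR, if_pos rfl] at h1
    omega
  have hp := h.closed x hxR
  have h2 := h.deg_eq x hxR
  rw [h1, if_neg hx0, zero_add] at h2
  obtain ⟨h3, h4⟩ := edgeSum_leaf hxR hx0 h2.symm
  refine ⟨hxR, hx0, hp, h.lt _ hp, hr.par_ne hx hx0, ?_, ?_, ?_, ?_, ?_, h3⟩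
  · have := h.card
    have := Finset.card_pos.2 ⟨x, hxR⟩
    omega
  · rw [h.sN_eq x hxR, h4]
  · rw [h.sE_eq x hxR, h4]
  · rw [h.siz_eq x hx, hr.subtreeSize_eq hx]
    congr 1
    refine Finset.sum_congr rfl fun y hy => ?_
    have : par y = x → y ∉ R := fun h5 h6 => h3 y h6 (Finset.ne_of_mem_erase hy) h5
    by_cases h5 : par y = x
    · simp [h5, this h5]
    · simp [h5]
  · rw [h.deg_eq _ hp, edgeSum_erase hxR hx0, if_pos (rfl : par x = par x)]
    omega

/-- Removing a leaf subtracts its edge from the three sums at the parent. Its accumulated size is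
complete at this moment, since all its children went before, and is added to that of the parent. -/
theorem Strip.step (h : Strip n par eid R deg sN sE siz pr pe ord cnt) (hr : Rooted n par dep)
    {x : ℕ} (hx : x < n) (h1 : deg x = 1) :
    Strip n par eid (R.erase x)
      (Function.update (Function.update deg x 0) (par x) (deg (par x) - 1))
      (Function.update sN (par x) (sN (par x) - x))
      (Function.update sE (par x) (sE (par x) - eid x))
      (Function.update siz (par x) (siz (par x) + siz x))
      (Function.update pr x (par x)) (Function.update pe x (eid x)) (Function.update ord cnt x)
      (cnt + 1) := by
  obtain ⟨hxR, hx0, hpR, hp, hpx, hcnt, -, -, hsiz, hdeg, hch⟩ := h.leaf hr hx h1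
  have hne : ∀ w ∈ R.erase x, w ≠ x := fun w hw => Finset.ne_of_mem_erase hw
  have hmem : ∀ w ∈ R.erase x, w ∈ R := fun w hw => Finset.mem_of_mem_erase hw
  have hsum : ∀ (A B : ℕ → ℕ) (w : ℕ), w ∈ R.erase x → edgeSum par R A B w =
      (if par x = w then B x else 0) + edgeSum par (R.erase x) A B w := by
    intro A B w hw
    rw [edgeSum_erase hxR hx0, if_neg (hne w hw).symm, zero_add]
  refine ⟨fun w hw => h.lt w (hmem w hw), by simp [h.root, Ne.symm hx0], fun w hw => ?_, ?_,
    fun w hw => ?_, fun w hw hwR => ?_, fun w hw => ?_, fun w hw => ?_, fun w hw => ?_,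
    fun w hw hwR => ?_, fun w hw => ?_, fun t ht => ?_, fun t ht => ?_, fun s t hst ht => ?_⟩
  · refine Finset.mem_erase.2 ⟨?_, h.closed w (hmem w hw)⟩
    by_cases hw0 : w = 0
    · rw [hw0, hr.par_zero]
      exact hx0.symm
    · exact hch w (hmem w hw) hw0
  · have := h.card
    rw [Finset.card_erase_of_mem hxR]
    have := Finset.card_pos.2 ⟨x, hxR⟩
    omega
  · have h2 := h.deg_eq w (hmem w hw)
    rw [hsum _ _ w hw] at h2
    by_cases hwp : w = par x
    · rw [hwp, Function.update_self]
      rw [hwp, if_pos rfl] at h2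
      omega
    · rw [Function.update_of_ne hwp, Function.update_of_ne (hne w hw), h2,
        if_neg (Ne.symm hwp), zero_add]
  · have hwp : w ≠ par x := by
      rintro rfl
      exact hwR (Finset.mem_erase.2 ⟨hpx, hpR⟩)
    rw [Function.update_of_ne hwp]
    by_cases hwx : w = x
    · rw [hwx, Function.update_self]
    · rw [Function.update_of_ne hwx]
      exact h.deg_zero w hw fun hc => hwR (Finset.mem_erase.2 ⟨hwx, hc⟩)
  · have h2 := h.sN_eq w (hmem w hw)
    rw [hsum _ _ w hw] at h2
    by_cases hwp : w = par x
    · rw [hwp, Function.update_self]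
      rw [hwp, if_pos rfl] at h2
      omega
    · rw [Function.update_of_ne hwp, h2, if_neg (Ne.symm hwp), zero_add]
  · have h2 := h.sE_eq w (hmem w hw)
    rw [hsum _ _ w hw] at h2
    by_cases hwp : w = par x
    · rw [hwp, Function.update_self]
      rw [hwp, if_pos rfl] at h2
      omega
    · rw [Function.update_of_ne hwp, h2, if_neg (Ne.symm hwp), zero_add]
  · have hx' : x ∈ (Finset.range n).erase 0 := by simp [hx, hx0]
    have h2 := h.siz_eq w hw
    rw [← Finset.add_sum_erase _ _ hx', if_neg (fun hc => hc.2 hxR), zero_add] at h2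
    rw [← Finset.add_sum_erase _ _ hx']
    have h3 : ∑ y ∈ ((Finset.range n).erase 0).erase x,
        (if par y = w ∧ y ∉ R.erase x then subtreeSize n par y else 0) =
        ∑ y ∈ ((Finset.range n).erase 0).erase x,
        if par y = w ∧ y ∉ R then subtreeSize n par y else 0 := by
      refine Finset.sum_congr rfl fun y hy => ?_
      simp [Finset.ne_of_mem_erase hy]
    rw [h3]
    by_cases hwp : w = par x
    · subst hwp
      rw [Function.update_self, if_pos ⟨rfl, by simp⟩, h2, hsiz]
      ring
    · rw [Function.update_of_ne hwp, if_neg (fun hc => hwp hc.1.symm), h2, zero_add]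
  · by_cases hwx : w = x
    · simp [hwx]
    · rw [Function.update_of_ne hwx, Function.update_of_ne hwx]
      exact h.pr_eq w hw fun hc => hwR (Finset.mem_erase.2 ⟨hwx, hc⟩)
  · by_cases hwx : w = x
    · subst hwx
      simp only [Finset.mem_erase, ne_eq, not_true_eq_false, false_and, not_false_eq_true, true_iff]
      exact ⟨cnt, by omega, Function.update_self _ _ _⟩
    · rw [Finset.mem_erase, not_and_or, not_not, or_iff_right hwx, h.ord_iff w hw]
      constructor
      · rintro ⟨t, ht, h2⟩
        exact ⟨t, by omega, by rwa [Function.update_of_ne (by omega)]⟩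
      · rintro ⟨t, ht, h2⟩
        have htc : t ≠ cnt := by
          rintro rfl
          rw [Function.update_self] at h2
          exact hwx h2.symm
        exact ⟨t, by omega, by rwa [Function.update_of_ne htc] at h2⟩
  · by_cases htc : t = cnt
    · rw [htc, Function.update_self]
      exact hx
    · rw [Function.update_of_ne htc]
      exact h.ord_lt t (by omega)
  · by_cases htc : t = cnt
    · rw [htc, Function.update_self]
      exact Or.inl (Finset.mem_erase.2 ⟨hpx, hpR⟩)
    · rw [Function.update_of_ne htc]
      rcases h.ord_par t (by omega) with h2 | ⟨s, h2, h3, h4⟩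
      · by_cases h5 : par (ord t) = x
        · exact Or.inr ⟨cnt, by omega, by omega, by rw [Function.update_self, h5]⟩
        · exact Or.inl (Finset.mem_erase.2 ⟨h5, h2⟩)
      · exact Or.inr ⟨s, h2, by omega, by rwa [Function.update_of_ne (by omega)]⟩
  · rw [Function.update_of_ne (by omega)]
    by_cases htc : t = cnt
    · rw [htc, Function.update_self]
      rintro rfl
      exact (h.ord_iff _ hx).2 ⟨s, by omega, rfl⟩ hxR
    · rw [Function.update_of_ne htc]
      exact h.ord_inj s t hst (by omega)

/-- When no leaves remain, only the root remains. -/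
theorem Strip.finish (h : Strip n par eid R deg sN sE siz pr pe ord cnt) (hr : Rooted n par dep)
    (hdeg : ∀ x < n, deg x ≠ 1) : R = {0} := by
  by_contra hR
  have hne : (R.erase 0).Nonempty := by
    rw [Finset.nonempty_iff_ne_empty]
    intro he
    refine hR (Finset.ext fun y => ⟨fun hy => ?_, fun hy => ?_⟩)
    · by_contra hy0
      have : y ∈ R.erase 0 := Finset.mem_erase.2 ⟨by simpa using hy0, hy⟩
      rw [he] at this
      simp at this
    · rw [Finset.mem_singleton.1 hy]
      exact h.root
  -- A deepest remaining vertex has no remaining children and would be a leaf.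
  obtain ⟨x, hx, hmax⟩ := Finset.exists_max_image _ dep hne
  obtain ⟨hx0, hxR⟩ := Finset.mem_erase.1 hx
  have hxn := h.lt x hxR
  refine hdeg x hxn ?_
  rw [h.deg_eq x hxR, if_neg hx0, zero_add, edgeSum_erase hxR hx0, if_pos rfl,
    if_neg (hr.par_ne hxn hx0), edgeSum, Finset.sum_eq_zero, add_zero]
  intro y hy
  simp only [Finset.mem_erase] at hy
  have hpy : par y ≠ x := by
    intro hpy
    have h1 := hr.dep_par y (h.lt y hy.2.2) hy.1
    have h2 := hmax y (by simp [hy])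
    rw [hpy] at h1
    omega
  rw [if_neg hy.2.1, if_neg hpy, add_zero]

end strip

end CutMerge

/-! ### The linear-time rooting programs. -/

namespace CutMerge

/-! ### The programs that root a tree -/

def initTreeProg : Stmt :=
  .upTo .x Var.n (.put .deg Var.x 0 ;; .put .sN Var.x 0 ;; .put .sE Var.x 0 ;; .put .siz Var.x 1) ;;
  .put .deg 0 2

/-- For every vertex of tree `i`, find its degree (increased by two for the root) and the sums of
its neighbours and of the numbers of its edges. -/
def degreesProg : Stmt :=
  .upTo .j Var.m (.id ::= Var.i * Var.m + Var.j ;;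
    .u ::= .get .io (2 * Var.id) ;;
    .v ::= .get .io (2 * Var.id + 1) ;;
    .put .deg Var.u (.get .deg Var.u + 1) ;;
    .put .deg Var.v (.get .deg Var.v + 1) ;;
    .put .sN Var.u (.get .sN Var.u + Var.v) ;;
    .put .sN Var.v (.get .sN Var.v + Var.u) ;;
    .put .sE Var.u (.get .sE Var.u + Var.id) ;;
    .put .sE Var.v (.get .sE Var.v + Var.id))

/-- Remove the leaf `x`. -/
def stripLeafProg : Stmt :=
  .p ::= .get .sN Var.x ;;
  .e ::= .get .sE Var.x ;;
  .put .pr Var.x Var.p ;;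
  .put .pe Var.x Var.e ;;
  .put .ord Var.cnt Var.x ;;
  .cnt ::= Var.cnt + 1 ;;
  .put .deg Var.x 0 ;;
  .put .deg Var.p (.get .deg Var.p - 1) ;;
  .put .sN Var.p (.get .sN Var.p - Var.x) ;;
  .put .sE Var.p (.get .sE Var.p - Var.e) ;;
  .put .siz Var.p (.get .siz Var.p + .get .siz Var.x) ;;
  .x ::= Var.p

/-- Removing a leaf can create a new leaf only at its parent, and the inner loop continues there at
once. Hence a single scan over the vertices leaves no leaf behind. -/
def stripProg : Stmt :=
  .cnt ::= 0 ;;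
  .upTo .v Var.n (.x ::= Var.v ;; .loop (.eq (.get .deg Var.x) 1) stripLeafProg)

/-- The stored orientation of an edge is arbitrary; symmetry of `F` allows sums over the list to be
reindexed by child vertices. -/
theorem Family.sum_edges {n k i : ℕ} (D : Family n k) (hi : i < k) (F : ℕ → ℕ → ℕ → ℕ)
    (hF : ∀ u v f, F u v f = F v u f) :
    ∑ j ∈ Finset.range (n - 1),
      F (D.U (i * (n - 1) + j)) (D.V (i * (n - 1) + j)) (i * (n - 1) + j) =
    ∑ y ∈ (Finset.range n).erase 0, F y (D.par i y) (D.eid i y) := by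
  have hi1 : (i + 1) * (n - 1) = i * (n - 1) + (n - 1) := by ring
  refine Finset.sum_bij' (fun j _ => D.ch (i * (n - 1) + j)) (fun y _ => D.eid i y - i * (n - 1))
    (fun j hj => ?_) (fun y hy => ?_) (fun j hj => ?_) (fun y hy => ?_) (fun j hj => ?_)
  all_goals simp only [Finset.mem_range, Finset.mem_erase] at *
  · have := D.ch_spec i hi (i * (n - 1) + j) (by omega) (by omega)
    omega
  · have := D.eid_spec i hi y (by omega) hy.2
    omega
  · have := D.ch_spec i hi (i * (n - 1) + j) (by omega) (by omega)
    omega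
  · have := D.eid_spec i hi y (by omega) hy.2
    rw [Nat.add_sub_cancel' this.1, this.2.2]
  · obtain ⟨h1, h2, h3⟩ := D.ch_spec i hi (i * (n - 1) + j) (by omega) (by omega)
    have h4 := D.ends i hi _ h1 h2
    rw [h3] at h4 ⊢
    rcases h4 with ⟨h4, h5⟩ | ⟨h4, h5⟩
    · rw [h4, h5]
    · rw [h4, h5, hF]

theorem update_add_add (d : ℕ → ℕ) (u v a b x : ℕ) :
    Function.update (Function.update d u (d u + a)) v (Function.update d u (d u + a) v + b) x =
      d x + ((if u = x then a else 0) + if v = x then b else 0) := by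
  by_cases hv : v = x
  · subst hv
    rw [Function.update_self, if_pos rfl]
    by_cases hu : u = v
    · subst hu
      rw [Function.update_self, if_pos rfl, add_assoc]
    · rw [Function.update_of_ne (Ne.symm hu), if_neg hu, zero_add]
  · rw [Function.update_of_ne (Ne.symm hv), if_neg hv, add_zero]
    by_cases hu : u = x
    · subst hu
      rw [Function.update_self, if_pos rfl]
    · rw [Function.update_of_ne (Ne.symm hu), if_neg hu, add_zero]

theorem update_add_le {d : ℕ → ℕ} {u v a n c : ℕ} (hd : ∀ x < n, d x ≤ c) (hu : u < n)
    (hv : v < n) : Function.update d u (d u + a) v ≤ c + a := by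
  by_cases h : v = u
  · rw [h, Function.update_self]
    exact Nat.add_le_add_right (hd u hu) _
  · rw [Function.update_of_ne h]
    exact (hd v hv).trans (Nat.le_add_right _ _)

theorem sum_range_le {a c : ℕ} {g : ℕ → ℕ} (h : ∀ j < a, g j ≤ c) :
    ∑ j ∈ Finset.range a, g j ≤ a * c := by
  have := Finset.sum_le_card_nsmul (Finset.range a) g c fun j hj => h j (Finset.mem_range.1 hj)
  simpa using this

section tree

variable {Z n k i : ℕ} {D : Family n k} {σ : Store}

theorem initTree_wp (hn : σ.var .n = n) (hZ : n + 2 < Z) :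
    Wp Z initTreeProg σ fun t σ' => t ≤ 6 * n + 3 ∧ ∀ x < n,
      σ'.arr .deg x = (if x = 0 then 2 else 0) ∧ σ'.arr .sN x = 0 ∧ σ'.arr .sE x = 0 ∧
      σ'.arr .siz x = 1 := by
  rw [initTreeProg, wp_seq]
  refine Wp.upTo n 4 (by omega) (fun a τ => ∀ x < a, τ.arr .deg x = 0 ∧ τ.arr .sN x = 0 ∧
    τ.arr .sE x = 0 ∧ τ.arr .siz x = 1) ?_ (by simp) ?_ ?_
  · intro τ hs
    simp [hs.var .n, hn]
  · intro a τ ha hs hv h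
    simp [hv]
    and_intros
    any_goals omega
    intro x hx
    by_cases hxa : x = a
    · subst hxa
      simp
    · simpa [Function.update_of_ne hxa] using h x (by omega)
  · intro t τ ht hs h
    simp
    and_intros
    any_goals omega
    intro x hx
    by_cases hx0 : x = 0
    · subst hx0
      simp [h 0 hx]
    · simp [hx0, h x hx]

theorem degrees_wp (hn : σ.var .n = n) (hm : σ.var .m = n - 1) (hi : σ.var .i = i) (hik : i < k)
    (hio : ∀ f < k * (n - 1), σ.arr .io (2 * f) = D.U f ∧ σ.arr .io (2 * f + 1) = D.V f)
    (h0 : ∀ x < n, σ.arr .deg x = (if x = 0 then 2 else 0) ∧ σ.arr .sN x = 0 ∧ σ.arr .sE x = 0 ∧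
      σ.arr .siz x = 1)
    (hZ : k * (2 * n) * (2 * n) + 10 * (k * n) + 20 < Z) :
    Wp Z degreesProg σ fun t σ' => t ≤ 11 * n + 2 ∧
      Strip n (D.par i) (D.eid i) (Finset.range n) (σ'.arr .deg) (σ'.arr .sN) (σ'.arr .sE)
        (σ'.arr .siz) (σ'.arr .pr) (σ'.arr .pe) (σ'.arr .ord) 0 := by
  have hkn : n ≤ k * n := Nat.le_mul_of_pos_left n D.k_pos
  have hk : (i + 1) * (n - 1) ≤ k * (n - 1) := Nat.mul_le_mul_right _ hik
  have hk' : k * (n - 1) ≤ k * n := Nat.mul_le_mul_left _ (Nat.sub_le _ _)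
  have hi1 : (i + 1) * (n - 1) = i * (n - 1) + (n - 1) := by ring
  -- Each of the fewer than n edges adds at most 2kn to a sum, so intermediate values stay within
  -- the room provided for the tables.
  have hnn : n * (2 * (k * n)) ≤ k * (2 * n) * (2 * n) := by
    have : k * (2 * n) * (2 * n) = n * (4 * (k * n)) := by ring
    rw [this]
    gcongr
    omega
  refine Wp.upTo (n - 1) 9 (by omega) (fun a τ => ∀ x < n,
    τ.arr .deg x = (if x = 0 then 2 else 0) + ∑ j ∈ Finset.range a,
      ((if D.U (i * (n - 1) + j) = x then 1 else 0) + if D.V (i * (n - 1) + j) = x then 1 else 0) ∧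
    τ.arr .sN x = ∑ j ∈ Finset.range a,
      ((if D.U (i * (n - 1) + j) = x then D.V (i * (n - 1) + j) else 0) +
        if D.V (i * (n - 1) + j) = x then D.U (i * (n - 1) + j) else 0) ∧
    τ.arr .sE x = ∑ j ∈ Finset.range a,
      ((if D.U (i * (n - 1) + j) = x then i * (n - 1) + j else 0) +
        if D.V (i * (n - 1) + j) = x then i * (n - 1) + j else 0)) ?_ ?_ ?_ ?_
  · intro τ hs
    simp [hs.var .m, hm]
  · intro x hx
    simp [h0 x hx]
  · intro a τ ha hs hv h
    have hf : i * (n - 1) + a < k * (n - 1) := by omega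
    obtain ⟨e1, e2⟩ := hio _ hf
    obtain ⟨e3, e4⟩ := D.ends_lt hf
    have v1 := hs.var .i
    have v2 := hs.var .m
    have v4 := hs.arr .io
    have hlt : ∀ j < a, i * (n - 1) + j < k * n ∧ D.U (i * (n - 1) + j) < n ∧
        D.V (i * (n - 1) + j) < n := by
      intro j hj
      obtain ⟨g1, g2⟩ := D.ends_lt (f := i * (n - 1) + j) (by omega)
      exact ⟨by omega, g1, g2⟩
    have hle : a * (2 * (k * n)) + 2 * (k * n) ≤ n * (2 * (k * n)) := by
      have : (a + 1) * (2 * (k * n)) ≤ n * (2 * (k * n)) := Nat.mul_le_mul_right _ (by omega)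
      rwa [add_mul, one_mul] at this
    have b1 : ∀ x < n, τ.arr .deg x ≤ a * (2 * (k * n)) + 2 := by
      intro x hx
      rw [(h x hx).1, add_comm]
      refine Nat.add_le_add (sum_range_le fun j hj => ?_) (by split_ifs <;> omega)
      have := hlt j hj
      split_ifs <;> omega
    have b2 : ∀ x < n, τ.arr .sN x ≤ a * (2 * (k * n)) := by
      intro x hx
      rw [(h x hx).2.1]
      refine sum_range_le fun j hj => ?_
      have := hlt j hj
      split_ifs <;> omega
    have b3 : ∀ x < n, τ.arr .sE x ≤ a * (2 * (k * n)) := by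
      intro x hx
      rw [(h x hx).2.2]
      refine sum_range_le fun j hj => ?_
      have := hlt j hj
      split_ifs <;> omega
    have c1 := update_add_le (a := 1) b1 e3 e4
    have c2 := update_add_le (a := D.V (i * (n - 1) + a)) b2 e3 e4
    have c3 := update_add_le (a := i * (n - 1) + a) b3 e3 e4
    have d1 := b1 _ e3
    have d2 := b2 _ e3
    have d3 := b3 _ e3
    simp [v1, v2, v4, hv, hm, hi, e1, e2]
    and_intros
    any_goals omega
    intro x hx
    obtain ⟨h1, h2, h3⟩ := h x hx
    rw [update_add_add, update_add_add, update_add_add, Finset.sum_range_succ,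
      Finset.sum_range_succ, Finset.sum_range_succ, h1, h2, h3, add_assoc]
    exact ⟨rfl, rfl, rfl⟩
  · intro t τ ht hs h
    have g1 := fun x => D.sum_edges hik (fun u v _ => (if u = x then 1 else 0) +
      if v = x then 1 else 0) fun _ _ _ => add_comm _ _
    have g2 := fun x => D.sum_edges hik (fun u v _ => (if u = x then v else 0) +
      if v = x then u else 0) fun _ _ _ => add_comm _ _
    have g3 := fun x => D.sum_edges hik (fun u v f => (if u = x then f else 0) +
      if v = x then f else 0) fun _ _ _ => add_comm _ _
    refine ⟨by omega, ?_, ?_, ?_, ?_, ?_, ?_, ?_, ?_, ?_, ?_, ?_, ?_, ?_, ?_⟩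
    · simp
    · simpa using D.n_pos
    · simpa using (D.rooted i hik).par_lt
    · simp
    · intro x hx
      rw [(h x (by simpa using hx)).1, g1]
      rfl
    · intro x hx hx'
      simp [hx] at hx'
    · intro x hx
      rw [(h x (by simpa using hx)).2.1, g2]
      rfl
    · intro x hx
      rw [(h x (by simpa using hx)).2.2, g3]
      rfl
    · intro x hx
      rw [hs.arr .siz, (h0 x hx).2.2.2, Finset.sum_eq_zero, add_zero]
      intro y hy
      rw [if_neg]
      exact fun hc => hc.2 (Finset.mem_of_mem_erase hy)
    · intro x hx hx'
      simp [hx] at hx'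
    · intro x hx
      simp [hx]
    · simp
    · simp
    · simp

theorem stripLeaf_wp {R : Finset ℕ} {x : ℕ} (hik : i < k) (hxv : σ.var .x = x) (hx : x < n)
    (hdeg : σ.arr .deg x = 1)
    (h : Strip n (D.par i) (D.eid i) R (σ.arr .deg) (σ.arr .sN) (σ.arr .sE)
        (σ.arr .siz) (σ.arr .pr) (σ.arr .pe) (σ.arr .ord) (σ.var .cnt))
    (hZ : k * (2 * n) * (2 * n) + 10 * (k * n) + 20 < Z) :
    Wp Z stripLeafProg σ fun t σ' => t = 12 ∧ σ'.var .x = D.par i x ∧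
      σ'.var .cnt = σ.var .cnt + 1 ∧
      σ'.arr .deg = Function.update (Function.update (σ.arr .deg) x 0) (D.par i x)
        (σ.arr .deg (D.par i x) - 1) ∧
      Strip n (D.par i) (D.eid i) (R.erase x) (σ'.arr .deg) (σ'.arr .sN) (σ'.arr .sE)
        (σ'.arr .siz) (σ'.arr .pr) (σ'.arr .pe) (σ'.arr .ord) (σ'.var .cnt) := by
  have hkn : n ≤ k * n := Nat.le_mul_of_pos_left n D.k_pos
  have hk' : k * (n - 1) ≤ k * n := Nat.mul_le_mul_left _ (Nat.sub_le _ _)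
  have hnn : n * (2 * (k * n)) ≤ k * (2 * n) * (2 * n) := by
    have : k * (2 * n) * (2 * n) = n * (4 * (k * n)) := by ring
    rw [this]
    gcongr
    omega
  have hr := D.rooted i hik
  obtain ⟨hxR, hx0, hpR, hp, hpx, hcnt, hN, hE, -, -, -⟩ := h.leaf hr hx hdeg
  have hstep := h.step hr hx hdeg
  have s1 := (h.siz_le hr hx).trans (subtreeSize_le x)
  have s2 := (h.siz_le hr hp).trans (subtreeSize_le (D.par i x))
  have b1 : σ.arr .deg (D.par i x) ≤ 2 + n * (2 * (k * n)) := by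
    rw [h.deg_eq _ hpR]
    refine Nat.add_le_add (by split_ifs <;> omega) (edgeSum_le h.lt (fun y _ _ => ?_) _)
    have := D.n_pos
    omega
  have b2 : σ.arr .sN (D.par i x) ≤ n * (2 * (k * n)) := by
    rw [h.sN_eq _ hpR]
    refine edgeSum_le h.lt (fun y hy _ => ?_) _
    have := hr.par_lt y (h.lt y hy)
    have := h.lt y hy
    omega
  have b3 : σ.arr .sE (D.par i x) ≤ n * (2 * (k * n)) := by
    rw [h.sE_eq _ hpR]
    refine edgeSum_le h.lt (fun y hy hy0 => ?_) _
    have := D.eid_lt hik (Nat.pos_of_ne_zero hy0) (h.lt y hy)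
    omega
  simp [stripLeafProg, hxv, hN, hE, Function.update_of_ne hpx]
  and_intros
  any_goals omega

theorem strip_wp (hik : i < k) (hn : σ.var .n = n)
    (h : Strip n (D.par i) (D.eid i) (Finset.range n) (σ.arr .deg) (σ.arr .sN) (σ.arr .sE)
        (σ.arr .siz) (σ.arr .pr) (σ.arr .pe) (σ.arr .ord) 0)
    (hZ : k * (2 * n) * (2 * n) + 10 * (k * n) + 20 < Z) :
    Wp Z stripProg σ fun t σ' => t ≤ 17 * n + 3 ∧
      Strip n (D.par i) (D.eid i) {0} (σ'.arr .deg) (σ'.arr .sN) (σ'.arr .sE)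
        (σ'.arr .siz) (σ'.arr .pr) (σ'.arr .pe) (σ'.arr .ord) (n - 1) := by
  have hkn : n ≤ k * n := Nat.le_mul_of_pos_left n D.k_pos
  have hr := D.rooted i hik
  rw [stripProg, wp_seq, wp_assign]
  refine ⟨by simp; omega, ?_⟩
  -- Each removal costs 12 steps and a test, and `cnt` counts removals over the whole scan; a
  -- scanned vertex costs 4 steps besides. Total time is thus linear although single iterations may
  -- be long.
  refine Wp.upTo_of_cost n (by omega) (fun a t τ => t ≤ 4 * a + 13 * τ.var .cnt ∧
    (∀ y < a, τ.arr .deg y ≠ 1) ∧ ∃ R, Strip n (D.par i) (D.eid i) R (τ.arr .deg) (τ.arr .sN)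
      (τ.arr .sE) (τ.arr .siz) (τ.arr .pr) (τ.arr .pe) (τ.arr .ord) (τ.var .cnt)) ?_ ?_ ?_ ?_
  · intro τ hs
    simp [hs.var .n, hn]
  · exact ⟨by simp, by simp, Finset.range n, by simpa using h⟩
  · rintro a t τ ha hs hv ⟨ht, hdeg, R, hR⟩
    rw [wp_seq, wp_assign]
    refine ⟨trivial, ?_⟩
    refine Wp.loop (fun t' τ' => t' + 13 * τ.var .cnt ≤ 13 * τ'.var .cnt ∧ τ'.var .x < n ∧
      (∀ y ≤ a, τ'.arr .deg y = 1 → y = τ'.var .x) ∧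
      ∃ R, Strip n (D.par i) (D.eid i) R (τ'.arr .deg) (τ'.arr .sN)
      (τ'.arr .sE) (τ'.arr .siz) (τ'.arr .pr) (τ'.arr .pe) (τ'.arr .ord) (τ'.var .cnt))
      (fun τ' => n - τ'.var .cnt) ?_ ?_ ?_ ?_
    · refine ⟨by simp, by simpa [hv] using ha, fun y hy hy1 => ?_, R, by simpa using hR⟩
      simp at hy1
      simp [hv]
      by_contra hya
      exact hdeg y (by omega) hy1
    · rintro t' τ' hs' ⟨-, hx, -⟩
      simp
      omega
    · rintro t' τ' hs' ⟨ht', hx, hy, R', hR'⟩ h1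
      have h1 : τ'.arr .deg (τ'.var .x) = 1 := h1
      have hleaf := hR'.leaf hr hx h1
      refine (stripLeaf_wp hik rfl hx h1 hR' hZ).mono ?_
      rintro t'' τ'' - ⟨e1, e2, e3, e4, e5⟩
      have hcard := e5.card
      refine ⟨⟨by omega, ?_, fun y hya hy1 => ?_, _, e5⟩, by omega⟩
      · rw [e2]
        exact hleaf.2.2.2.1
      · rw [e2]
        by_contra hyp
        rw [e4, Function.update_of_ne hyp] at hy1
        by_cases hyx : y = τ'.var .x
        · rw [hyx, Function.update_self] at hy1
          omega
        · rw [Function.update_of_ne hyx] at hy1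
          exact hyx (hy y hya hy1)
    · rintro t' τ' hs' ⟨ht', hx, hy, R', hR'⟩ h1
      have h1 : τ'.arr .deg (τ'.var .x) ≠ 1 := h1
      simp
      refine ⟨by omega, fun y hya hy1 => ?_, R', hR'⟩
      rw [← hy y (by omega) hy1] at h1
      exact h1 hy1
  · rintro t τ hs ⟨ht, hdeg, R, hR⟩
    have hR0 := hR.finish hr hdeg
    subst hR0
    have hc := hR.card
    rw [Finset.card_singleton] at hc
    have hc' : τ.var .cnt = n - 1 := by omega
    rw [hc'] at hR
    exact ⟨by omega, hR⟩

end tree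

end CutMerge

/-! ### Selecting the two smallest best cuts around each vertex. -/

namespace CutMerge

/-! ### The two smallest elements of a set -/

/-- Insert a number into a pair of the two smallest elements. -/
def insertTwo (z : ℕ) (p : ℕ × ℕ) : ℕ × ℕ :=
  if z < p.1 then (z, p.1) else if z < p.2 then (p.1, z) else p

namespace Family

theorem LeastTwo.congr {S S' : ℕ → Prop} {t a b : ℕ} (h : LeastTwo S t a b)
    (hS : ∀ z, S' z ↔ S z) : LeastTwo S' t a b := by
  obtain rfl : S' = S := funext fun z => propext (hS z)
  exact h

theorem LeastTwo.insert {S : ℕ → Prop} {t z : ℕ} {p : ℕ × ℕ} (h : LeastTwo S t p.1 p.2)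
    (hz : ¬ S z) :
    LeastTwo (fun c => S c ∨ (c = z ∧ z < t)) t (insertTwo z p).1 (insertTwo z p).2 := by
  obtain ⟨a, b⟩ := p
  obtain ⟨h1, h2, h3, h4, h5, h6⟩ := h
  simp only at *
  have hza : a < t → z ≠ a := fun hlt he => hz (he ▸ h4 hlt)
  have hlt : ∀ c, S c ∨ (c = z ∧ z < t) → c < t := by
    rintro c (hc | ⟨rfl, hc⟩)
    · exact h1 c hc
    · exact hc
  rw [insertTwo]
  simp only
  split_ifs with g1 g2
  · refine ⟨hlt, g1.le, h2.trans h3, fun _ => Or.inr ⟨rfl, by omega⟩,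
      fun hc => ⟨Or.inl (h4 hc), g1⟩, ?_⟩
    rintro c (hc | ⟨rfl, -⟩)
    · rcases h6 c hc with rfl | h7
      · exact Or.inr le_rfl
      · exact Or.inr (h2.trans h7)
    · exact Or.inl rfl
  · refine ⟨hlt, by omega, by omega, fun hc => Or.inl (h4 hc), fun hc => ⟨Or.inr ⟨rfl, hc⟩, ?_⟩, ?_⟩
    · have := hza (by omega)
      omega
    · rintro c (hc | ⟨rfl, -⟩)
      · rcases h6 c hc with rfl | h7
        · exact Or.inl rfl
        · exact Or.inr (by omega)
      · exact Or.inr le_rfl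
  · refine ⟨hlt, h2, h3, fun hc => Or.inl (h4 hc), fun hc => ⟨Or.inl (h5 hc).1, (h5 hc).2⟩, ?_⟩
    rintro c (hc | ⟨rfl, -⟩)
    · exact h6 c hc
    · exact Or.inr (by omega)

/-- The two smallest elements of a union are among the two smallest of each part. Disjointness
prevents one number from being counted twice; inserting the dummy value has no effect on the set. -/
theorem LeastTwo.merge {S S' : ℕ → Prop} {t a b : ℕ} {p : ℕ × ℕ} (h : LeastTwo S t p.1 p.2)
    (h' : LeastTwo S' t a b) (hd : ∀ z, S z → ¬ S' z) :
    LeastTwo (fun c => S c ∨ S' c) t (insertTwo b (insertTwo a p)).1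
      (insertTwo b (insertTwo a p)).2 := by
  have ha : ¬ S a := fun hc => hd a hc (h'.fst (h.lt a hc))
  have hb : ¬ (S b ∨ (b = a ∧ a < t)) := by
    rintro (hc | ⟨hc, hlt⟩)
    · exact hd b hc (h'.snd (h.lt b hc)).1
    · have := (h'.snd (hc ▸ hlt)).2
      omega
  have h2 := (h.insert ha).insert hb
  refine ⟨?_, h2.le, h2.le_top, fun hc => ?_, fun hc => ⟨?_, (h2.snd hc).2⟩, ?_⟩
  · rintro z (hz | hz)
    · exact h.lt z hz
    · exact h'.lt z hz
  · rcases h2.fst hc with (h3 | ⟨h3, h4⟩) | ⟨h3, h4⟩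
    · exact Or.inl h3
    · exact Or.inr (by rw [h3]; exact h'.fst h4)
    · exact Or.inr (by rw [h3]; exact (h'.snd h4).1)
  · rcases (h2.snd hc).1 with (h3 | ⟨h3, h4⟩) | ⟨h3, h4⟩
    · exact Or.inl h3
    · exact Or.inr (by rw [h3]; exact h'.fst h4)
    · exact Or.inr (by rw [h3]; exact (h'.snd h4).1)
  · rintro z (hz | hz)
    · exact h2.least z (Or.inl (Or.inl hz))
    · have hzt := h'.lt z hz
      rcases h'.least z hz with rfl | hbz
      · exact h2.least z (Or.inl (Or.inr ⟨rfl, hzt⟩))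
      · have hbt : b < t := by omega
        have hab := (h'.snd hbt).2
        have k1 := h2.least b (Or.inr ⟨rfl, hbt⟩)
        have k2 := h2.least a (Or.inl (Or.inr ⟨rfl, by omega⟩))
        have k3 := h2.le
        omega

theorem LeastTwo.cons {S : ℕ → Prop} {t a b c : ℕ} (h : LeastTwo S t a b) (hc : c < t)
    (hS : ∀ z, S z → c < z) : LeastTwo (fun z => S z ∨ z = c) t c a := by
  refine ⟨?_, ?_, h.le.trans h.le_top, fun _ => Or.inr rfl, fun ha => ⟨Or.inl (h.fst ha),
    hS a (h.fst ha)⟩, ?_⟩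
  · rintro z (hz | rfl)
    · exact h.lt z hz
    · exact hc
  · by_cases ha : a < t
    · exact (hS a (h.fst ha)).le
    · omega
  · rintro z (hz | rfl)
    · have := h.le
      rcases h.least z hz with h1 | h1
      · exact Or.inr h1.ge
      · exact Or.inr (by omega)
    · exact Or.inl rfl

theorem leastTwo_empty {S : ℕ → Prop} {t : ℕ} (h : ∀ z, ¬ S z) : LeastTwo S t t t :=
  ⟨fun z hz => absurd hz (h z), le_rfl, le_rfl, fun h => absurd h (lt_irrefl _),
    fun h => absurd h (lt_irrefl _), fun z hz => absurd hz (h z)⟩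

/-- Bare existence, so that `Flow.best_iff` can be applied to identify the best cuts before their
codes have been computed. -/
theorem exists_leastTwo {S : ℕ → Prop} {t : ℕ} (h : ∀ z, S z → z < t) :
    ∃ a b, LeastTwo S t a b := by
  have key : ∀ u, ∃ p : ℕ × ℕ, LeastTwo (fun z => S z ∧ z < u) t p.1 p.2 := by
    intro u
    induction u with
    | zero => exact ⟨(t, t), leastTwo_empty (by simp)⟩
    | succ u ih =>
      obtain ⟨p, hp⟩ := ih
      by_cases hu : S u
      · refine ⟨_, (hp.insert (z := u) (by simp)).congr fun z => ?_⟩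
        constructor
        · rintro ⟨h1, h2⟩
          by_cases hzu : z = u
          · exact Or.inr ⟨hzu, h u hu⟩
          · exact Or.inl ⟨h1, by omega⟩
        · rintro (⟨h1, h2⟩ | ⟨rfl, h1⟩)
          · exact ⟨h1, by omega⟩
          · exact ⟨hu, by omega⟩
      · refine ⟨p, hp.congr fun z => ?_⟩
        constructor
        · rintro ⟨h1, h2⟩
          have : z ≠ u := by
            rintro rfl
            exact hu h1
          exact ⟨h1, by omega⟩
        · rintro ⟨h1, h2⟩
          exact ⟨h1, by omega⟩
  obtain ⟨p, hp⟩ := key t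
  exact ⟨p.1, p.2, hp.congr fun z => ⟨fun hz => ⟨hz, h z hz⟩, fun hz => hz.1⟩⟩

variable {n k : ℕ} (D : Family n k)

/-- The best cuts are the labels of the flow tree. -/
theorem Flow.best_iff_label {D : Family n k} (hD : D.Laminar) {u v e : ℕ → ℕ}
    (hF : D.Flow k u v e) (f : ℕ) : D.Best f ↔ ∃ j < n, u j ≠ v j ∧ e j = f := by
  have h : ∀ x, ∃ p : ℕ × ℕ, LeastTwo (D.Codes x) (n * (k * n)) p.1 p.2 := by
    intro x
    obtain ⟨a, b, h⟩ := exists_leastTwo (S := D.Codes x) (t := n * (k * n)) (by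
      rintro z ⟨f, hf, -, rfl⟩
      exact D.code_lt hf.1)
    exact ⟨(a, b), h⟩
  choose p hp using h
  exact (hF.best_iff hD (c1 := fun x => (p x).1) (c2 := fun x => (p x).2) fun x _ => hp x).1 f

/-! ### The two smallest best cuts around a vertex in one tree -/

/-- The codes of the best cuts in tree `i` around a vertex. -/
def TreeCodes (i v c : ℕ) : Prop :=
  ∃ q, 0 < q ∧ q < n ∧ D.Best (D.eid i q) ∧ Anc (D.par i) q v ∧ c = D.code (D.eid i q)

theorem size_eid {i x : ℕ} (hi : i < k) (hx0 : 0 < x) (hx : x < n) :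
    D.size (D.eid i x) = subtreeSize n (D.par i) x := by
  classical
  rw [size, subtreeSize]
  congr 1
  exact Finset.filter_congr fun z _ => D.cut_eid hi hx0 hx

theorem code_eid {i x : ℕ} (hi : i < k) (hx0 : 0 < x) (hx : x < n) :
    D.code (D.eid i x) = subtreeSize n (D.par i) x * (k * n) + D.eid i x := by
  rw [code, D.size_eid hi hx0 hx]

theorem treeCodes_iff {i v c : ℕ} (hi : i < k) :
    D.TreeCodes i v c ↔ ∃ f, i * (n - 1) ≤ f ∧ f < (i + 1) * (n - 1) ∧ D.Best f ∧ D.cut f v ∧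
      c = D.code f := by
  constructor
  · rintro ⟨q, h1, h2, h3, h4, h5⟩
    obtain ⟨g1, g2, -⟩ := D.eid_spec i hi q h1 h2
    exact ⟨_, g1, g2, h3, (D.cut_eid hi h1 h2).2 h4, h5⟩
  · rintro ⟨f, h1, h2, h3, h4, h5⟩
    obtain ⟨g1, g2, g3⟩ := D.ch_spec i hi f h1 h2
    refine ⟨D.ch f, g1, g2, by rwa [g3], ?_, by rwa [g3]⟩
    rwa [← D.cut_eid hi g1 g2, g3]

theorem not_treeCodes_zero {i : ℕ} (hi : i < k) (c : ℕ) : ¬ D.TreeCodes i 0 c := by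
  rintro ⟨q, h1, -, -, h4, -⟩
  have := (D.rooted i hi).anc_zero.1 h4
  omega

theorem treeCodes_par {i x c : ℕ} (hx0 : 0 < x) (hx : x < n) :
    D.TreeCodes i x c ↔ D.TreeCodes i (D.par i x) c ∨
      (D.Best (D.eid i x) ∧ c = D.code (D.eid i x)) := by
  constructor
  · rintro ⟨q, h1, h2, h3, h4, h5⟩
    by_cases hq : x = q
    · subst hq
      exact Or.inr ⟨h3, h5⟩
    · exact Or.inl ⟨q, h1, h2, h3, (anc_par_iff hq).2 h4, h5⟩
  · rintro (⟨q, h1, h2, h3, h4, h5⟩ | ⟨h1, h2⟩)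
    · exact ⟨q, h1, h2, h3, h4.trans ⟨1, rfl⟩, h5⟩
    · exact ⟨x, hx0, hx, h1, Anc.refl _ _, h2⟩

/-- A proper ancestor has a strictly larger subtree, and size dominates in the code. So the edge
directly above `x`, if best, is the smallest in this tree. -/
theorem code_lt_of_treeCodes {i x c : ℕ} (hi : i < k) (hx0 : 0 < x) (hx : x < n)
    (hc : D.TreeCodes i (D.par i x) c) : D.code (D.eid i x) < c := by
  classical
  obtain ⟨q, h1, h2, h3, h4, rfl⟩ := hc
  have hr := D.rooted i hi
  have hsub : ((Finset.range n).filter fun z => Anc (D.par i) x z) ⊂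
      (Finset.range n).filter fun z => Anc (D.par i) q z := by
    rw [Finset.ssubset_iff_of_subset]
    · have hp := hr.par_lt x hx
      refine ⟨D.par i x, by simp [hp, h4], ?_⟩
      simp [hr.not_anc_par hx hx0.ne']
    · intro z
      simp only [Finset.mem_filter]
      rintro ⟨g1, g2⟩
      exact ⟨g1, (h4.trans ⟨1, rfl⟩).trans g2⟩
  have hlt : subtreeSize n (D.par i) x < subtreeSize n (D.par i) q := by
    rw [subtreeSize, subtreeSize]
    exact Finset.card_lt_card hsub
  rw [D.code_eid hi hx0 hx, D.code_eid hi h1 h2]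
  have := lt_kn (D.eid_lt hi hx0 hx)
  have := Nat.mul_le_mul_right (k * n) (Nat.succ_le_of_lt hlt)
  rw [Nat.succ_mul] at this
  omega

theorem leastTwo_treeCodes {i x a b : ℕ} (hi : i < k) (hx0 : 0 < x) (hx : x < n)
    (h : LeastTwo (D.TreeCodes i (D.par i x)) (n * (k * n)) a b) :
    (D.Best (D.eid i x) → LeastTwo (D.TreeCodes i x) (n * (k * n)) (D.code (D.eid i x)) a) ∧
    (¬ D.Best (D.eid i x) → LeastTwo (D.TreeCodes i x) (n * (k * n)) a b) := by
  constructor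
  · intro hb
    refine (h.cons (D.code_lt (D.eid_lt hi hx0 hx)) fun z hz =>
      D.code_lt_of_treeCodes hi hx0 hx hz).congr fun z => ?_
    rw [D.treeCodes_par hx0 hx]
    simp [hb]
  · intro hb
    refine h.congr fun z => ?_
    rw [D.treeCodes_par hx0 hx]
    simp [hb]

/-- The codes of the best cuts in the first `i` trees around a vertex. -/
def CodesBelow (i v c : ℕ) : Prop := ∃ i' < i, D.TreeCodes i' v c

theorem codesBelow_zero (v c : ℕ) : ¬ D.CodesBelow 0 v c := by
  rintro ⟨i, hi, -⟩
  omega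

theorem codesBelow_succ {i v c : ℕ} :
    D.CodesBelow (i + 1) v c ↔ D.CodesBelow i v c ∨ D.TreeCodes i v c := by
  constructor
  · rintro ⟨i', h1, h2⟩
    by_cases h : i' = i
    · exact Or.inr (h ▸ h2)
    · exact Or.inl ⟨i', by omega, h2⟩
  · rintro (⟨i', h1, h2⟩ | h)
    · exact ⟨i', by omega, h2⟩
    · exact ⟨i, by omega, h⟩

/-- A code determines its edge and thereby the tree, so different trees contribute different codes.
-/
theorem codesBelow_disjoint {i v c : ℕ} (hi : i < k) (h : D.CodesBelow i v c) :
    ¬ D.TreeCodes i v c := by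
  obtain ⟨i', h1, h2⟩ := h
  intro h3
  rw [D.treeCodes_iff (h1.trans hi)] at h2
  rw [D.treeCodes_iff hi] at h3
  obtain ⟨f, f1, f2, f3, -, f4⟩ := h2
  obtain ⟨g, g1, g2, g3, -, g4⟩ := h3
  have hfg := D.code_inj f3.1 g3.1 (f4.symm.trans g4)
  subst hfg
  have := (div_eq f1 f2).symm.trans (div_eq g1 g2)
  omega

theorem codesBelow_all {v c : ℕ} : D.CodesBelow k v c ↔ D.Codes v c := by
  constructor
  · rintro ⟨i, h1, h2⟩
    rw [D.treeCodes_iff h1] at h2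
    obtain ⟨f, -, -, f3, f4, f5⟩ := h2
    exact ⟨f, f3, f4, f5⟩
  · rintro ⟨f, f3, f4, f5⟩
    obtain ⟨h1, h2, h3⟩ := tree_of_lt f3.1
    exact ⟨_, h1, (D.treeCodes_iff h1).2 ⟨f, h2, h3, f3, f4, f5⟩⟩

end Family

end CutMerge

/-! ### The top-down pass through one tree. -/

namespace CutMerge

/-- Insert the entry for `x` of an array into the two smallest numbers found for `x`. -/
def insertTwoProg (a : Arr) : Stmt :=
  .z ::= .get a Var.x ;;
  .ite (.lt Var.z (.get .c1 Var.x)) (.put .c2 Var.x (.get .c1 Var.x) ;; .put .c1 Var.x Var.z)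
    (.ite (.lt Var.z (.get .c2 Var.x)) (.put .c2 Var.x Var.z) .skip)

/-- Find the two smallest best cuts around `x` in the current tree. -/
def nearestProg : Stmt :=
  -- Leaves are stripped before their parents, so the list is read backwards to go from the root
  -- downwards.
  .x ::= .get .ord (Var.m - 1 - Var.t) ;;
  .p ::= .get .pr Var.x ;;
  .ite (.eq (.get .mark (.get .pe Var.x)) 1)
    (.put .n1 Var.x (.get .siz Var.x * Var.B + .get .pe Var.x) ;;
      .put .n2 Var.x (.get .n1 Var.p))
    (.put .n1 Var.x (.get .n1 Var.p) ;; .put .n2 Var.x (.get .n2 Var.p))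

def descendProg : Stmt :=
  .put .n1 0 (Var.n * Var.B) ;;
  .put .n2 0 (Var.n * Var.B) ;;
  .upTo .t Var.m (nearestProg ;; insertTwoProg .n1 ;; insertTwoProg .n2)

/-- Take the best cuts of tree `i` into account. -/
def treeProg : Stmt :=
  initTreeProg ;; degreesProg ;; stripProg ;; descendProg

/-- The root and the last `a` vertices of the list `ord` of length `m`. -/
def Visited (m : ℕ) (ord : ℕ → ℕ) (a x : ℕ) : Prop :=
  x = 0 ∨ ∃ s, m - a ≤ s ∧ s < m ∧ ord s = x

section descend

variable {Z n k i : ℕ} {D : Family n k} {σ : Store}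

theorem insertTwo_wp {a : Arr} {x : ℕ} (hxv : σ.var .x = x) (hx : x < Z) :
    Wp Z (insertTwoProg a) σ fun t σ' => t ≤ 4 ∧
      σ'.arr .c1 = Function.update (σ.arr .c1) x
        (insertTwo (σ.arr a x) (σ.arr .c1 x, σ.arr .c2 x)).1 ∧
      σ'.arr .c2 = Function.update (σ.arr .c2) x
        (insertTwo (σ.arr a x) (σ.arr .c1 x, σ.arr .c2 x)).2 := by
  simp [insertTwoProg, insertTwo, hxv, hx]
  refine ⟨fun h => ?_, fun h => ⟨fun h' => ?_, fun h' => ?_⟩⟩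
  · simp [h]
  · simp [Nat.not_lt.2 h, h']
  · simp [Nat.not_lt.2 h, Nat.not_lt.2 h']

theorem nearest_wp {s x : ℕ} (hik : i < k) (hm : σ.var .m = n - 1) (ht : σ.var .t = n - 1 - 1 - s)
    (hs : s < n - 1) (hB : σ.var .B = k * n)
    (hmark : ∀ f < k * (n - 1), D.Best f ↔ σ.arr .mark f = 1)
    (hstrip : Strip n (D.par i) (D.eid i) {0} (σ.arr .deg) (σ.arr .sN) (σ.arr .sE)
        (σ.arr .siz) (σ.arr .pr) (σ.arr .pe) (σ.arr .ord) (n - 1))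
    (hx : σ.arr .ord s = x)
    (hpar : Family.LeastTwo (D.TreeCodes i (D.par i x)) (n * (k * n)) (σ.arr .n1 (D.par i x))
      (σ.arr .n2 (D.par i x)))
    (hZ : k * (2 * n) * (2 * n) + 10 * (k * n) + 20 < Z) :
    Wp Z nearestProg σ fun t σ' => t = 5 ∧ σ'.var .x = x ∧
      (∀ y, y ≠ x → σ'.arr .n1 y = σ.arr .n1 y ∧ σ'.arr .n2 y = σ.arr .n2 y) ∧
      Family.LeastTwo (D.TreeCodes i x) (n * (k * n)) (σ'.arr .n1 x) (σ'.arr .n2 x) := by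
  have hkn : n ≤ k * n := Nat.le_mul_of_pos_left n D.k_pos
  have hxn : x < n := hx ▸ hstrip.ord_lt s hs
  have hxR : x ∉ ({0} : Finset ℕ) := (hstrip.ord_iff x hxn).2 ⟨s, hs, hx⟩
  have hx0 : x ≠ 0 := by simpa using hxR
  have hr := D.rooted i hik
  have hp := hr.par_lt x hxn
  have hpx := hr.par_ne hxn hx0
  obtain ⟨h1, h2⟩ := hstrip.pr_eq x hxn hxR
  have hlt := D.eid_lt hik (Nat.pos_of_ne_zero hx0) hxn
  have hk' : k * (n - 1) ≤ k * n := Nat.mul_le_mul_left _ (Nat.sub_le _ _)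
  have hsiz : σ.arr .siz x = subtreeSize n (D.par i) x := by
    rw [hstrip.siz_eq x hxn, hr.subtreeSize_eq hxn]
    congr 1
    refine Finset.sum_congr rfl fun y hy => ?_
    simp [Finset.ne_of_mem_erase hy]
  have hcode := D.code_eid hik (Nat.pos_of_ne_zero hx0) hxn
  have hclt := D.code_lt hlt
  have hnn : n * (k * n) ≤ k * (2 * n) * (2 * n) := by
    have : k * (2 * n) * (2 * n) = 4 * (n * (k * n)) := by ring
    omega
  obtain ⟨l1, l2⟩ := D.leastTwo_treeCodes hik (Nat.pos_of_ne_zero hx0) hxn hpar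
  have hm' := hmark _ hlt
  have hidx : n - 1 - 1 - (n - 1 - 1 - s) = s := by omega
  simp [nearestProg, hm, ht, hidx, hx, h1, h2, hB, hsiz, ← hcode, ← hm']
  refine ⟨by omega, by omega, ⟨⟨by omega, by omega⟩, by omega⟩, fun hb => ?_, fun hb => ?_⟩
  · rw [hcode] at hclt
    and_intros
    any_goals omega
    · intro y hy
      simp [Function.update_of_ne hy]
    · rw [Function.update_of_ne hpx]
      exact l1 hb
  · and_intros
    any_goals omega
    · intro y hy
      simp [Function.update_of_ne hy]
    · exact l2 hb

/-- The pair for a vertex is that of its parent, preceded by its own edge if marked. It is folded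
into the pair collected from earlier trees as soon as the vertex is visited. -/
theorem descend_wp (hik : i < k) (hn : σ.var .n = n) (hm : σ.var .m = n - 1) (hB : σ.var .B = k * n)
    (hmark : ∀ f < k * (n - 1), D.Best f ↔ σ.arr .mark f = 1)
    (hstrip : Strip n (D.par i) (D.eid i) {0} (σ.arr .deg) (σ.arr .sN) (σ.arr .sE)
        (σ.arr .siz) (σ.arr .pr) (σ.arr .pe) (σ.arr .ord) (n - 1))
    (hc : ∀ x < n, Family.LeastTwo (D.CodesBelow i x) (n * (k * n)) (σ.arr .c1 x) (σ.arr .c2 x))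
    (hZ : k * (2 * n) * (2 * n) + 10 * (k * n) + 20 < Z) :
    Wp Z descendProg σ fun t σ' => t ≤ 15 * n + 4 ∧
      ∀ x < n, Family.LeastTwo (D.CodesBelow (i + 1) x) (n * (k * n)) (σ'.arr .c1 x)
        (σ'.arr .c2 x) := by
  have hkn : n ≤ k * n := Nat.le_mul_of_pos_left n D.k_pos
  have hr := D.rooted i hik
  have hnn : n * (k * n) ≤ k * (2 * n) * (2 * n) := by
    have : k * (2 * n) * (2 * n) = 4 * (n * (k * n)) := by ring
    omega
  have h00 : ∀ x c, x = 0 → ¬ D.TreeCodes i x c := by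
    rintro x c rfl
    exact D.not_treeCodes_zero hik c
  simp only [descendProg, wp_seq, wp_put]
  simp [hn, hB]
  and_intros
  any_goals omega
  refine Wp.upTo (n - 1) 13 (by omega) (fun a τ => ∀ x < n,
    (Visited (n - 1) (σ.arr .ord) a x →
      Family.LeastTwo (D.TreeCodes i x) (n * (k * n)) (τ.arr .n1 x) (τ.arr .n2 x) ∧
      Family.LeastTwo (D.CodesBelow (i + 1) x) (n * (k * n)) (τ.arr .c1 x) (τ.arr .c2 x)) ∧
    (¬ Visited (n - 1) (σ.arr .ord) a x →
      Family.LeastTwo (D.CodesBelow i x) (n * (k * n)) (τ.arr .c1 x) (τ.arr .c2 x))) ?_ ?_ ?_ ?_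
  · intro τ hs
    simp [hs.var .m, hm]
  · intro x hx
    refine ⟨?_, fun _ => by simpa using hc x hx⟩
    rintro (hx0 | ⟨s, h1, h2, -⟩)
    · refine ⟨?_, ?_⟩
      · rw [hx0]
        simp
        exact Family.leastTwo_empty fun z => D.not_treeCodes_zero hik z
      · refine (hc x hx).congr fun z => ?_
        rw [D.codesBelow_succ]
        exact or_iff_left (h00 x z hx0)
    · omega
  · intro a τ ha hs hv h
    have w1 := (hs.var .m)
    have w2 := (hs.var .B)
    have w3 := (hs.arr .mark)
    have w4 := (hs.arr .deg)
    have w5 := (hs.arr .sN)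
    have w6 := (hs.arr .sE)
    have w7 := (hs.arr .siz)
    have w8 := (hs.arr .pr)
    have w9 := (hs.arr .pe)
    have w10 := (hs.arr .ord)
    simp at w1 w2 w3 w4 w5 w6 w7 w8 w9 w10
    obtain ⟨s, hs1, hs2⟩ : ∃ s, s < n - 1 ∧ a = n - 1 - 1 - s :=
      ⟨n - 1 - 1 - a, by omega, by omega⟩
    obtain ⟨x, hx⟩ : ∃ x, σ.arr .ord s = x := ⟨_, rfl⟩
    have hxn : x < n := hx ▸ hstrip.ord_lt s hs1
    have hxR : x ∉ ({0} : Finset ℕ) := (hstrip.ord_iff x hxn).2 ⟨s, hs1, hx⟩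
    have hx0 : x ≠ 0 := by simpa using hxR
    have hp := hr.par_lt x hxn
    -- The parent was stripped after `x`, or is the root, so its pair is already available.
    have hpar : Visited (n - 1) (σ.arr .ord) a (D.par i x) := by
      have := hstrip.ord_par s hs1
      rw [hx] at this
      rcases this with h1 | ⟨s', h1, h2, h3⟩
      · exact Or.inl (by simpa using h1)
      · exact Or.inr ⟨s', by omega, h2, h3⟩
    have hfresh : ¬ Visited (n - 1) (σ.arr .ord) a x := by
      rintro (h1 | ⟨s', h1, h2, h3⟩)
      · exact hx0 h1
      · exact hstrip.ord_inj s s' (by omega) h2 (hx.trans h3.symm)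
    rw [wp_seq]
    refine (nearest_wp (D := D) (i := i) (x := x) (s := s) hik (w1.trans hm) (hv.trans hs2) hs1
      (w2.trans hB) (by rwa [w3]) (by rwa [w4, w5, w6, w7, w8, w9, w10]) (by rw [w10, hx])
      ((h _ hp).1 hpar).1 hZ).mono ?_
    rintro t₁ τ₁ s₁ ⟨ht₁, hx₁, hoth, hnew⟩
    rw [wp_seq]
    refine (insertTwo_wp (Z := Z) hx₁ (by omega)).mono ?_
    rintro t₂ τ₂ s₂ ⟨ht₂, e1, e2⟩
    refine (insertTwo_wp (Z := Z) ((s₂.var .x).trans hx₁) (by omega)).mono ?_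
    rintro t₃ τ₃ s₃ ⟨ht₃, e3, e4⟩
    refine ⟨by omega, ?_⟩
    have g1 := (s₃.arr .n1).trans (s₂.arr .n1)
    have g2 := (s₃.arr .n2).trans (s₂.arr .n2)
    have g3 := s₁.arr .c1
    have g4 := s₁.arr .c2
    have g5 := s₂.arr .n2
    simp only [Store.set_arr]
    intro y hy
    by_cases hyx : y = x
    · subst hyx
      refine ⟨fun _ => ⟨by rwa [g1, g2], ?_⟩, fun hc => (hc (Or.inr ⟨s, by omega, hs1, hx⟩)).elim⟩
      have hm := Family.LeastTwo.merge (p := (τ.arr .c1 y, τ.arr .c2 y)) ((h y hy).2 hfresh) hnew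
        fun z hz => D.codesBelow_disjoint hik hz
      rw [e3, e4, e1, e2, g3, g4, g5, Function.update_self, Function.update_self,
        Function.update_self, Function.update_self]
      exact hm.congr fun z => D.codesBelow_succ
    · have k1 : τ₃.arr .c1 y = τ.arr .c1 y := by
        rw [e3, Function.update_of_ne hyx, e1, Function.update_of_ne hyx, g3]
      have k2 : τ₃.arr .c2 y = τ.arr .c2 y := by
        rw [e4, Function.update_of_ne hyx, e2, Function.update_of_ne hyx, g4]
      rw [g1, g2, (hoth y hyx).1, (hoth y hyx).2, k1, k2]
      have hiff : Visited (n - 1) (σ.arr .ord) (a + 1) y ↔ Visited (n - 1) (σ.arr .ord) a y := by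
        refine or_congr_right ⟨?_, ?_⟩
        · rintro ⟨s', h1, h2, h3⟩
          have : s' ≠ s := by
            rintro rfl
            exact hyx (h3.symm.trans hx)
          exact ⟨s', by omega, h2, h3⟩
        · rintro ⟨s', h1, h2, h3⟩
          exact ⟨s', by omega, h2, h3⟩
      rw [hiff]
      exact h y hy
  · intro t τ ht hs h
    refine ⟨by omega, fun x hx => ((h x hx).1 ?_).2⟩
    by_cases hx0 : x = 0
    · exact Or.inl hx0
    · obtain ⟨s, h1, h2⟩ := (hstrip.ord_iff x hx).1 (by simpa using hx0)
      exact Or.inr ⟨s, by omega, h1, h2⟩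

theorem tree_wp (hik : i < k) (hn : σ.var .n = n) (hm : σ.var .m = n - 1) (hi : σ.var .i = i)
    (hB : σ.var .B = k * n)
    (hio : ∀ f < k * (n - 1), σ.arr .io (2 * f) = D.U f ∧ σ.arr .io (2 * f + 1) = D.V f)
    (hmark : ∀ f < k * (n - 1), D.Best f ↔ σ.arr .mark f = 1)
    (hc : ∀ x < n, Family.LeastTwo (D.CodesBelow i x) (n * (k * n)) (σ.arr .c1 x) (σ.arr .c2 x))
    (hZ : k * (2 * n) * (2 * n) + 10 * (k * n) + 20 < Z) :
    Wp Z treeProg σ fun t σ' => t ≤ 61 * n ∧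
      ∀ x < n, Family.LeastTwo (D.CodesBelow (i + 1) x) (n * (k * n)) (σ'.arr .c1 x)
        (σ'.arr .c2 x) := by
  have hn0 := D.n_pos
  have hkn : n ≤ k * n := Nat.le_mul_of_pos_left n D.k_pos
  rw [treeProg, wp_seq]
  refine (initTree_wp hn (by omega)).mono fun t₁ σ₁ s₁ ⟨ht₁, h0⟩ => ?_
  rw [wp_seq]
  refine (degrees_wp (D := D) ((s₁.var .n).trans hn) ((s₁.var .m).trans hm)
    ((s₁.var .i).trans hi) hik (by rwa [s₁.arr .io]) h0 hZ).mono fun t₂ σ₂ s₂ ⟨ht₂, h1⟩ => ?_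
  rw [wp_seq]
  refine (strip_wp hik ((s₂.var .n).trans ((s₁.var .n).trans hn)) h1 hZ).mono
    fun t₃ σ₃ s₃ ⟨ht₃, h2⟩ => ?_
  refine (descend_wp hik ((s₃.var .n).trans ((s₂.var .n).trans ((s₁.var .n).trans hn)))
    ((s₃.var .m).trans ((s₂.var .m).trans ((s₁.var .m).trans hm)))
    ((s₃.var .B).trans ((s₂.var .B).trans ((s₁.var .B).trans hB)))
    (by rwa [s₃.arr .mark, s₂.arr .mark, s₁.arr .mark]) h2
    (by rwa [s₃.arr .c1, s₂.arr .c1, s₁.arr .c1, s₃.arr .c2, s₂.arr .c2, s₁.arr .c2])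
    hZ).mono fun t₄ σ₄ s₄ ⟨ht₄, h3⟩ => ⟨by omega, h3⟩

end descend

end CutMerge

/-! ### Assembling the complete program. -/

namespace CutMerge

open Relation

/-! ### The complete program -/

/-- The first tree is its own flow tree. Entry n - 1 is not written and keeps its initial zeros,
which provides the loop. -/
def loadFirstProg : Stmt :=
  .upTo .j Var.m (.put .eu Var.j (.get .io (2 * Var.j)) ;;
    .put .ev Var.j (.get .io (2 * Var.j + 1)) ;; .put .ei Var.j Var.j)

def roundsProg : Stmt :=
  .upTo .i Var.k (.ite (.lt 0 Var.i) roundProg .skip)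

def markProg : Stmt :=
  .upTo .j Var.n (.ite (.eq (.get .eu Var.j) (.get .ev Var.j)) .skip (.put .mark (.get .ei Var.j) 1))

def initCodesProg : Stmt :=
  .upTo .x Var.n (.put .c1 Var.x (Var.n * Var.B) ;; .put .c2 Var.x (Var.n * Var.B))

/-- The array `vo` inverts `c1`, so that a second code can be turned into the vertex that owns the
cut. The root is stored at the dummy code. -/
def ownersProg : Stmt :=
  .upTo .x Var.n (.put .vo (.get .c1 Var.x) Var.x)

/-- The code modulo `B` is the edge number. Output weights are placed behind the input weights
first, because input weights may still be needed for later edges. -/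
def outputProg : Stmt :=
  .upTo .j Var.m (.c ::= .get .c1 (Var.j + 1) ;;
    .put .io (2 * Var.j) (Var.j + 1) ;;
    .put .io (2 * Var.j + 1) (.get .vo (.get .c2 (Var.j + 1))) ;;
    .wput (Var.k * Var.m + Var.j) (Var.c - Var.c / Var.B * Var.B))

def copyWeightsProg : Stmt :=
  .upTo .j Var.m (.wput Var.j (Var.k * Var.m + Var.j))

def mergeTreesProg : Stmt :=
  .m ::= Var.n - 1 ;; loadFirstProg ;; roundsProg ;; markProg ;; .B ::= Var.k * Var.n ;;
  initCodesProg ;; .upTo .i Var.k treeProg ;; ownersProg ;; outputProg ;; copyWeightsProg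

section main

variable {Z n k : ℕ} {D : Family n k} {σ : Store}

theorem loadFirst_wp (hm : σ.var .m = n - 1)
    (hio : ∀ f < k * (n - 1), σ.arr .io (2 * f) = D.U f ∧ σ.arr .io (2 * f + 1) = D.V f)
    (hu : σ.arr .eu (n - 1) = 0) (hv : σ.arr .ev (n - 1) = 0) (he : σ.arr .ei (n - 1) = 0)
    (hZ : k * (2 * n) * (2 * n) + 10 * (k * n) + 20 < Z) :
    Wp Z loadFirstProg σ fun t σ' => t ≤ 5 * n + 2 ∧
      D.Flow 1 (σ'.arr .eu) (σ'.arr .ev) (σ'.arr .ei) := by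
  have hn0 := D.n_pos
  have hkn : n ≤ k * n := Nat.le_mul_of_pos_left n D.k_pos
  have hkn' : n - 1 ≤ k * (n - 1) := Nat.le_mul_of_pos_left _ D.k_pos
  refine Wp.upTo (n - 1) 3 (by omega) (fun a τ => (∀ j < a, τ.arr .eu j = D.U j ∧
    τ.arr .ev j = D.V j ∧ τ.arr .ei j = j) ∧
    τ.arr .eu (n - 1) = 0 ∧ τ.arr .ev (n - 1) = 0 ∧ τ.arr .ei (n - 1) = 0) ?_ ?_ ?_ ?_
  · intro τ hs
    simp [hs.var .m, hm]
  · simp [hu, hv, he]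
  · rintro a τ ha hs hav ⟨h1, h2, h3, h4⟩
    have w := hs.arr .io
    obtain ⟨e1, e2⟩ := hio a (by omega)
    simp [hav, w, e1, e2]
    and_intros
    any_goals omega
    · intro j hj
      by_cases hja : j = a
      · subst hja
        simp
      · simpa [Function.update_of_ne hja] using h1 j (by omega)
    all_goals
      rw [Function.update_of_ne (by omega)]
      assumption
  · rintro t τ ht hs ⟨h1, h2, h3, h4⟩
    refine ⟨by omega, ⟨n - 1, by omega, by rw [h2, h3]⟩, fun j hj => ?_, fun P hP x hx y hy => ?_⟩
    · by_cases hjn : j < n - 1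
      · obtain ⟨g1, g2, g3⟩ := h1 j hjn
        have := D.ends_lt (f := j) (by omega)
        omega
      · obtain rfl : j = n - 1 := by omega
        omega
    · have hl := D.link_tree D.k_pos P hx hy
      simp only [zero_mul, Nat.zero_le, true_and, zero_add, true_imp_iff] at hl
      rw [← hl]
      constructor
      · refine fun hl => hl.mono fun j hj => ?_
        by_cases hjn : j < n - 1
        · obtain ⟨g1, g2, g3⟩ := h1 j hjn
          exact Or.inr ⟨⟨by omega, g3 ▸ hj.2⟩, g1.symm, g2.symm⟩
        · obtain rfl : j = n - 1 := by omega
          exact Or.inl (by rw [h2, h3])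
      · refine fun hl => hl.mono fun j hj => ?_
        obtain ⟨g1, g2, g3⟩ := h1 j (by omega)
        exact Or.inr ⟨⟨by omega, g3.symm ▸ hj.2⟩, g1, g2⟩

theorem rounds_wp (hk : σ.var .k = k) (hn : σ.var .n = n) (hm : σ.var .m = n - 1)
    (hW : σ.wt = D.W)
    (hio : ∀ f < k * (n - 1), σ.arr .io (2 * f) = D.U f ∧ σ.arr .io (2 * f + 1) = D.V f)
    (hF : D.Flow 1 (σ.arr .eu) (σ.arr .ev) (σ.arr .ei))
    (htab : ∀ m, σ.arr .tab m = 0)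
    (hZ : k * (2 * n) * (2 * n) + 10 * (k * n) + 20 < Z) :
    Wp Z roundsProg σ fun t σ' => t ≤ k * (210 * (n * (Nat.log 2 n + 1)) + 3) + 2 ∧
      D.Flow k (σ'.arr .eu) (σ'.arr .ev) (σ'.arr .ei) := by
  have hn0 := D.n_pos
  have hk0 := D.k_pos
  have hkn : k ≤ k * n := Nat.le_mul_of_pos_right k D.n_pos
  have h1L : 1 ≤ n * (Nat.log 2 n + 1) := Nat.mul_pos D.n_pos (Nat.succ_pos _)
  -- Iteration 0 does nothing, as the first tree is already loaded; `max a 1` counts the trees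
  -- included so far.
  refine Wp.upTo k (210 * (n * (Nat.log 2 n + 1)) + 1) (by omega) (fun a τ =>
    D.Flow (max a 1) (τ.arr .eu) (τ.arr .ev) (τ.arr .ei) ∧
    ∀ m, a * (2 * n) * (2 * n) ≤ m → τ.arr .tab m = 0) ?_ ?_ ?_ ?_
  · intro τ hs
    simp [hs.var .k, hk]
  · exact ⟨by simpa using hF, fun m _ => htab m⟩
  · rintro a τ ha hs hv ⟨h1, h2⟩
    simp only [wp_ite, wp_skip]
    refine ⟨⟨show 0 < Z by omega, trivial⟩, fun h0 => ?_, fun h0 => ?_⟩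
    · have h0 : 0 < τ.var .i := h0
      rw [show max a 1 = a by omega] at h1
      refine (round_wp (D := D) ((hs.var .n).trans hn) ((hs.var .m).trans hm) hv ha
        (hs.wt.trans hW) (by rwa [hs.arr .io]) h1 h2 hZ).mono ?_
      rintro t' τ' - ⟨g1, g2, g3⟩
      refine ⟨by omega, ?_, g3⟩
      rw [show max (a + 1) 1 = a + 1 by omega]
      exact g2
    · have h0 : ¬ 0 < τ.var .i := h0
      refine ⟨by omega, ?_, fun m hm => h2 m (le_trans ?_ hm)⟩
      · rw [show max (a + 1) 1 = max a 1 by omega]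
        exact h1
      · gcongr
        omega
  · rintro t τ ht hs ⟨h1, -⟩
    rw [show max k 1 = k by omega] at h1
    exact ⟨ht, h1⟩

theorem mark_wp (hD : D.Laminar) (hn : σ.var .n = n)
    (hF : D.Flow k (σ.arr .eu) (σ.arr .ev) (σ.arr .ei)) (hmark : ∀ f, σ.arr .mark f = 0)
    (hZ : k * (2 * n) * (2 * n) + 10 * (k * n) + 20 < Z) :
    Wp Z markProg σ fun t σ' => t ≤ 4 * n + 2 ∧ ∀ f, D.Best f ↔ σ'.arr .mark f = 1 := by
  have hn0 := D.n_pos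
  have hkn : n ≤ k * n := Nat.le_mul_of_pos_left n D.k_pos
  have hk' : k * (n - 1) ≤ k * n := Nat.mul_le_mul_left _ (Nat.sub_le _ _)
  refine Wp.upTo n 2 (by omega) (fun a τ => ∀ f, τ.arr .mark f = 1 ↔
    ∃ j < a, σ.arr .eu j ≠ σ.arr .ev j ∧ σ.arr .ei j = f) ?_ ?_ ?_ ?_
  · intro τ hs
    simp [hs.var .n, hn]
  · simp [hmark]
  · intro a τ ha hs hv h
    obtain ⟨b1, b2, b3⟩ := hF.lt a ha
    simp [hv, hs.arr .eu, hs.arr .ev, hs.arr .ei]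
    refine ⟨by omega, fun heq f => ?_, fun hne => ⟨by omega, by omega, by omega, fun f => ?_⟩⟩
    · rw [h f]
      constructor
      · rintro ⟨j, h1, h2⟩
        exact ⟨j, by omega, h2⟩
      · rintro ⟨j, h1, h2⟩
        have : j ≠ a := by
          rintro rfl
          exact h2.1 heq
        exact ⟨j, by omega, h2⟩
    · by_cases hf : f = σ.arr .ei a
      · subst hf
        simp only [Function.update_self, true_iff]
        exact ⟨a, le_rfl, hne, rfl⟩
      · rw [Function.update_of_ne hf, h f]
        constructor
        · rintro ⟨j, h1, h2⟩
          exact ⟨j, by omega, h2⟩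
        · rintro ⟨j, h1, h2⟩
          have : j ≠ a := by
            rintro rfl
            exact hf h2.2.symm
          exact ⟨j, by omega, h2⟩
  · intro t τ ht hs h
    refine ⟨by omega, fun f => ?_⟩
    rw [hF.best_iff_label hD, h f]

theorem initCodes_wp (hn : σ.var .n = n) (hB : σ.var .B = k * n) (hk0 : 0 < k)
    (hZ : k * (2 * n) * (2 * n) + 10 * (k * n) + 20 < Z) :
    Wp Z initCodesProg σ fun t σ' => t ≤ 4 * n + 2 ∧ ∀ x < n, σ'.arr .c1 x = n * (k * n) ∧
      σ'.arr .c2 x = n * (k * n) := by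
  have hkn : n ≤ k * n := Nat.le_mul_of_pos_left n hk0
  have hnn : n * (k * n) ≤ k * (2 * n) * (2 * n) := by
    have : k * (2 * n) * (2 * n) = 4 * (n * (k * n)) := by ring
    omega
  refine Wp.upTo n 2 (by omega) (fun a τ => ∀ x < a, τ.arr .c1 x = n * (k * n) ∧
      τ.arr .c2 x = n * (k * n)) ?_ (by simp) ?_ ?_
  · intro τ hs
    simp [hs.var .n, hn]
  · intro a τ ha hs hv h
    simp [hv, hs.var .n, hn, hs.var .B, hB]
    and_intros
    any_goals omega
    intro x hx
    by_cases hxa : x = a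
    · subst hxa
      simp
    · simpa [Function.update_of_ne hxa] using h x (by omega)
  · intro t τ ht hs h
    exact ⟨by omega, h⟩

theorem trees_wp (hk : σ.var .k = k) (hn : σ.var .n = n) (hm : σ.var .m = n - 1)
    (hB : σ.var .B = k * n)
    (hio : ∀ f < k * (n - 1), σ.arr .io (2 * f) = D.U f ∧ σ.arr .io (2 * f + 1) = D.V f)
    (hmark : ∀ f, D.Best f ↔ σ.arr .mark f = 1)
    (hc : ∀ x < n, σ.arr .c1 x = n * (k * n) ∧ σ.arr .c2 x = n * (k * n))
    (hZ : k * (2 * n) * (2 * n) + 10 * (k * n) + 20 < Z) :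
    Wp Z (.upTo .i Var.k treeProg) σ fun t σ' => t ≤ k * (61 * n + 2) + 2 ∧
      ∀ x < n, Family.LeastTwo (D.Codes x) (n * (k * n)) (σ'.arr .c1 x) (σ'.arr .c2 x) := by
  have hkn : k ≤ k * n := Nat.le_mul_of_pos_right k D.n_pos
  refine Wp.upTo k (61 * n) (by omega) (fun a τ => ∀ x < n,
    Family.LeastTwo (D.CodesBelow a x) (n * (k * n)) (τ.arr .c1 x) (τ.arr .c2 x)) ?_ ?_ ?_ ?_
  · intro τ hs
    simp [hs.var .k, hk]
  · intro x hx
    simp [hc x hx]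
    exact Family.leastTwo_empty fun z => D.codesBelow_zero x z
  · intro a τ ha hs hv h
    exact (tree_wp (D := D) ha ((hs.var .n).trans hn) ((hs.var .m).trans hm) hv
      ((hs.var .B).trans hB) (by rwa [hs.arr .io]) (by rw [hs.arr .mark]; exact fun f _ => hmark f)
      h hZ).mono fun t' τ' _ h' => h'
  · intro t τ ht hs h
    exact ⟨ht, fun x hx => (h x hx).congr fun z => D.codesBelow_all.symm⟩

/-- Distinct vertices have distinct first codes, so no entry is overwritten: owners are injective,
and only the root has the dummy code. -/
theorem owners_wp (hD : D.Laminar) (hn : σ.var .n = n)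
    (hc : ∀ x < n, Family.LeastTwo (D.Codes x) (n * (k * n)) (σ.arr .c1 x) (σ.arr .c2 x))
    (hZ : k * (2 * n) * (2 * n) + 10 * (k * n) + 20 < Z) :
    Wp Z ownersProg σ fun t σ' => t ≤ 3 * n + 2 ∧ ∀ x < n, σ'.arr .vo (σ.arr .c1 x) = x := by
  have hkn : n ≤ k * n := Nat.le_mul_of_pos_left n D.k_pos
  have hnn : n * (k * n) ≤ k * (2 * n) * (2 * n) := by
    have : k * (2 * n) * (2 * n) = 4 * (n * (k * n)) := by ring
    omega
  have hinj : ∀ x < n, ∀ y < n, σ.arr .c1 x = σ.arr .c1 y → x = y := by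
    have h0 := (Family.codes_zero hc).1
    have hpos : ∀ x, 0 < x → x < n → σ.arr .c1 x < n * (k * n) := by
      intro x hx0 hx
      obtain ⟨h1, -, h2⟩ := Family.owner_spec hc hx0 hx
      rw [h2]
      exact D.code_lt h1.1
    intro x hx y hy h
    rcases Nat.eq_zero_or_pos x with rfl | hx0
    · rcases Nat.eq_zero_or_pos y with rfl | hy0
      · rfl
      · have := hpos y hy0 hy
        omega
    · rcases Nat.eq_zero_or_pos y with rfl | hy0
      · have := hpos x hx0 hx
        omega
      · exact Family.owner_inj hD hc hx0 hx hy0 hy (by rw [Family.owner, Family.owner, h])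
  refine Wp.upTo n 1 (by omega) (fun a τ => ∀ x < a, τ.arr .vo (σ.arr .c1 x) = x)
    ?_ (by simp) ?_ ?_
  · intro τ hs
    simp [hs.var .n, hn]
  · intro a τ ha hs hv h
    have h1 := (hc a ha).le
    have h2 := (hc a ha).le_top
    simp [hv, hs.arr .c1]
    and_intros
    any_goals omega
    intro x hx
    by_cases hxa : x = a
    · subst hxa
      simp
    · rw [Function.update_of_ne fun h' => hxa (hinj x (by omega) a ha h')]
      exact h x (by omega)
  · intro t τ ht hs h
    exact ⟨by omega, h⟩

theorem output_wp (hk : σ.var .k = k) (hm : σ.var .m = n - 1) (hB : σ.var .B = k * n)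
    (hW : σ.wt = D.W)
    (hc : ∀ x < n, Family.LeastTwo (D.Codes x) (n * (k * n)) (σ.arr .c1 x) (σ.arr .c2 x))
    (hZ : k * (2 * n) * (2 * n) + 10 * (k * n) + 20 < Z) :
    Wp Z outputProg σ fun t σ' => t ≤ 6 * n + 2 ∧ ∀ j < n - 1, σ'.arr .io (2 * j) = j + 1 ∧
      σ'.arr .io (2 * j + 1) = σ.arr .vo (σ.arr .c2 (j + 1)) ∧
      σ'.wt (k * (n - 1) + j) = D.W (D.owner (σ.arr .c1) (j + 1)) := by
  have hkn : n ≤ k * n := Nat.le_mul_of_pos_left n D.k_pos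
  have hk' : k * (n - 1) ≤ k * n := Nat.mul_le_mul_left _ (Nat.sub_le _ _)
  have hnn : n * (k * n) ≤ k * (2 * n) * (2 * n) := by
    have : k * (2 * n) * (2 * n) = 4 * (n * (k * n)) := by ring
    omega
  refine Wp.upTo (n - 1) 4 (by omega) (fun a τ => (∀ f < k * (n - 1), τ.wt f = D.W f) ∧
      ∀ j < a, τ.arr .io (2 * j) = j + 1 ∧
      τ.arr .io (2 * j + 1) = σ.arr .vo (σ.arr .c2 (j + 1)) ∧
      τ.wt (k * (n - 1) + j) = D.W (D.owner (σ.arr .c1) (j + 1))) ?_ ?_ ?_ ?_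
  · intro τ hs
    simp [hs.var .m, hm]
  · simp [hW]
  · rintro a τ ha hs hv ⟨h1, h2⟩
    obtain ⟨o1, -, o2⟩ := Family.owner_spec hc (v := a + 1) (by omega) (by omega)
    have hlt := o1.1
    have g1 := (hc (a + 1) (by omega)).le
    have g2 := (hc (a + 1) (by omega)).le_top
    have hmod : σ.arr .c1 (a + 1) - σ.arr .c1 (a + 1) / (k * n) * (k * n) =
        D.owner (σ.arr .c1) (a + 1) := by
      rw [Family.owner, Nat.mod_def, mul_comm]
    have hdiv : σ.arr .c1 (a + 1) / (k * n) * (k * n) ≤ σ.arr .c1 (a + 1) :=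
      Nat.div_mul_le_self _ _
    have hdiv' : σ.arr .c1 (a + 1) / (k * n) ≤ σ.arr .c1 (a + 1) := Nat.div_le_self _ _
    simp [hv, hs.arr .c1, hs.arr .c2, hs.arr .vo, hs.var .k, hs.var .m, hs.var .B, hk, hm, hB, hmod]
    and_intros
    any_goals omega
    · intro f hf
      rw [Function.update_of_ne (by omega)]
      exact h1 f hf
    · intro j hj
      by_cases hja : j = a
      · subst hja
        simp [h1 _ hlt]
      · have := h2 j (by omega)
        rw [Function.update_of_ne (by omega), Function.update_of_ne (by omega),
          Function.update_of_ne (by omega), Function.update_of_ne (by omega),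
          Function.update_of_ne (by omega)]
        exact this
  · rintro t τ ht hs ⟨-, h⟩
    exact ⟨by omega, h⟩

theorem copyWeights_wp (hk : σ.var .k = k) (hm : σ.var .m = n - 1) (hk0 : 0 < k)
    (hZ : k * (2 * n) * (2 * n) + 10 * (k * n) + 20 < Z) :
    Wp Z copyWeightsProg σ fun t σ' => t ≤ 3 * n + 2 ∧ ∀ j < n - 1,
      σ'.wt j = σ.wt (k * (n - 1) + j) := by
  have hkn : n ≤ k * n := Nat.le_mul_of_pos_left n hk0
  have hkn' : n - 1 ≤ k * (n - 1) := Nat.le_mul_of_pos_left _ hk0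
  have hk' : k * (n - 1) ≤ k * n := Nat.mul_le_mul_left _ (Nat.sub_le _ _)
  refine Wp.upTo (n - 1) 1 (by omega) (fun a τ => (∀ j < n - 1, τ.wt (k * (n - 1) + j) =
    σ.wt (k * (n - 1) + j)) ∧ ∀ j < a, τ.wt j = σ.wt (k * (n - 1) + j)) ?_ (by simp) ?_ ?_
  · intro τ hs
    simp [hs.var .m, hm]
  · rintro a τ ha hs hv ⟨h1, h2⟩
    simp [hv, hs.var .k, hs.var .m, hk, hm]
    and_intros
    any_goals omega
    · intro j hj
      rw [Function.update_of_ne (by omega)]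
      exact h1 j hj
    · intro j hj
      by_cases hja : j = a
      · subst hja
        simp [h1 j ha]
      · rw [Function.update_of_ne hja]
        exact h2 j (by omega)
  · rintro t τ ht hs ⟨-, h⟩
    exact ⟨by omega, h⟩

/-- The final flow tree gives that every best cut owns a vertex; with the computed codes this is all
`exists_rooted_merged` needs to recognize the output as the tree of best cuts. -/
theorem mergeTrees_wp (hD : D.Laminar) (hk : σ.var .k = k) (hn : σ.var .n = n) (hW : σ.wt = D.W)
    (hio : ∀ f < k * (n - 1), σ.arr .io (2 * f) = D.U f ∧ σ.arr .io (2 * f + 1) = D.V f)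
    (h0 : ∀ a, a ≠ .io → ∀ j, σ.arr a j = 0)
    (hZ : k * (2 * n) * (2 * n) + 10 * (k * n) + 20 < Z) :
    Wp Z mergeTreesProg σ fun t σ' => t ≤ 400 * (k * n * (Nat.log 2 n + 1)) ∧
      ∃ par dep own : ℕ → ℕ, Rooted n par dep ∧ (∀ v, 0 < v → v < n → D.Best (own v)) ∧
        (∀ f, D.Best f → ∃ v, 0 < v ∧ v < n ∧ own v = f) ∧
        (∀ v z, 0 < v → v < n → z < n → (Anc par v z ↔ D.cut (own v) z)) ∧
        ∀ j < n - 1, σ'.arr .io (2 * j) = j + 1 ∧ σ'.arr .io (2 * j + 1) = par (j + 1) ∧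
          σ'.wt j = D.W (own (j + 1)) := by
  have hn0 := D.n_pos
  have hk0 := D.k_pos
  have hkn : n ≤ k * n := Nat.le_mul_of_pos_left n D.k_pos
  have hkn' : k ≤ k * n := Nat.le_mul_of_pos_right k D.n_pos
  rw [mergeTreesProg, wp_seq, wp_assign]
  refine ⟨by simp [hn]; omega, ?_⟩
  rw [wp_seq]
  refine (loadFirst_wp (D := D) (by simp [hn]) (by simpa using hio)
    (by simpa using h0 .eu (by simp) _) (by simpa using h0 .ev (by simp) _)
    (by simpa using h0 .ei (by simp) _) hZ).mono fun t₁ σ₁ s₁ ⟨ht₁, hF₁⟩ => ?_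
  have k₁ : σ₁.var .k = k := by simp [s₁.var .k, hk]
  have n₁ : σ₁.var .n = n := by simp [s₁.var .n, hn]
  have m₁ : σ₁.var .m = n - 1 := by simp [s₁.var .m, hn]
  have W₁ : σ₁.wt = D.W := by simp [s₁.wt, hW]
  have io₁ : σ₁.arr .io = σ.arr .io := by simp [s₁.arr .io]
  have tab₁ : σ₁.arr .tab = σ.arr .tab := by simp [s₁.arr .tab]
  have mark₁ : σ₁.arr .mark = σ.arr .mark := by simp [s₁.arr .mark]
  rw [wp_seq]
  refine (rounds_wp (D := D) k₁ n₁ m₁ W₁ (by rwa [io₁]) hF₁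
    (by rw [tab₁]; exact h0 .tab (by simp)) hZ).mono fun t₂ σ₂ s₂ ⟨ht₂, hF₂⟩ => ?_
  have k₂ := (s₂.var .k).trans k₁
  have n₂ := (s₂.var .n).trans n₁
  have m₂ := (s₂.var .m).trans m₁
  have W₂ := s₂.wt.trans W₁
  have io₂ := (s₂.arr .io).trans io₁
  rw [wp_seq]
  refine (mark_wp hD n₂ hF₂ (by rw [s₂.arr .mark, mark₁]; exact h0 .mark (by simp)) hZ).mono
    fun t₃ σ₃ s₃ ⟨ht₃, hmark⟩ => ?_
  have k₃ := (s₃.var .k).trans k₂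
  have n₃ := (s₃.var .n).trans n₂
  have m₃ := (s₃.var .m).trans m₂
  have W₃ := s₃.wt.trans W₂
  have io₃ := (s₃.arr .io).trans io₂
  rw [wp_seq, wp_assign]
  refine ⟨by simp [k₃, n₃]; omega, ?_⟩
  rw [wp_seq]
  refine (initCodes_wp (n := n) (k := k) (by simp [n₃]) (by simp [k₃, n₃]) hk0 hZ).mono
    fun t₄ σ₄ s₄ ⟨ht₄, hc₄⟩ => ?_
  have k₄ : σ₄.var .k = k := by simp [s₄.var .k, k₃]
  have n₄ : σ₄.var .n = n := by simp [s₄.var .n, n₃]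
  have m₄ : σ₄.var .m = n - 1 := by simp [s₄.var .m, m₃]
  have B₄ : σ₄.var .B = k * n := by simp [s₄.var .B, k₃, n₃]
  have W₄ : σ₄.wt = D.W := by simp [s₄.wt, W₃]
  have io₄ : σ₄.arr .io = σ.arr .io := by simp [s₄.arr .io, io₃]
  have mark₄ : σ₄.arr .mark = σ₃.arr .mark := by simp [s₄.arr .mark]
  rw [wp_seq]
  refine (trees_wp (D := D) k₄ n₄ m₄ B₄ (by rwa [io₄]) (by rwa [mark₄]) hc₄ hZ).mono
    fun t₅ σ₅ s₅ ⟨ht₅, hc⟩ => ?_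
  have k₅ := (s₅.var .k).trans k₄
  have n₅ := (s₅.var .n).trans n₄
  have m₅ := (s₅.var .m).trans m₄
  have B₅ := (s₅.var .B).trans B₄
  have W₅ := s₅.wt.trans W₄
  rw [wp_seq]
  refine (owners_wp hD n₅ hc hZ).mono fun t₆ σ₆ s₆ ⟨ht₆, hvo⟩ => ?_
  have c1₆ := s₆.arr .c1
  have c2₆ := s₆.arr .c2
  rw [wp_seq]
  refine (output_wp (D := D) ((s₆.var .k).trans k₅) ((s₆.var .m).trans m₅) ((s₆.var .B).trans B₅)
    (s₆.wt.trans W₅) (by rwa [c1₆, c2₆]) hZ).mono fun t₇ σ₇ s₇ ⟨ht₇, hout⟩ => ?_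
  refine (copyWeights_wp ((s₇.var .k).trans ((s₆.var .k).trans k₅))
    ((s₇.var .m).trans ((s₆.var .m).trans m₅)) hk0 hZ).mono fun t₈ σ₈ s₈ ⟨ht₈, hcopy⟩ => ?_
  rw [c1₆, c2₆] at hout
  obtain ⟨-, hsurj⟩ := hF₂.best_iff hD hc
  obtain ⟨dep, hrooted, hanc⟩ := Family.exists_rooted_merged hD hc hsurj hvo
  refine ⟨?_, _, dep, D.owner (σ₅.arr .c1), hrooted,
    fun v hv0 hv => (Family.owner_spec hc hv0 hv).1, hsurj, hanc, fun j hj => ?_⟩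
  -- The rounds contribute 210 knL and the rooting passes 61 kn; everything else is linear in kn.
  · have hL : 1 ≤ Nat.log 2 n + 1 := by omega
    generalize Nat.log 2 n + 1 = L at *
    have e1 : k * (210 * (n * L) + 3) = 210 * (k * n * L) + 3 * k := by ring
    have e2 : k * (61 * n + 2) = 61 * (k * n) + 2 * k := by ring
    have e3 : k * n ≤ k * n * L := Nat.le_mul_of_pos_right _ hL
    omega
  · obtain ⟨h1, h2, h3⟩ := hout j hj
    rw [s₈.arr .io, h1, h2, hcopy j hj, h3]
    exact ⟨rfl, rfl, rfl⟩

end main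

end CutMerge

/-! ### From the machine input to a family, and memory layout. -/

namespace CutMerge

/-! ### The input -/

/-- A stored tree, rooted at `0`: the edge from `x` to its parent is entry `ed x`, and `ch j` is
the lower end of entry `j`. -/
theorem exists_rooted_of_storedAt {n b : ℕ} (hn : 0 < n) {T : CutTree (Fin n)} {s : State}
    (h : T.StoredAt s b) :
    ∃ par dep ch ed : ℕ → ℕ, ∃ hr : Rooted n par dep, IsParent T.graph par ∧
      (∀ x, 0 < x → x < n → ed x < n - 1 ∧ ch (ed x) = x) ∧
      (∀ j < n - 1, 0 < ch j ∧ ch j < n ∧ ed (ch j) = j) ∧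
      (∀ x, 0 < x → x < n →
        (s.mem (2 * (b + ed x)) = x ∧ s.mem (2 * (b + ed x) + 1) = par x) ∨
        (s.mem (2 * (b + ed x) + 1) = x ∧ s.mem (2 * (b + ed x)) = par x)) ∧
      ∀ x : Fin n, (x : ℕ) ≠ 0 → T.weight (hr.edge x) = s.wmem (b + ed x) := by
  obtain ⟨f, hf⟩ := h
  obtain ⟨par, dep, hr, hp⟩ := exists_rooted T.isTree hn
  -- The permutation between the stored order of the edges and their order by lower end.
  let π : Fin (n - 1) ≃ Fin (n - 1) := f.trans (hr.edgeEquiv hp).symm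
  have hedge : ∀ x (h0 : 0 < x) (hx : x < n),
      (f (π.symm ⟨x - 1, by omega⟩) : Sym2 (Fin n)) = hr.edge ⟨x, hx⟩ := by
    intro x h0 hx
    have : f (π.symm ⟨x - 1, by omega⟩) = hr.edgeEquiv hp ⟨x - 1, by omega⟩ := by
      simp [π]
    rw [this]
    have hx' : (⟨x - 1 + 1, by omega⟩ : Fin n) = ⟨x, hx⟩ :=
      Fin.ext (Nat.sub_add_cancel h0)
    rw [← hx']
    rfl
  let ch : ℕ → ℕ := fun j => if hj : j < n - 1 then π ⟨j, hj⟩ + 1 else 0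
  let ed : ℕ → ℕ := fun x => if hx : x - 1 < n - 1 then π.symm ⟨x - 1, hx⟩ else 0
  have hed : ∀ x (h0 : 0 < x) (hx : x < n), ed x = π.symm ⟨x - 1, by omega⟩ := by
    intro x h0 hx
    simp only [ed]
    rw [dif_pos (by omega)]
  refine ⟨par, dep, ch, ed, hr, hp, fun x h0 hx => ?_, fun j hj => ?_, fun x h0 hx => ?_,
    fun x h0 => ?_⟩
  · rw [hed x h0 hx]
    refine ⟨Fin.is_lt _, ?_⟩
    simp [ch]
    omega
  · have h1 := (π ⟨j, hj⟩).2
    have h2 : ch j = π ⟨j, hj⟩ + 1 := by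
      simp only [ch]
      rw [dif_pos hj]
    refine ⟨by omega, by omega, ?_⟩
    rw [hed _ (by omega) (by omega)]
    simp [h2]
  · obtain ⟨u, v, h1, h2, h3, -⟩ := hf (π.symm ⟨x - 1, by omega⟩)
    rw [hedge x h0 hx, Rooted.edge, Sym2.eq_iff, Fin.ext_iff, Fin.ext_iff, Fin.ext_iff,
      Fin.ext_iff] at h1
    rw [hed x h0 hx, h2, h3]
    simp only at h1
    omega
  · obtain ⟨u, v, -, -, -, h4⟩ := hf (π.symm ⟨x - 1, by omega⟩)
    rw [hed x (by omega) x.2, h4, hedge x (by omega) x.2]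

theorem IsInput.exists_family {k n : ℕ} {T : Fin k → CutTree (Fin n)} {s : State}
    (hk : 0 < k) (hn : 0 < n) (h : IsInput T s) :
    ∃ D : Family n k, D.Describes T ∧ D.W = s.wmem ∧
      ∀ f, D.U f = s.mem (2 * f) ∧ D.V f = s.mem (2 * f + 1) := by
  have hex : ∀ i : ℕ, ∃ par dep ch ed : ℕ → ℕ, ∀ hi : i < k, ∃ hr : Rooted n par dep,
      IsParent (T ⟨i, hi⟩).graph par ∧
      (∀ x, 0 < x → x < n → ed x < n - 1 ∧ ch (ed x) = x) ∧
      (∀ j < n - 1, 0 < ch j ∧ ch j < n ∧ ed (ch j) = j) ∧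
      (∀ x, 0 < x → x < n →
        (s.mem (2 * (i * (n - 1) + ed x)) = x ∧
          s.mem (2 * (i * (n - 1) + ed x) + 1) = par x) ∨
        (s.mem (2 * (i * (n - 1) + ed x) + 1) = x ∧
          s.mem (2 * (i * (n - 1) + ed x)) = par x)) ∧
      ∀ x : Fin n, (x : ℕ) ≠ 0 →
        (T ⟨i, hi⟩).weight (hr.edge x) = s.wmem (i * (n - 1) + ed x) := by
    intro i
    by_cases hi : i < k
    · obtain ⟨par, dep, ch, ed, hr, hprop⟩ := exists_rooted_of_storedAt hn (h.trees ⟨i, hi⟩)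
      exact ⟨par, dep, ch, ed, fun _ => ⟨hr, hprop⟩⟩
    · exact ⟨id, id, id, id, fun hi' => absurd hi' hi⟩
  choose par dep ch ed hall using hex
  choose hr hp hed hch hends hw using hall
  let D : Family n k :=
    { U := fun f => s.mem (2 * f)
      V := fun f => s.mem (2 * f + 1)
      W := s.wmem
      par := par
      dep := dep
      eid := fun i x => i * (n - 1) + ed i x
      ch := fun f => ch (f / (n - 1)) (f % (n - 1))
      n_pos := hn
      k_pos := hk
      rooted := hr
      eid_spec := by
        intro i hi x h0 hx
        obtain ⟨h1, h2⟩ := hed i hi x h0 hx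
        refine ⟨by omega, by rw [add_mul]; omega, ?_⟩
        rw [mul_comm, Nat.mul_add_div (by omega), Nat.mul_add_mod, Nat.div_eq_of_lt h1,
          Nat.mod_eq_of_lt h1, add_zero, h2]
      ch_spec := by
        intro i hi f h1 h2
        rw [add_mul, one_mul] at h2
        obtain ⟨j, rfl⟩ : ∃ j, f = i * (n - 1) + j := ⟨f - i * (n - 1), by omega⟩
        have hj : j < n - 1 := by omega
        rw [mul_comm, Nat.mul_add_div (by omega), Nat.mul_add_mod, Nat.div_eq_of_lt hj,
          Nat.mod_eq_of_lt hj, add_zero]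
        obtain ⟨g1, g2, g3⟩ := hch i hi j hj
        exact ⟨g1, g2, by rw [g3]⟩
      ends := hends }
  exact ⟨D, ⟨fun i => hp i i.2, fun i x hx => hw i i.2 x hx⟩, rfl, fun f => ⟨rfl, rfl⟩⟩

/-! ### The machine program -/

/-- Compute the distance of consecutive arrays in memory. -/
def strideProg : Program :=
  .seq (.instr (.arith .mul tempReg 0 1))
    (.seq (.instr (.const (tempReg + 1) 1))
      (.seq (.instr (.arith .add tempReg tempReg (tempReg + 1)))
        (.seq (.instr (.arith .mul tempReg tempReg tempReg))
          (.seq (.instr (.const (tempReg + 1) 40))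
            (.instr (.arith .mul strideReg tempReg (tempReg + 1)))))))

/-- A common array length that exceeds 4kn² + 10kn + 20, the space for the cell tables of all
rounds, and can be computed from k and n in a few instructions. -/
def stride (k n : ℕ) : ℕ := (k * n + 1) * (k * n + 1) * 40

/-- Here 26 * 40 = 1040 < 2 ^ 11, and kn + 1 is at most 2 to the power log(kn) + 1, twice. This is
the origin of the word-length constant 13 = 11 + 2. -/
theorem stride_lt {k n w : ℕ} (hw : 13 * (Nat.log 2 (k * n) + 1) ≤ w) :
    26 * stride k n < 2 ^ w := by
  have h1 : k * n + 1 ≤ 2 ^ (Nat.log 2 (k * n) + 1) := Nat.lt_pow_succ_log_self (by norm_num) _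
  have h2 : 2 ≤ 2 ^ (Nat.log 2 (k * n) + 1) := by
    rw [pow_succ]
    have := Nat.one_le_two_pow (n := Nat.log 2 (k * n))
    omega
  calc 26 * stride k n < 2 ^ 11 * ((k * n + 1) * (k * n + 1)) := by
        rw [stride]
        have : 0 < (k * n + 1) * (k * n + 1) := by positivity
        omega
    _ ≤ (2 ^ (Nat.log 2 (k * n) + 1)) ^ 11 *
        (2 ^ (Nat.log 2 (k * n) + 1) * 2 ^ (Nat.log 2 (k * n) + 1)) := by gcongr
    _ = 2 ^ (13 * (Nat.log 2 (k * n) + 1)) := by ring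
    _ ≤ 2 ^ w := Nat.pow_le_pow_right (by norm_num) hw

theorem strideProg_runs {w k n : ℕ} {s : State} (hk : s.reg 0 = k) (hn : s.reg 1 = n)
    (hw : 13 * (Nat.log 2 (k * n) + 1) ≤ w) :
    ∃ s', Runs w strideProg s 6 s' ∧ s'.mem = s.mem ∧ s'.wmem = s.wmem ∧
      s'.reg strideReg = stride k n ∧ ∀ r < 30, s'.reg r = s.reg r := by
  have hlt := stride_lt hw
  have h0 : (k * n + 1) ≤ (k * n + 1) * (k * n + 1) := Nat.le_mul_of_pos_left _ (Nat.succ_pos _)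
  rw [stride] at hlt
  refine ⟨_, .seq (.instr _ _) (.seq (.instr _ _) (.seq (.instr _ _) (.seq (.instr _ _)
    (.seq (.instr _ _) (.instr _ _))))), rfl, rfl, ?_, fun r hr => ?_⟩
  · simp only [Instr.exec, strideReg, tempReg, ArithOp.eval]
    simp [hk, hn, stride]
    exact Nat.mod_eq_of_lt (by omega)
  · simp only [Instr.exec, strideReg, tempReg, ArithOp.eval]
    simp [Function.update_of_ne (show r ≠ 30 by omega), Function.update_of_ne (show r ≠ 31 by omega),
      Function.update_of_ne (show r ≠ 32 by omega)]

theorem exists_cutTree {n : ℕ} (hn : 0 < n) {par dep : ℕ → ℕ} (hr : Rooted n par dep)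
    (W : ℕ → ℝ) : ∃ T : CutTree (Fin n), IsParent T.graph par ∧
      ∀ x : Fin n, (x : ℕ) ≠ 0 → T.weight (hr.edge x) = W x := by
  classical
  obtain ⟨G, hG⟩ := hr.exists_isParent
  refine ⟨⟨G, hr.isTree hG hn, fun e => if h : ∃ x : Fin n, (x : ℕ) ≠ 0 ∧ hr.edge x = e then
    W h.choose else 0⟩, hG, fun x hx => ?_⟩
  have h : ∃ y : Fin n, (y : ℕ) ≠ 0 ∧ hr.edge y = hr.edge x := ⟨x, hx, rfl⟩
  simp only
  rw [dif_pos h, hr.edge_injOn h.choose_spec.1 hx h.choose_spec.2]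

end CutMerge

theorem mainTheorem4 :
    ∃ (P : CutMerge.Program) (c C : ℕ), 0 < c ∧
      ∀ (k n : ℕ) (T : Fin k → CutMerge.CutTree (Fin n)),
        1 ≤ k → 1 ≤ n → CutMerge.NonCrossing T →
        ∀ w : ℕ, c * (Nat.log 2 (k * n) + 1) ≤ w →
        ∀ s : CutMerge.State, CutMerge.IsInput T s →
          ∃ (t : ℕ) (s' : CutMerge.State) (T₀ : CutMerge.CutTree (Fin n)),
            CutMerge.Runs w P s t s' ∧
            t ≤ C * (k * n * (Nat.log 2 n + 1) ^ 2) ∧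
            T₀.StoredAt s' 0 ∧
            CutMerge.IsMerge T T₀ := by
  obtain ⟨K, hK⟩ := CutMerge.mergeTreesProg.exists_costLE
  refine ⟨.seq CutMerge.strideProg CutMerge.mergeTreesProg.compile, 13, 400 * K + 6, by norm_num,
    fun k n T hk hn hT w hw s hs => ?_⟩
  obtain ⟨D, hD, hDW, hDUV⟩ := hs.exists_family hk hn
  obtain ⟨s₁, hrun₁, hmem₁, hwmem₁, hst₁, hreg₁⟩ :=
    CutMerge.strideProg_runs hs.reg_zero hs.reg_one hw
  have hlt := CutMerge.stride_lt hw
  obtain ⟨Z, hZdef⟩ : ∃ Z, CutMerge.stride k n = Z := ⟨_, rfl⟩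
  rw [hZdef] at hst₁ hlt
  have hkn : n ≤ k * n := Nat.le_mul_of_pos_left n hk
  have hk' : k * (n - 1) ≤ k * n := Nat.mul_le_mul_left _ (Nat.sub_le _ _)
  -- The cell tables take 4kn² entries, and n ≤ kn bounds this by a multiple of (kn)².
  have hZ : k * (2 * n) * (2 * n) + 10 * (k * n) + 20 < Z := by
    have h1 : k * (2 * n) * (2 * n) ≤ 4 * (k * n * (k * n)) := by
      calc k * (2 * n) * (2 * n) = 4 * (k * n * n) := by ring
        _ ≤ 4 * (k * n * (k * n)) := by gcongr
    have h2 : Z = 40 * (k * n * (k * n)) + 80 * (k * n) + 40 := by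
      rw [← hZdef, CutMerge.stride]
      ring
    omega
  let σ : CutMerge.Store :=
    { var := fun a => s.reg a.reg
      arr := fun a j => if a = .io then s.mem j else 0
      wt := s.wmem }
  have hrep : CutMerge.Rep Z σ s₁ := by
    refine ⟨fun a => hreg₁ _ a.reg_lt, hst₁, fun a j hj => ?_, fun j _ => by rw [hwmem₁]⟩
    rw [hmem₁]
    by_cases ha : a = .io
    · subst ha
      simp [σ, show CutMerge.Arr.io.pos = 0 from rfl]
    · have hpos : 0 < a.pos :=
        Nat.pos_of_ne_zero fun h0 => ha (CutMerge.Arr.pos_injective h0)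
      have : Z ≤ a.pos * Z := Nat.le_mul_of_pos_left Z hpos
      simp only [σ, if_neg ha]
      exact hs.mem_other _ (by omega)
  have hio : ∀ f < k * (n - 1), σ.arr .io (2 * f) = D.U f ∧ σ.arr .io (2 * f + 1) = D.V f :=
    fun f _ => ⟨(hDUV f).1.symm, (hDUV f).2.symm⟩
  obtain ⟨t, σ', hexec, ht, par, dep, own, hr, hown, hsurj, hcut, hout⟩ :=
    CutMerge.mergeTrees_wp (D := D) (σ := σ) (hD.laminar hT) hs.reg_zero hs.reg_one hDW.symm hio
      (fun a ha j => if_neg ha) hZ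
  obtain ⟨t', s', hrun, hrep', ht'⟩ :=
    CutMerge.Stmt.compile_runs (w := w) (by omega) (by omega) hexec hK hrep
  obtain ⟨T₀, hT₀, hweight⟩ := CutMerge.exists_cutTree hn hr fun x => D.W (own x)
  refine ⟨6 + t', s', T₀, .seq hrun₁ hrun, ?_, ?_, hD.isMerge hr hown hsurj hcut hT₀ hweight⟩
  · have hL : 1 ≤ Nat.log 2 n + 1 := by omega
    generalize Nat.log 2 n + 1 = L at *
    -- The program runs in time O(knL); the second factor L is simply given away.
    have h1 : k * n * L ≤ k * n * L ^ 2 := Nat.mul_le_mul_left _ (Nat.le_self_pow (by norm_num) L)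
    have h2 : 1 ≤ k * n * L := Nat.mul_pos (Nat.mul_pos hk hn) hL
    calc 6 + t' ≤ 6 * (k * n * L) + K * (400 * (k * n * L)) :=
          Nat.add_le_add (by omega) (ht'.trans (Nat.mul_le_mul_left _ ht))
      _ = (400 * K + 6) * (k * n * L) := by ring
      _ ≤ (400 * K + 6) * (k * n * L ^ 2) := Nat.mul_le_mul_left _ h1
  -- Output entry j is the edge from vertex j + 1 to its parent.
  · refine ⟨hr.edgeEquiv hT₀, fun j => ⟨⟨j + 1, by omega⟩, ⟨par (j + 1), hr.par_lt _ (by omega)⟩,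
      rfl, ?_⟩⟩
    obtain ⟨h1, h2, h3⟩ := hout j j.2
    have m1 := hrep'.mem .io (2 * j) (by omega)
    have m2 := hrep'.mem .io (2 * j + 1) (by omega)
    have m3 := hrep'.wmem j (by omega)
    rw [show CutMerge.Arr.io.pos = 0 from rfl, zero_mul, zero_add] at m1 m2
    rw [zero_add, m1, m2, m3, h1, h2, h3]
    exact ⟨rfl, rfl, (hweight ⟨j + 1, by omega⟩ (by simp)).symm⟩
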